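/- Let $Q$ be a finite-dimensional smooth manifold (Hausdorff, second countable), $k\ge 1$, and let $\mathrm T^rQ=J^r_0(\mathbb R,Q)$ be its $r$-th order tangent bundle, with natural coordinates $(q_0^i,\dots,q_r^i)$. Let $L\in C^\infty(\mathrm T^kQ\times\mathbb R)$ be a Lagrangian of order $k$ (pulled back to higher-order bundles without change of notation), and let $z$ be the coordinate of $\mathbb R$. Let $$D_LF=\sum_{\alpha=0}^{r}q^i_{\alpha+1}\frac{\partial F}{\partial q^i_\alpha}+L\frac{\partial F}{\partial z}-\frac{\partial L}{\partial z}F,\qquad F\in C^\infty(\mathrm T^rQ\times\mathbb R)\quad(r\ge k-1),$$ be the Lagrangian total derivative: $D_LF=\mathcal L_\Gamma(\tau^*F)-\frac{\partial L}{\partial z}\tau^*F$ for any holonomic vector field $\Gamma$ on $\mathrm T^{r+1}Q\times\mathbb R$ with $\Gamma(z)=L$, where $\tau\colon\mathrm T^{r+1}Q\times\mathbb R\to\mathrm T^rQ\times\mathbb R$ is the projection; the same formula defines $D_L$ on differential forms. With the vertical endomorphisms $\mathcal J_\beta=\sum_\alpha\frac{(\beta+\alpha)!}{\alpha!}\,\mathrm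 dq^i_\alpha\otimes\frac{\partial}{\partial q^i_{\beta+\alpha}}$ and the canonical vector fields $\Delta_\beta=\sum_\alpha\frac{(\beta+\alpha)!}{\alpha!}\,q^i_{\alpha+1}\frac{\partial}{\partial q^i_{\beta+\alpha}}$, put on $\mathrm T^{2k-1}Q\times\mathbb R$ $$\theta_L=\sum_{\beta=1}^k\frac{(-1)^{\beta-1}}{\beta!}D_L^{\beta-1}\,i(\mathcal J_\beta)\mathrm dL,\qquad \eta_L=\mathrm dz-\theta_L,\qquad E_L=\sum_{\beta=1}^k\frac{(-1)^{\beta-1}}{\beta!}D_L^{\beta-1}(\Delta_\beta(L))-L .$$ The generalized Legendre map $\mathrm{Leg}\colon\mathrm T^{2k-1}Q\times\mathbb R\to \mathrm T^*(\mathrm T^{k-1}Q)\times\mathbb R$ sends $(p,z)$ to $(\xi,z)$, where $\xi$ is the covector at the projection of $p$ to $\mathrm T^{k-1}Q$ such that $(\theta_L)_{(p,z)}(u)=\langle\xi,\bar u\rangle$ for every tangent vector $u$ at $(p,z)$, $\bar u$ being the projection of $u$ to $\mathrm T(\mathrm T^{k-1}Q)$. Assume that $L$ is regular, i.e. that $\mathrm{Leg}$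 is a local diffeomorphism. Let $\eta=\mathrm dz-\theta$ be the canonical contact form of $\mathrm T^*(\mathrm T^{k-1}Q)\times\mathbb R$ ($\theta$ the canonical one-form of the cotangent bundle), with Reeb vector field $\partial/\partial z$. Let $\mathcal W=\mathrm T^{2k-1}Q\times_{\mathrm T^{k-1}Q}\mathrm T^*(\mathrm T^{k-1}Q)\times\mathbb R$, with projections $\varrho_1\colon\mathcal W\to\mathrm T^{2k-1}Q\times\mathbb R$ and $\varrho_2\colon\mathcal W\to \mathrm T^*(\mathrm T^{k-1}Q)\times\mathbb R$, let $\eta_{\mathcal W}=\varrho_2^*\eta$, let $\mathcal H=\mathcal C-\varrho_1^*L$ with $\mathcal C(p,\xi,z)=\langle\xi,j_k(p)\rangle$, where $j_k(p)=(q_0,\dots,q_{k-1};q_1,\dots,q_k)\in\mathrm T(\mathrm T^{k-1}Q)$ (so $\mathcal C=\sum_{\alpha=0}^{k-1}p_i^\alpha q^i_{\alpha+1}$), and let $\mathcal W_1=\{(p,z;\mathrm{Leg}(p,z))\}\subset\mathcal W$ be the graph of $\mathrm{Leg}$. Let $X_{\mathcal H}$ be a smooth vector field on $\mathcal W$, tangent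 to $\mathcal W_1$, which at the points of $\mathcal W_1$ satisfies $$i(X_{\mathcal H})\mathrm d\eta_{\mathcal W}=\mathrm d\mathcal H-\frac{\partial\mathcal H}{\partial z}\,\eta_{\mathcal W},\qquad i(X_{\mathcal H})\eta_{\mathcal W}=-\mathcal H .$$ Then $\eta_L$ has a unique Reeb vector field $\mathcal R_L$, it is smooth, and there is a unique vector field $X_L$ on $\mathrm T^{2k-1}Q\times\mathbb R$ with $$i(X_L)\mathrm d\eta_L=\mathrm dE_L-\mathcal R_L(E_L)\,\eta_L,\qquad i(X_L)\eta_L=-E_L ;$$ $X_L$ is smooth, and $X_L\circ\varrho_1=\mathrm T\varrho_1\circ X_{\mathcal H}$ on $\mathcal W_1$. Moreover, every point of $\mathrm T^{2k-1}Q\times\mathbb R$ has an open neighbourhood on which $\mathrm{Leg}$ is injective, and for every open $U\subset\mathrm T^{2k-1}Q\times\mathbb R$ on which $\mathrm{Leg}$ is injective the set $V=\mathrm{Leg}(U)$ is open in $\mathrm T^*(\mathrm T^{k-1}Q)\times\mathbb R$, and there are a smooth function $H$ and a smooth vector field $X_H$ on $V$, determined by $$H\circ\mathrm{Leg}=E_L\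 \text{ on }U,\qquad X_H\circ\varrho_2=\mathrm T\varrho_2\circ X_{\mathcal H}\ \text{ on }\mathcal W_1\cap\varrho_1^{-1}(U),$$ such that $\mathcal H=H\circ\varrho_2$ on $\mathcal W_1\cap\varrho_1^{-1}(U)$, such that $X_H$ solves the contact Hamilton equations $$i(X_H)\mathrm d\eta=\mathrm dH-\frac{\partial H}{\partial z}\,\eta,\qquad i(X_H)\eta=-H\qquad\text{on }V,$$ and such that $\mathrm{Leg}_*X_L=X_H$, i.e. $\mathrm T\,\mathrm{Leg}\circ X_L=X_H\circ\mathrm{Leg}$ on $U$. (If $\mathrm{Leg}$ is a global diffeomorphism, one can take $U=\mathrm T^{2k-1}Q\times\mathbb R$, and then $V=\mathrm T^*(\mathrm T^{k-1}Q)\times\mathbb R$.) -/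

import Mathlib

open Set Filter Topology Bundle
open scoped Manifold ContDiff Bundle

noncomputable section

namespace HOContact

/-! Calculus facts used to put a manifold structure on spaces of jets. -/

section Analysis
variable {E F : Type*} [NormedAddCommGroup E] [NormedSpace ℝ E] [NormedAddCommGroup F]
  [NormedSpace ℝ F]

theorem iteratedDeriv_comp_congr {c c' : ℝ → E} {f : E → F} (hc : ContDiffAt ℝ ∞ c 0)
    (hc' : ContDiffAt ℝ ∞ c' 0) (hf : ContDiffAt ℝ ∞ f (c 0)) {k : ℕ}
    (h : ∀ a ≤ k, iteratedDeriv a c 0 = iteratedDeriv a c' 0) {a : ℕ} (ha : a ≤ k) :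
    iteratedDeriv a (f ∘ c) 0 = iteratedDeriv a (f ∘ c') 0 := by
  have h0 : c 0 = c' 0 := by simpa using h 0 (Nat.zero_le k)
  have hF : ∀ b ≤ k, iteratedFDeriv ℝ b c 0 = iteratedFDeriv ℝ b c' 0 := by
    intro b hb
    ext
    rw [iteratedFDeriv_apply_eq_iteratedDeriv_mul_prod,
      iteratedFDeriv_apply_eq_iteratedDeriv_mul_prod, h b hb]
  have hle : (a : WithTop ℕ∞) ≤ ∞ := by exact_mod_cast le_top
  rw [iteratedDeriv_eq_iteratedFDeriv, iteratedDeriv_eq_iteratedFDeriv,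
    iteratedFDeriv_comp hf hc hle, iteratedFDeriv_comp (h0 ▸ hf) hc' hle, ← h0]
  congr 1
  simp only [FormalMultilinearSeries.taylorComp]
  refine Finset.sum_congr rfl fun p _ => ?_
  ext
  simp only [FormalMultilinearSeries.compAlongOrderedFinpartition_apply]
  congr 1
  funext i
  simp only [OrderedFinpartition.applyOrderedFinpartition, ftaylorSeries]
  rw [hF _ ((p.partSize_le i).trans ha)]

theorem contDiffOn_iteratedDeriv_snd {G : E × ℝ → F} {S : Set (E × ℝ)} (hS : IsOpen S)
    (hG : ContDiffOn ℝ ∞ G S) (a : ℕ) :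
    ContDiffOn ℝ ∞ (fun x : E × ℝ => iteratedDeriv a (fun s => G (x.1, s)) x.2) S := by
  induction a with
  | zero => simpa using hG
  | succ a ih =>
    have h1 := (ih.fderiv_of_isOpen hS (m := ∞) (by simp)).clm_apply
      (contDiffOn_const (c := ((0 : E), (1 : ℝ))))
    refine h1.congr fun x hx => ?_
    rw [iteratedDeriv_succ]
    have hd := ((ih.differentiableOn (by simp)).differentiableAt (hS.mem_nhds hx)).hasFDerivAt
    have hl : HasDerivAt (fun s : ℝ => (x.1, s)) ((0 : E), (1 : ℝ)) x.2 :=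
      (hasDerivAt_const x.2 x.1).prodMk (hasDerivAt_id x.2)
    exact (HasFDerivAt.comp_hasDerivAt (f := fun s : ℝ => (x.1, s)) x.2 hd hl).deriv

end Analysis

section Jets
variable {E : Type*} [NormedAddCommGroup E] [NormedSpace ℝ E]

/-- The polynomial curve `t ↦ ∑ₐ (tᵃ / a!) qₐ` in the model space, whose `a`-th derivative at `0`
is `qₐ`. -/
def polyCurve {k : ℕ} (q : Fin (k + 1) → E) (t : ℝ) : E :=
  ∑ a : Fin (k + 1), (t ^ (a : ℕ) / ((a : ℕ).factorial : ℝ)) • q a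

theorem contDiff_polyCurve (k : ℕ) :
    ContDiff ℝ ∞ (fun x : (Fin (k + 1) → E) × ℝ => polyCurve x.1 x.2) := by
  unfold polyCurve
  fun_prop

theorem polyCurve_zero {k : ℕ} (q : Fin (k + 1) → E) : polyCurve q 0 = q 0 := by
  unfold polyCurve
  rw [Finset.sum_eq_single 0]
  · simp
  · intro b _ hb
    have : (b : ℕ) ≠ 0 := fun h => hb (Fin.ext h)
    simp [this]
  · simp

theorem iteratedDeriv_polyCurve {k : ℕ} (q : Fin (k + 1) → E) (a : Fin (k + 1)) :
    iteratedDeriv a (polyCurve q) 0 = q a := by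
  have hs : ∀ b : Fin (k + 1), ContDiff ℝ (a : ℕ)
      (fun t : ℝ => t ^ (b : ℕ) / ((b : ℕ).factorial : ℝ)) := fun b => by fun_prop
  have h1 : polyCurve q = fun t => ∑ b : Fin (k + 1),
      (t ^ (b : ℕ) / ((b : ℕ).factorial : ℝ)) • q b := rfl
  have hsum := iteratedDeriv_fun_sum (n := (a : ℕ)) (x := (0 : ℝ)) (I := Finset.univ)
    (f := fun (b : Fin (k + 1)) (t : ℝ) => (t ^ (b : ℕ) / ((b : ℕ).factorial : ℝ)) • q b)
    fun b _ => ((hs b).smul contDiff_const).contDiffAt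
  rw [h1, hsum, Finset.sum_eq_single a]
  · rw [iteratedDeriv_smul_const (hs a).contDiffAt, iteratedDeriv_div_const,
      iteratedDeriv_fun_pow_zero]
    simp [Nat.factorial_ne_zero]
  · intro b _ hb
    have : (a : ℕ) ≠ b := fun h => hb (Fin.ext h.symm)
    rw [iteratedDeriv_smul_const (hs b).contDiffAt, iteratedDeriv_div_const,
      iteratedDeriv_fun_pow_zero]
    simp [this]
  · simp

variable (E) (Q : Type*) [TopologicalSpace Q] [ChartedSpace E Q]

/-- Smooth curves in `Q` defined on a neighbourhood of `0 ∈ ℝ` (the values far from `0` are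
irrelevant). -/
structure Curve where
  toFun : ℝ → Q
  smooth : ∀ᶠ t in 𝓝 (0 : ℝ), ContMDiffAt 𝓘(ℝ, ℝ) 𝓘(ℝ, E) ∞ toFun t

variable {E Q}

/-- The numbers `(q₀, …, q_k)`, `qₐ = dᵃ(φ ∘ c)/dtᵃ (0)`, of a curve `c` in a chart `φ` of `Q`. -/
def Curve.coord (k : ℕ) (φ : OpenPartialHomeomorph Q E) (c : Curve E Q) : Fin (k + 1) → E :=
  fun a => iteratedDeriv a (fun t => φ (c.toFun t)) 0

variable (E Q)

/-- Two curves have the same `k`-jet at `0` if they agree at `0` and their derivatives at `0` up to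
order `k` agree in the charts of `Q` at that point. -/
def jetSetoid (k : ℕ) : Setoid (Curve E Q) where
  r c c' := c.toFun 0 = c'.toFun 0 ∧
    ∀ φ ∈ atlas E Q, c.toFun 0 ∈ φ.source → c.coord k φ = c'.coord k φ
  iseqv :=
    { refl := fun _ => ⟨rfl, fun _ _ _ => rfl⟩
      symm := fun h => ⟨h.1.symm, fun φ hφ h0 => (h.2 φ hφ (h.1 ▸ h0)).symm⟩
      trans := fun h h' => ⟨h.1.trans h'.1,
        fun φ hφ h0 => (h.2 φ hφ h0).trans (h'.2 φ hφ (h.1 ▸ h0))⟩ }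

/-- The `k`-th order tangent bundle `T^k Q = J^k_0(ℝ, Q)`, as a set. -/
def Jet (k : ℕ) : Type _ := Quotient (jetSetoid E Q k)

/-- The model space of `T^k Q`: tuples `(q₀, …, q_k)` of elements of the model space of `Q`. -/
abbrev JetModel (k : ℕ) : Type _ := Fin (k + 1) → E

variable {E Q}

/-- The `k`-jet at `0` of a curve. -/
def Jet.mk (k : ℕ) (c : Curve E Q) : Jet E Q k := Quotient.mk (jetSetoid E Q k) c

/-- The projection `T^k Q → Q`. -/
def Jet.base {k : ℕ} (p : Jet E Q k) : Q :=
  Quotient.lift (s := jetSetoid E Q k) (fun c => c.toFun 0) (fun _ _ h => h.1) p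

/-- The projection `ρ^k_r : T^k Q → T^r Q`. -/
def Jet.proj {k r : ℕ} (h : r ≤ k) (p : Jet E Q k) : Jet E Q r :=
  Quotient.lift (s := jetSetoid E Q k) (fun c => Jet.mk r c)
    (fun _ _ hc => Quotient.sound (s := jetSetoid E Q r) ⟨hc.1, fun φ hφ h0 => by
      funext a
      exact congrFun (hc.2 φ hφ h0) (Fin.castLE (Nat.succ_le_succ h) a)⟩) p

theorem Jet.base_proj {k r : ℕ} (h : r ≤ k) (p : Jet E Q k) : (p.proj h).base = p.base := by
  induction p using Quotient.ind
  rfl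

theorem Jet.proj_proj {k r s : ℕ} (h : r ≤ k) (h' : s ≤ r) (p : Jet E Q k) :
    (p.proj h).proj h' = p.proj (h'.trans h) := by
  induction p using Quotient.ind
  rfl

/-- Natural coordinates `(q₀, …, q_k)` of a jet, induced by a chart `φ` of `Q` around its base
point. -/
def Jet.coord {k : ℕ} (φ : OpenPartialHomeomorph Q E) (p : Jet E Q k) : JetModel E k :=
  (Quotient.out (s := jetSetoid E Q k) p).coord k φ

theorem Jet.coord_mk {k : ℕ} {φ : OpenPartialHomeomorph Q E} (hφ : φ ∈ atlas E Q)
    (c : Curve E Q) (h0 : c.toFun 0 ∈ φ.source) : (Jet.mk k c).coord φ = c.coord k φ := by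
  have h := Quotient.mk_out (s := jetSetoid E Q k) c
  exact h.2 φ hφ (h.1 ▸ h0)

variable [IsManifold 𝓘(ℝ, E) ∞ Q]

theorem Curve.contDiffAt {φ : OpenPartialHomeomorph Q E} (hφ : φ ∈ atlas E Q)
    (c : Curve E Q) (h0 : c.toFun 0 ∈ φ.source) :
    ContDiffAt ℝ ∞ (fun t => φ (c.toFun t)) 0 := by
  rw [← contMDiffAt_iff_contDiffAt]
  exact ((contMDiffOn_of_mem_maximalAtlas (I := 𝓘(ℝ, E)) (n := ∞)
    (IsManifold.subset_maximalAtlas hφ)).contMDiffAt (φ.open_source.mem_nhds h0)).comp 0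
      c.smooth.self_of_nhds

theorem contMDiffAt_curveOfCoord {k : ℕ} {φ : OpenPartialHomeomorph Q E} (hφ : φ ∈ atlas E Q)
    {q : JetModel E k} (hq : q 0 ∈ φ.target) :
    ∀ᶠ t in 𝓝 (0 : ℝ), ContMDiffAt 𝓘(ℝ, ℝ) 𝓘(ℝ, E) ∞ (fun t => φ.symm (polyCurve q t)) t := by
  have hc : ContDiff ℝ ∞ (polyCurve q) :=
    (contDiff_polyCurve k).comp (contDiff_prodMk_right q)
  have : ∀ᶠ t in 𝓝 (0 : ℝ), polyCurve q t ∈ φ.target :=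
    hc.continuous.continuousAt.eventually (φ.open_target.mem_nhds (by rwa [polyCurve_zero]))
  filter_upwards [this] with t ht
  exact ((contMDiffOn_symm_of_mem_maximalAtlas (I := 𝓘(ℝ, E)) (n := ∞)
    (IsManifold.subset_maximalAtlas hφ)).contMDiffAt (φ.open_target.mem_nhds ht)).comp t
      hc.contMDiff.contMDiffAt

open Classical in
/-- A curve with prescribed natural coordinates `q` in the chart `φ`. -/
def curveOfCoord {k : ℕ} (φ : OpenPartialHomeomorph Q E) (hφ : φ ∈ atlas E Q)
    (q : JetModel E k) : Curve E Q :=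
  if hq : q 0 ∈ φ.target then ⟨_, contMDiffAt_curveOfCoord hφ hq⟩
  else ⟨fun _ => φ.symm (q 0), Eventually.of_forall fun _ => contMDiffAt_const⟩

theorem coord_curveOfCoord {k : ℕ} {φ ψ : OpenPartialHomeomorph Q E} (hφ : φ ∈ atlas E Q)
    {q : JetModel E k} (hq : q 0 ∈ φ.target) :
    (curveOfCoord φ hφ q).coord k ψ =
      fun a : Fin (k + 1) => iteratedDeriv (a : ℕ) (fun t => ψ (φ.symm (polyCurve q t))) 0 := by
  simp only [curveOfCoord, hq, dite_true]
  rfl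

theorem curveOfCoord_zero {k : ℕ} {φ : OpenPartialHomeomorph Q E} (hφ : φ ∈ atlas E Q)
    {q : JetModel E k} (hq : q 0 ∈ φ.target) :
    (curveOfCoord φ hφ q).toFun 0 = φ.symm (q 0) := by
  simp only [curveOfCoord, hq, dite_true, polyCurve_zero]

theorem coord_curveOfCoord_self {k : ℕ} {φ : OpenPartialHomeomorph Q E} (hφ : φ ∈ atlas E Q)
    {q : JetModel E k} (hq : q 0 ∈ φ.target) : (curveOfCoord φ hφ q).coord k φ = q := by
  rw [coord_curveOfCoord hφ hq]
  funext a
  rw [← iteratedDeriv_polyCurve q a]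
  refine Filter.EventuallyEq.iteratedDeriv_eq _ ?_
  have hc : Continuous (polyCurve q) :=
    ((contDiff_polyCurve k).comp (contDiff_prodMk_right q)).continuous
  have : ∀ᶠ t in 𝓝 (0 : ℝ), polyCurve q t ∈ φ.target :=
    hc.continuousAt.eventually (φ.open_target.mem_nhds (by rwa [polyCurve_zero]))
  filter_upwards [this] with t ht
  exact φ.right_inv ht

/-- Having the same derivatives up to order `k` at `0` does not depend on the chart. -/
theorem Curve.coord_congr {k : ℕ} {φ ψ : OpenPartialHomeomorph Q E} (hφ : φ ∈ atlas E Q)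
    (hψ : ψ ∈ atlas E Q) {c c' : Curve E Q} (h0 : c.toFun 0 = c'.toFun 0)
    (hcφ : c.toFun 0 ∈ φ.source) (hcψ : c.toFun 0 ∈ ψ.source)
    (h : c.coord k φ = c'.coord k φ) : c.coord k ψ = c'.coord k ψ := by
  have key : ∀ d : Curve E Q, d.toFun 0 ∈ φ.source → ∀ a : ℕ,
      iteratedDeriv a (fun t => ψ (d.toFun t)) 0 =
        iteratedDeriv a ((ψ ∘ φ.symm) ∘ (fun t => φ (d.toFun t))) 0 := by
    intro d hd a
    refine Filter.EventuallyEq.iteratedDeriv_eq _ ?_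
    have := d.smooth.self_of_nhds.continuousAt.eventually (φ.open_source.mem_nhds hd)
    filter_upwards [this] with t ht
    simp [φ.left_inv ht]
  have htr : ContDiffAt ℝ ∞ (ψ ∘ φ.symm) (φ (c.toFun 0)) := by
    rw [← contMDiffAt_iff_contDiffAt]
    refine ContMDiffAt.comp (I' := 𝓘(ℝ, E)) _ ?_ ?_
    · rw [φ.left_inv hcφ]
      exact (contMDiffOn_of_mem_maximalAtlas (I := 𝓘(ℝ, E)) (n := ∞)
        (IsManifold.subset_maximalAtlas hψ)).contMDiffAt (ψ.open_source.mem_nhds hcψ)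
    · exact (contMDiffOn_symm_of_mem_maximalAtlas (I := 𝓘(ℝ, E)) (n := ∞)
        (IsManifold.subset_maximalAtlas hφ)).contMDiffAt
          (φ.open_target.mem_nhds (φ.map_source hcφ))
  funext a
  simp only [Curve.coord]
  rw [key c hcφ, key c' (h0 ▸ hcφ)]
  refine iteratedDeriv_comp_congr (k := k) (c.contDiffAt hφ hcφ) (c'.contDiffAt hφ (h0 ▸ hcφ)) htr
    (fun b hb => congrFun h ⟨b, Nat.lt_succ_of_le hb⟩) (Nat.le_of_lt_succ a.2)

/-- The natural chart of `T^k Q` induced by a chart `φ` of `Q`. -/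
def jetChart (k : ℕ) (φ : OpenPartialHomeomorph Q E) (hφ : φ ∈ atlas E Q) :
    PartialEquiv (Jet E Q k) (JetModel E k) where
  toFun p := p.coord φ
  invFun q := Jet.mk k (curveOfCoord φ hφ q)
  source := {p | p.base ∈ φ.source}
  target := {q | q 0 ∈ φ.target}
  map_source' := by
    intro p hp
    induction p using Quotient.ind with | _ c => ?_
    change (Jet.mk k c).coord φ 0 ∈ φ.target
    rw [Jet.coord_mk hφ c hp]
    have h0 : c.coord k φ 0 = φ (c.toFun 0) := by simp [Curve.coord]
    rw [h0]
    exact φ.map_source hp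
  map_target' := by
    intro q hq
    change (curveOfCoord φ hφ q).toFun 0 ∈ φ.source
    rw [curveOfCoord_zero hφ hq]
    exact φ.map_target hq
  left_inv' := by
    intro p hp
    induction p using Quotient.ind with | _ c => ?_
    change Jet.mk k (curveOfCoord φ hφ ((Jet.mk k c).coord φ)) = Jet.mk k c
    have hc : c.toFun 0 ∈ φ.source := hp
    rw [Jet.coord_mk hφ c hc]
    have h0 : c.coord k φ 0 = φ (c.toFun 0) := by simp [Curve.coord]
    have hq : c.coord k φ 0 ∈ φ.target := h0 ▸ φ.map_source hc
    have e0 : (curveOfCoord φ hφ (c.coord k φ)).toFun 0 = c.toFun 0 := by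
      rw [curveOfCoord_zero hφ hq, h0, φ.left_inv hc]
    refine Quotient.sound (s := jetSetoid E Q k) ⟨e0, fun ψ hψ hψ0 => ?_⟩
    exact Curve.coord_congr hφ hψ e0 (e0 ▸ hc) hψ0 (coord_curveOfCoord_self hφ hq)
  right_inv' := by
    intro q hq
    rw [Jet.coord_mk hφ _ (by rw [curveOfCoord_zero hφ hq]; exact φ.map_target hq)]
    exact coord_curveOfCoord_self hφ hq

theorem jetChart_trans_source (k : ℕ) {φ ψ : OpenPartialHomeomorph Q E} (hφ : φ ∈ atlas E Q)
    (hψ : ψ ∈ atlas E Q) : ((jetChart k φ hφ).symm.trans (jetChart k ψ hψ)).source =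
      {q : JetModel E k | q 0 ∈ (φ.symm.trans ψ).source} := by
  ext q
  simp only [PartialEquiv.trans_source, PartialEquiv.symm_source, mem_inter_iff, mem_preimage,
    OpenPartialHomeomorph.trans_source, OpenPartialHomeomorph.symm_source, mem_ofPred_eq]
  refine and_congr_right fun hq => ?_
  change (curveOfCoord φ hφ q).toFun 0 ∈ ψ.source ↔ _
  rw [curveOfCoord_zero hφ hq]

theorem contDiffOn_jetChart_trans (k : ℕ) {φ ψ : OpenPartialHomeomorph Q E} (hφ : φ ∈ atlas E Q)
    (hψ : ψ ∈ atlas E Q) : ContDiffOn ℝ ∞ ((jetChart k φ hφ).symm.trans (jetChart k ψ hψ))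
      ((jetChart k φ hφ).symm.trans (jetChart k ψ hψ)).source := by
  rw [jetChart_trans_source]
  set S : Set (JetModel E k × ℝ) := {x | polyCurve x.1 x.2 ∈ (φ.symm.trans ψ).source} with hS
  have hSo : IsOpen S := (φ.symm.trans ψ).open_source.preimage (contDiff_polyCurve k).continuous
  have hψφ : ContDiffOn ℝ ∞ (ψ ∘ φ.symm) (φ.symm.trans ψ).source := by
    rw [← contMDiffOn_iff_contDiffOn]
    refine ContMDiffOn.comp (I' := 𝓘(ℝ, E)) (contMDiffOn_of_mem_maximalAtlas (I := 𝓘(ℝ, E))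
      (n := ∞) (IsManifold.subset_maximalAtlas hψ)) ((contMDiffOn_symm_of_mem_maximalAtlas
        (I := 𝓘(ℝ, E)) (n := ∞) (IsManifold.subset_maximalAtlas hφ)).mono ?_) ?_
    · intro x hx; exact hx.1
    · intro x hx; exact hx.2
  have hG : ContDiffOn ℝ ∞ (fun x : JetModel E k × ℝ => ψ (φ.symm (polyCurve x.1 x.2))) S :=
    hψφ.comp (contDiff_polyCurve k).contDiffOn fun x hx => hx
  rw [contDiffOn_pi]
  intro a
  have h1 := (contDiffOn_iteratedDeriv_snd hSo hG a).comp
    (contDiff_prodMk_left (0 : ℝ)).contDiffOn (s := {q : JetModel E k |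
      q 0 ∈ (φ.symm.trans ψ).source}) (fun q hq => by
        change polyCurve q 0 ∈ (φ.symm.trans ψ).source
        rw [polyCurve_zero]; exact hq)
  refine h1.congr fun q hq => ?_
  have hq0 : q 0 ∈ φ.target := hq.1
  change (Jet.mk k (curveOfCoord φ hφ q)).coord ψ a = _
  rw [Jet.coord_mk hψ _ (by rw [curveOfCoord_zero hφ hq0]; exact hq.2), coord_curveOfCoord hφ hq0]
  rfl

variable (E Q)

/-- The natural atlas of `T^k Q`; the preferred chart at a jet is the one induced by the preferred
chart of `Q` at its base point. -/
def jetCore (k : ℕ) : ChartedSpaceCore (JetModel E k) (Jet E Q k) where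
  atlas := {e | ∃ (φ : OpenPartialHomeomorph Q E) (hφ : φ ∈ atlas E Q), e = jetChart k φ hφ}
  chartAt p := jetChart k (chartAt E p.base) (chart_mem_atlas E p.base)
  mem_chart_source p := mem_chart_source E p.base
  chart_mem_atlas p := ⟨_, _, rfl⟩
  open_source := by
    rintro _ _ ⟨φ, hφ, rfl⟩ ⟨ψ, hψ, rfl⟩
    rw [jetChart_trans_source]
    exact (φ.symm.trans ψ).open_source.preimage (continuous_apply 0)
  continuousOn_toFun := by
    rintro _ _ ⟨φ, hφ, rfl⟩ ⟨ψ, hψ, rfl⟩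
    exact (contDiffOn_jetChart_trans k hφ hψ).continuousOn

instance (k : ℕ) : TopologicalSpace (Jet E Q k) := (jetCore E Q k).toTopologicalSpace

instance (k : ℕ) : ChartedSpace (JetModel E k) (Jet E Q k) := (jetCore E Q k).toChartedSpace

instance (k : ℕ) : IsManifold 𝓘(ℝ, JetModel E k) ∞ (Jet E Q k) := by
  refine isManifold_of_contDiffOn _ _ _ fun e e' he he' => ?_
  obtain ⟨e, he⟩ := mem_iUnion.1 he
  obtain ⟨⟨φ, hφ, rfl⟩, rfl⟩ := mem_iUnion.1 he
  obtain ⟨e', he'⟩ := mem_iUnion.1 he'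
  obtain ⟨⟨ψ, hψ, rfl⟩, rfl⟩ := mem_iUnion.1 he'
  have := contDiffOn_jetChart_trans k hφ hψ
  simp only [modelWithCornersSelf_coe, modelWithCornersSelf_coe_symm, Function.comp_id,
    Function.id_comp, preimage_id, range_id, inter_univ]
  exact this

variable {E Q}

theorem chartAt_jet {k : ℕ} (p p' : Jet E Q k) :
    chartAt (JetModel E k) p p' = p'.coord (chartAt E p.base) := rfl

theorem contMDiff_jetProj {k r : ℕ} (h : r ≤ k) :
    ContMDiff 𝓘(ℝ, JetModel E k) 𝓘(ℝ, JetModel E r) ∞ (Jet.proj h : Jet E Q k → Jet E Q r) := by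
  intro p
  set e := chartAt (JetModel E k) p with he
  set e' := chartAt (JetModel E r) (p.proj h) with he'
  let R : JetModel E k →L[ℝ] JetModel E r :=
    ContinuousLinearMap.pi fun a => ContinuousLinearMap.proj (Fin.castLE (Nat.succ_le_succ h) a)
  have hs : ∀ p' ∈ e.source, p'.proj h ∈ e'.source ∧ e' (p'.proj h) = R (e p') := by
    intro p' hp'
    have hb : p'.base ∈ (chartAt E p.base).source := hp'
    refine ⟨?_, ?_⟩
    · change (p'.proj h).base ∈ (chartAt E (p.proj h).base).source
      rwa [Jet.base_proj, Jet.base_proj]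
    · rw [he, he', chartAt_jet, chartAt_jet, Jet.base_proj]
      induction p' using Quotient.ind with | _ c => ?_
      have h1 := Jet.coord_mk (k := k) (chart_mem_atlas E p.base) c hb
      have h2 := Jet.coord_mk (k := r) (chart_mem_atlas E p.base) c hb
      change (Jet.mk r c).coord _ = R ((Jet.mk k c).coord _)
      rw [h1, h2]
      rfl
  have hev : (fun p' => e'.symm (R (e p'))) =ᶠ[𝓝 p] (Jet.proj h : Jet E Q k → Jet E Q r) := by
    filter_upwards [e.open_source.mem_nhds (mem_chart_source _ p)] with p' hp'
    rw [← (hs p' hp').2, e'.left_inv (hs p' hp').1]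
  refine ContMDiffAt.congr_of_eventuallyEq ?_ hev.symm
  have h1 : ContMDiffAt 𝓘(ℝ, JetModel E k) 𝓘(ℝ, JetModel E k) ∞ e p :=
    contMDiffAt_of_mem_maximalAtlas (IsManifold.chart_mem_maximalAtlas p) (mem_chart_source _ p)
  have h2 : ContMDiffAt 𝓘(ℝ, JetModel E r) 𝓘(ℝ, JetModel E r) ∞ e'.symm (R (e p)) := by
    have hm := hs p (mem_chart_source _ p)
    refine contMDiffAt_symm_of_mem_maximalAtlas
      (IsManifold.chart_mem_maximalAtlas (p.proj h)) ?_
    rw [← hm.2]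
    exact e'.map_source hm.1
  exact h2.comp p (R.contMDiff.contMDiffAt.comp p h1)

end Jets

section Forms

/-! Differential forms of degree one and contact Hamiltonian equations on a manifold. -/

variable {F : Type*} [NormedAddCommGroup F] [NormedSpace ℝ F] {H : Type*} [TopologicalSpace H]
  (I : ModelWithCorners ℝ F H) (M : Type*) [TopologicalSpace M] [ChartedSpace H M]

/-- (Not necessarily smooth) differential one-forms on `M`. -/
abbrev OneForm : Type _ := ∀ x : M, TangentSpace I x →L[ℝ] ℝ

/-- (Not necessarily smooth) vector fields on `M`. -/
abbrev VField : Type _ := ∀ x : M, TangentSpace I x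

/-- The cotangent bundle `T*M`. -/
abbrev CotBundle : Type _ :=
  TotalSpace (F →L[ℝ] ℝ) (fun x : M => TangentSpace I x →L[ℝ] Trivial M ℝ x)

variable {I M}

/-- Smoothness of a vector field on a set. -/
def SmoothVFieldOn [IsManifold I 1 M] (X : VField I M) (s : Set M) : Prop :=
  ContMDiffOn I I.tangent ∞ (fun x => (⟨x, X x⟩ : TangentBundle I M)) s

/-- The contraction `i(u) dα` at a point `x` of a manifold without boundary, for `u ∈ T_x M`: if
`a : F → (F →L ℝ)` is the expression of `α` in the preferred chart at `x`, then
`dα(u, v) = (Da · u)(v) - (Da · v)(u)` for the components of `u`, `v` in that chart. -/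
def iExtDeriv (α : OneForm I M) (x : M) (u : TangentSpace I x) : TangentSpace I x →L[ℝ] ℝ :=
  let e := extChartAt I x
  let a : F → F →L[ℝ] ℝ := fun y => (α (e.symm y)).comp (mfderiv 𝓘(ℝ, F) I e.symm y)
  let A : F →L[ℝ] F →L[ℝ] ℝ := fderiv ℝ a (e x)
  let D : TangentSpace I x →L[ℝ] F := mvfderiv I e x
  ((A - A.flip) (D u)).comp D

/-- `R` is a Reeb vector field of `η`: `i(R)dη = 0` and `i(R)η = 1`. -/
def IsReeb (η : OneForm I M) (R : VField I M) : Prop :=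
  ∀ x, iExtDeriv η x (R x) = 0 ∧ η x (R x) = 1

/-- The contact Hamiltonian equations at the point `x`, for the form `η`, the Reeb field `R`, the
Hamiltonian `h` and the vector field `X`: `i(X)dη = dh - (R(h))η` and `i(X)η = -h`. -/
def ContactEqAt (η : OneForm I M) (R : VField I M) (h : M → ℝ) (X : VField I M) (x : M) : Prop :=
  iExtDeriv η x (X x) = mvfderiv I h x - (mvfderiv I h x (R x)) • η x ∧ η x (X x) = - h x

/-- The vector field `∂/∂z` on `M × ℝ`. -/
def ddz : VField (I.prod 𝓘(ℝ, ℝ)) (M × ℝ) := fun _ => ((0 : F), (1 : ℝ))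

/-- The canonical contact form `dz - θ` on `T*M × ℝ`, where `θ` is the pull-back of the canonical
one-form of `T*M`, `θ_ξ(u) = ξ(Tπ u)`. -/
def canonicalContactForm [IsManifold I 1 M] :
    OneForm ((I.prod 𝓘(ℝ, F →L[ℝ] ℝ)).prod 𝓘(ℝ, ℝ)) (CotBundle I M × ℝ) := fun y =>
  mvfderiv ((I.prod 𝓘(ℝ, F →L[ℝ] ℝ)).prod 𝓘(ℝ, ℝ)) (fun y : CotBundle I M × ℝ => y.2) y -
    ContinuousLinearMap.comp (y.1.snd : TangentSpace I y.1.proj →L[ℝ] ℝ)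
      (mfderiv ((I.prod 𝓘(ℝ, F →L[ℝ] ℝ)).prod 𝓘(ℝ, ℝ)) I
        (fun y : CotBundle I M × ℝ => y.1.proj) y)

end Forms

section Lagrangian

/-! Geometry of `T^k Q × ℝ` and of higher-order contact Lagrangian systems. -/

variable {E : Type*} [NormedAddCommGroup E] [NormedSpace ℝ E]
  {Q : Type*} [TopologicalSpace Q] [ChartedSpace E Q] [IsManifold 𝓘(ℝ, E) ∞ Q]

variable (E) in
/-- The model of `T^k Q`. -/
abbrev IJ (k : ℕ) := 𝓘(ℝ, JetModel E k)

variable (E) in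
/-- The model of `T^k Q × ℝ`. -/
abbrev IX (k : ℕ) := (IJ E k).prod 𝓘(ℝ, ℝ)

variable (E Q) in
/-- The extended higher-order tangent bundle `T^k Q × ℝ`. -/
abbrev XJet (k : ℕ) : Type _ := Jet E Q k × ℝ

/-- The projection `τ^k_r : T^k Q × ℝ → T^r Q × ℝ`. -/
def XJet.proj {k r : ℕ} (h : r ≤ k) (x : XJet E Q k) : XJet E Q r := (x.1.proj h, x.2)

/-- The canonical injection `T^{r+1} Q → T(T^r Q)`, in natural coordinates
`(q₀, …, q_{r+1}) ↦ (q₀, …, q_r; q₁, …, q_{r+1})`. Here, as everywhere below, the tangent space at a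
point is identified with the model space through the preferred chart at the point; the preferred
charts at a jet and at its projections are induced by one and the same chart of `Q`. -/
def jetInj {r : ℕ} (p : Jet E Q (r + 1)) : TangentSpace (IJ E r) (p.proj (Nat.le_succ r)) :=
  fun a : Fin (r + 1) => (chartAt (JetModel E (r + 1)) p p : JetModel E (r + 1)) a.succ

variable (E) in
/-- The linear map `(v₀, …, v_k) ↦ (w₀, …, w_k)` with `wₐ = a!/(a-r)! v_{a-r}` for `a ≥ r` and
`wₐ = 0` for `a < r`. -/
def verticalMap (k r : ℕ) : JetModel E k →L[ℝ] JetModel E k :=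
  ContinuousLinearMap.pi fun a : Fin (k + 1) => ((a : ℕ).descFactorial r : ℝ) •
    (ContinuousLinearMap.proj (⟨a - r, (Nat.sub_le _ _).trans_lt a.2⟩ : Fin (k + 1)) :
      JetModel E k →L[ℝ] E)

/-- The `r`-th vertical endomorphism `𝒥_r` of `T(T^k Q × ℝ)`, in natural coordinates
`∑_α (r+α)!/α! dq_α ⊗ ∂/∂q_{r+α}`. -/
def vertEndo {k : ℕ} (r : ℕ) (x : XJet E Q k) :
    TangentSpace (IX E k) x →L[ℝ] TangentSpace (IX E k) x :=
  ((verticalMap E k r).comp (ContinuousLinearMap.fst ℝ (JetModel E k) ℝ)).prod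
    (0 : JetModel E k × ℝ →L[ℝ] ℝ)

/-- The `r`-th canonical vector field `Δ_r` (`r ≥ 1`) on `T^k Q × ℝ`, in natural coordinates
`∑_α (r+α)!/α! q_{α+1} ∂/∂q_{r+α}`. -/
def canonicalVField {k : ℕ} (r : ℕ) : VField (IX E k) (XJet E Q k) := fun x =>
  ((fun a : Fin (k + 1) => ((a : ℕ).descFactorial r : ℝ) •
    (chartAt (JetModel E k) x.1 x.1 : JetModel E k)
      ⟨a - (r - 1), (Nat.sub_le _ _).trans_lt a.2⟩ : JetModel E k), (0 : ℝ))

/-- For a function `L` on `T^k Q × ℝ` and `x ∈ T^{r+1} Q × ℝ`, `k ≤ r + 1`: the tangent vector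
`Tτ(Γ_x)` to `T^r Q × ℝ` at `τ(x)`, where `Γ` is any holonomic vector field on `T^{r+1} Q × ℝ` with
`i(Γ)dz = L`; in coordinates it is `∑_{α ≤ r} q_{α+1} ∂/∂q_α + L ∂/∂z`. -/
def totalVec {k r : ℕ} (L : XJet E Q k → ℝ) (h : k ≤ r + 1) (x : XJet E Q (r + 1)) :
    TangentSpace (IX E r) (x.proj (Nat.le_succ r)) :=
  ((jetInj x.1 : JetModel E r), (L (x.proj h) : ℝ))

/-- The derivative `∂L/∂z`. -/
def dLdz {k : ℕ} (L : XJet E Q k → ℝ) (x : XJet E Q k) : ℝ := mvfderiv (IX E k) L x (ddz x)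

/-- The Lagrangian total derivative `D_L F = d_L F - (∂L/∂z) F` of a function, where
`d_L F = Lie(Γ)(τ*F) = dF(Tτ Γ)`. -/
def totalD {k r : ℕ} (L : XJet E Q k → ℝ) (h : k ≤ r + 1) (F : XJet E Q r → ℝ) :
    XJet E Q (r + 1) → ℝ := fun x =>
  mvfderiv (IX E r) F (x.proj (Nat.le_succ r)) (totalVec L h x) -
    dLdz L (x.proj h) * F (x.proj (Nat.le_succ r))

/-- The Lagrangian total derivative `D_L ξ = Lie(Γ)(τ*ξ) - (∂L/∂z) τ*ξ` of a one-form, with the Lie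
derivative computed by Cartan's formula: `Lie(Γ)(τ*ξ) = i(Γ)d(τ*ξ) + d(i(Γ)τ*ξ)`, where
`i(Γ)d(τ*ξ) = dξ(Tτ Γ, Tτ ·)` and `i(Γ)τ*ξ = ξ(Tτ Γ)`. -/
def totalDForm {k r : ℕ} (L : XJet E Q k → ℝ) (h : k ≤ r + 1)
    (ξ : OneForm (IX E r) (XJet E Q r)) : OneForm (IX E (r + 1)) (XJet E Q (r + 1)) := fun x =>
  let τ : XJet E Q (r + 1) → XJet E Q r := XJet.proj (Nat.le_succ r)
  (iExtDeriv ξ (τ x) (totalVec L h x)).comp (mfderiv (IX E (r + 1)) (IX E r) τ x) +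
    mvfderiv (IX E (r + 1)) (fun y => ξ (τ y) (totalVec L h y)) x -
    dLdz L (x.proj h) • (ξ (τ x)).comp (mfderiv (IX E (r + 1)) (IX E r) τ x)

/-- The iterate `D_L^j F`, for a function `F` on `T^k Q × ℝ`. -/
def iterTotalD {k : ℕ} (L F : XJet E Q k → ℝ) : (j : ℕ) → XJet E Q (k + j) → ℝ
  | 0 => F
  | j + 1 => totalD L (Nat.le_add_right k (j + 1)) (iterTotalD L F j)

/-- The iterate `D_L^j ξ`, for a one-form `ξ` on `T^k Q × ℝ`. -/
def iterTotalDForm {k : ℕ} (L : XJet E Q k → ℝ) (ξ : OneForm (IX E k) (XJet E Q k)) :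
    (j : ℕ) → OneForm (IX E (k + j)) (XJet E Q (k + j))
  | 0 => ξ
  | j + 1 => totalDForm L (Nat.le_add_right k (j + 1)) (iterTotalDForm L ξ j)

/-! The order of a Lagrangian is written `k = m + 1`; thus `2k - 1 = 2m + 1`, `k - 1 = m`, and a
summation index `β = 1, …, k` is written `β = b + 1`. -/

theorem level_le {m : ℕ} (b : Fin (m + 1)) : m + 1 + (b : ℕ) ≤ 2 * m + 1 := by omega

theorem order_le (m : ℕ) : m + 1 ≤ 2 * m + 1 := by omega

theorem base_le (m : ℕ) : m ≤ 2 * m + 1 := by omega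

variable {m : ℕ} (L : XJet E Q (m + 1) → ℝ)

/-- The Lagrangian energy `E_L = ∑_{β=1}^k (-1)^{β-1} (1/β!) D_L^{β-1}(Δ_β(L)) - L`, a function on
`T^{2k-1} Q × ℝ`. -/
def energy (x : XJet E Q (2 * m + 1)) : ℝ :=
  ∑ b : Fin (m + 1), ((-1 : ℝ) ^ (b : ℕ) / (((b : ℕ) + 1).factorial : ℝ)) *
      iterTotalD L (fun y => mvfderiv (IX E (m + 1)) L y (canonicalVField ((b : ℕ) + 1) y)) b
        (x.proj (level_le b)) -
    L (x.proj (order_le m))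

/-- The Cartan Lagrangian one-form
`θ_L = ∑_{β=1}^k (-1)^{β-1} (1/β!) D_L^{β-1} i(𝒥_β)dL` on `T^{2k-1} Q × ℝ`. -/
def cartanForm : OneForm (IX E (2 * m + 1)) (XJet E Q (2 * m + 1)) := fun x =>
  ∑ b : Fin (m + 1), ((-1 : ℝ) ^ (b : ℕ) / (((b : ℕ) + 1).factorial : ℝ)) •
    (iterTotalDForm L (fun y => (mvfderiv (IX E (m + 1)) L y).comp (vertEndo ((b : ℕ) + 1) y)) b
        (x.proj (level_le b))).comp
      (mfderiv (IX E (2 * m + 1)) (IX E (m + 1 + b)) (XJet.proj (level_le b)) x)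

/-- The contact Lagrangian form `η_L = dz - θ_L` on `T^{2k-1} Q × ℝ`. -/
def lagrangianContactForm : OneForm (IX E (2 * m + 1)) (XJet E Q (2 * m + 1)) := fun x =>
  mvfderiv (IX E (2 * m + 1)) (fun y : XJet E Q (2 * m + 1) => y.2) x - cartanForm L x

/-- The extended Legendre-Ostrogradskii map: the covector `ζ` at the projection of `x` to
`T^{k-1} Q × ℝ` (unique, as the projection is a submersion) such that `θ_L(u) = ζ(Tτ u)` for all
`u ∈ T_x(T^{2k-1} Q × ℝ)`. -/
def extendedLegendre (x : XJet E Q (2 * m + 1)) :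
    TangentSpace (IX E m) (x.proj (base_le m)) →L[ℝ] ℝ :=
  Classical.epsilon fun ζ => ∀ u : TangentSpace (IX E (2 * m + 1)) x,
    cartanForm L x u = ζ (mfderiv (IX E (2 * m + 1)) (IX E m) (XJet.proj (base_le m)) x u)

/-- The covector part of the generalized Legendre map: the restriction of the extended Legendre map
to vectors tangent to `T^{k-1} Q`. -/
def legendreCovector (x : XJet E Q (2 * m + 1)) :
    TangentSpace (IJ E m) (x.1.proj (base_le m)) →L[ℝ] ℝ :=
  (extendedLegendre L x).comp
    (mfderiv (IJ E m) (IX E m) (fun q : Jet E Q m => (q, x.2)) (x.1.proj (base_le m)))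

variable (E) in
/-- The model of `T*(T^m Q) × ℝ`. -/
abbrev IP (m : ℕ) := ((IJ E m).prod 𝓘(ℝ, JetModel E m →L[ℝ] ℝ)).prod 𝓘(ℝ, ℝ)

variable (E Q) in
/-- The phase space `T*(T^m Q) × ℝ`. -/
abbrev PhaseSpace (m : ℕ) : Type _ := CotBundle (IJ E m) (Jet E Q m) × ℝ

/-- The generalized Legendre map `Leg : T^{2k-1} Q × ℝ → T*(T^{k-1} Q) × ℝ`. -/
def legendre (x : XJet E Q (2 * m + 1)) : PhaseSpace E Q m :=
  (⟨x.1.proj (base_le m), legendreCovector L x⟩, x.2)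

/-- The Lagrangian is regular: its generalized Legendre map is a local diffeomorphism. -/
def IsRegularLagrangian : Prop :=
  IsLocalDiffeomorph (IX E (2 * m + 1)) (IP E m) ∞ (legendre L)

/-! The unified bundle. -/

variable (E Q) in
/-- The projection `ρ^{2k-1}_{k-1} : T^{2k-1} Q → T^{k-1} Q` as a smooth map. -/
def rho (m : ℕ) : C^∞⟮IJ E (2 * m + 1), Jet E Q (2 * m + 1); IJ E m, Jet E Q m⟯ :=
  ⟨Jet.proj (base_le m), contMDiff_jetProj (base_le m)⟩

variable (E) in
/-- The model of the unified bundle. -/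
abbrev IW (m : ℕ) := ((IJ E (2 * m + 1)).prod 𝓘(ℝ, JetModel E m →L[ℝ] ℝ)).prod 𝓘(ℝ, ℝ)

variable (E Q) in
/-- The extended unified bundle `W = T^{2k-1} Q ×_{T^{k-1} Q} T*(T^{k-1} Q) × ℝ`; the fibre product is
realized as the pull-back of the cotangent bundle of `T^{k-1} Q` to `T^{2k-1} Q`. -/
abbrev Unified (m : ℕ) : Type _ :=
  TotalSpace (JetModel E m →L[ℝ] ℝ) (rho E Q m *ᵖ
    (fun x : Jet E Q m => TangentSpace (IJ E m) x →L[ℝ] Trivial (Jet E Q m) ℝ x)) × ℝ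

/-- The projection `ϱ₁ : W → T^{2k-1} Q × ℝ`. -/
def pr₁ (w : Unified E Q m) : XJet E Q (2 * m + 1) := (w.1.proj, w.2)

/-- The projection `ϱ₂ : W → T*(T^{k-1} Q) × ℝ`. -/
def pr₂ (w : Unified E Q m) : PhaseSpace E Q m := (Pullback.lift (rho E Q m) w.1, w.2)

/-- The precontact form `η_W = ϱ₂^* η_{k-1}` on `W`. -/
def unifiedForm : OneForm (IW E m) (Unified E Q m) := fun w =>
  (canonicalContactForm (pr₂ w)).comp (mfderiv (IW E m) (IP E m) pr₂ w)

/-- The coupling function `C(p, ξ, z) = ⟨ξ, j_k(p)⟩` on `W`. The vector `j_k(p)` and the covector `ξ`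
are based at the same point of `T^{k-1} Q`, see `Jet.proj_proj`. -/
def coupling (w : Unified E Q m) : ℝ :=
  let ξ : TangentSpace (IJ E m) (w.1.proj.proj (base_le m)) →L[ℝ] ℝ := w.1.snd
  let v : TangentSpace (IJ E m) ((w.1.proj.proj (order_le m)).proj (Nat.le_succ m)) :=
    jetInj (w.1.proj.proj (order_le m))
  ξ v

/-- The Hamiltonian function `ℋ = C - L` on `W`. -/
def unifiedHamiltonian (w : Unified E Q m) : ℝ :=
  coupling w - L ((pr₁ w).proj (order_le m))

/-- The map `x ↦ (x, Leg x)` from `T^{2k-1} Q × ℝ` to `W`. -/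
def legendreGraph (x : XJet E Q (2 * m + 1)) : Unified E Q m :=
  (⟨x.1, legendreCovector L x⟩, x.2)

/-- The submanifold `W₁ = graph(Leg)` of `W`. -/
def W₁ : Set (Unified E Q m) := range (legendreGraph L)

/-- A vector field on `W` is tangent to `W₁`: at each point of `W₁` its value lies in the image of the
tangent map of the parametrization `x ↦ (x, Leg x)` of `W₁`. -/
def IsTangentToW₁ (X : VField (IW E m) (Unified E Q m)) : Prop :=
  ∀ x : XJet E Q (2 * m + 1), ∃ u : TangentSpace (IX E (2 * m + 1)) x,
    X (legendreGraph L x) = mfderiv (IX E (2 * m + 1)) (IW E m) (legendreGraph L) x u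

theorem pr₁_legendreGraph (x : XJet E Q (2 * m + 1)) : pr₁ (legendreGraph L x) = x := rfl

theorem pr₂_legendreGraph (x : XJet E Q (2 * m + 1)) : pr₂ (legendreGraph L x) = legendre L x := rfl

end Lagrangian

end HOContact

end

open HOContact

/-! Everything reduces to two identities along the graph map `legendreGraph L` from `T^{2k-1}Q × ℝ`
to `W`: it pulls `η_W` back to `η_L`, and it pulls `ℋ` back to `E_L`.

The first says `η_L = Leg^* η` and rests on `θ_L` being semibasic over `T^{k-1}Q`. The form
`i(𝒥_β)dL` is semibasic over `T^{k-β}Q` and each `D_L` raises this order by one, so every summand of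
`θ_L` ends at order `k-1`, and `θ_L` also kills `∂/∂z` (`cartanForm_apply_eq_zero`). The second
follows from `i(Γ)θ_L = E_L + L` (`cartanForm_totalVec`): `D_L` commutes with contraction by `Γ`,
because `dξ(Γ,Γ) = 0`, and `i(Γ)i(𝒥_β)dL = Δ_β(L)`. Since `Γ` projects to `j_k` on `T^{k-1}Q`, the
left side is `⟨Leg, j_k⟩ = 𝒞`.

The canonical form is nondegenerate and `Leg` is a local diffeomorphism, so `η_L` is nondegenerate.
This makes its Reeb field and the solution of its contact equations unique, and the Reeb field is
the lift of `∂/∂z` through `Leg`. Existence of `X_L` requires no linear system: by tangency `X_ℋ`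
is, along `W₁`, the image under the graph map of `X_L = Tϱ₁ ∘ X_ℋ`, so the equations on `W` pull
back to `T^{2k-1}Q × ℝ` (`ContactEqAt.restrict`). The field `∂/∂z` on `W` need not be tangent to
`W₁`, but the multiplier of `η` is recovered by evaluation on the Reeb field
(`contactEqAt_of_multiplier`). Finally `Leg` pushes the equations forward where it is injective
(`ContactEqAt.pushforward`).

The geometric objects are defined pointwise in preferred charts, so they must be compared in one
fixed chart near a point. A tangent vector to `T^rQ` is handled as the jet of a curve `w` along a
curve `c`, on which a coordinate change `Φ` acts by `w ↦ DΦ(c)w`. Then `𝒥_β` is multiplication of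
`w` by `t^β`, and `j` is the choice `w = c'`; both commute visibly with coordinate changes. -/

noncomputable section

namespace HOContact

/-! ### One-forms in charts and naturality of the exterior derivative. -/

section OneForms

variable {F : Type*} [NormedAddCommGroup F] [NormedSpace ℝ F] {H : Type*} [TopologicalSpace H]
  {I : ModelWithCorners ℝ F H} {M : Type*} [TopologicalSpace M] [ChartedSpace H M]
  {G : Type*} [NormedAddCommGroup G] [NormedSpace ℝ G] {H' : Type*} [TopologicalSpace H']
  {J : ModelWithCorners ℝ G H'} {N : Type*} [TopologicalSpace N] [ChartedSpace H' N]

/-- The expression of a one-form in the preferred chart at a point. -/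
def localExpr (α : OneForm I M) (x : M) : F → F →L[ℝ] ℝ := fun y =>
  (α ((extChartAt I x).symm y)).comp (mfderiv 𝓘(ℝ, F) I (extChartAt I x).symm y)

/-- The pull-back of a one-form. -/
def pullbackForm (f : M → N) (α : OneForm J N) : OneForm I M := fun x =>
  (α (f x)).comp (mfderiv I J f x)

theorem iExtDeriv_apply [IsManifold I 1 M] (α : OneForm I M) (x : M) (u v : TangentSpace I x) :
    iExtDeriv α x u v =
      fderiv ℝ (localExpr α x) (extChartAt I x x) (u : F) (v : F) -
        fderiv ℝ (localExpr α x) (extChartAt I x x) (v : F) (u : F) := by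
  have h : ∀ w : TangentSpace I x, mvfderiv I (extChartAt I x) x w = (w : F) := by
    intro w
    change mfderiv I 𝓘(ℝ, F) (extChartAt I x) x w = w
    rw [mfderiv_extChartAt_self]
    rfl
  change (fderiv ℝ (localExpr α x) (extChartAt I x x) - (fderiv ℝ (localExpr α x)
    (extChartAt I x x)).flip) (mvfderiv I (extChartAt I x) x u) (mvfderiv I (extChartAt I x) x v) = _
  rw [h, h]
  rfl

theorem iExtDeriv_apply_self [IsManifold I 1 M] (α : OneForm I M) (x : M) (u : TangentSpace I x) :
    iExtDeriv α x u u = 0 := by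
  rw [iExtDeriv_apply, sub_self]

theorem iExtDeriv_antisymm [IsManifold I 1 M] (α : OneForm I M) (x : M) (u v : TangentSpace I x) :
    iExtDeriv α x u v = - iExtDeriv α x v u := by
  rw [iExtDeriv_apply, iExtDeriv_apply, neg_sub]

theorem localExpr_modelSpace (a : F → F →L[ℝ] ℝ) (x : F) :
    localExpr (I := 𝓘(ℝ, F)) (M := F) a x = a := by
  funext y
  have h1 : (extChartAt 𝓘(ℝ, F) x).symm = PartialEquiv.refl F := by
    rw [extChartAt_model_space_eq_id]
    rfl
  have h2 : ∀ f : PartialEquiv F F, f = PartialEquiv.refl F →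
      ContinuousLinearMap.comp (a (f y)) (mfderiv 𝓘(ℝ, F) 𝓘(ℝ, F) f y) = a y := by
    rintro _ rfl
    have : mfderiv 𝓘(ℝ, F) 𝓘(ℝ, F) (PartialEquiv.refl F) y = ContinuousLinearMap.id ℝ F :=
      mfderiv_id
    rw [this]
    rfl
  exact h2 _ h1

theorem iExtDeriv_modelSpace (a : F → F →L[ℝ] ℝ) (x u v : F) :
    iExtDeriv (I := 𝓘(ℝ, F)) (M := F) a x u v = fderiv ℝ a x u v - fderiv ℝ a x v u := by
  have h := iExtDeriv_apply (I := 𝓘(ℝ, F)) (M := F) a x u v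
  have h1 : extChartAt 𝓘(ℝ, F) x x = x := by
    rw [extChartAt_model_space_eq_id]
    rfl
  rw [localExpr_modelSpace, h1] at h
  exact h

/-- Naturality of the exterior derivative of one-forms. -/
theorem iExtDeriv_pullbackForm [IsManifold I ∞ M] [IsManifold J ∞ N] [I.Boundaryless] [J.Boundaryless]
    {f : M → N} {α : OneForm J N} {x : M} (hf : ContMDiffAt I J ∞ f x)
    (hα : DifferentiableAt ℝ (localExpr α (f x)) (extChartAt J (f x) (f x)))
    (u : TangentSpace I x) :
    iExtDeriv (pullbackForm f α : OneForm I M) x u =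
      (iExtDeriv α (f x) (mfderiv I J f x u)).comp (mfderiv I J f x) := by
  set e := extChartAt I x with he
  set e' := extChartAt J (f x) with he'
  set y₀ := e x with hy₀
  set g : F → G := writtenInExtChartAt I J x f with hg
  have hgs : ContDiffAt ℝ ∞ g y₀ := by
    have := (contMDiffAt_iff.1 hf).2
    rwa [I.range_eq_univ, contDiffWithinAt_univ] at this
  have hgy : g y₀ = e' (f x) := by simp [hg, hy₀, he, he', writtenInExtChartAt]
  have hgd : ∀ᶠ y in 𝓝 y₀, DifferentiableAt ℝ g y := by
    have h1 : ContDiffAt ℝ 1 g y₀ := hgs.of_le (by simp)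
    filter_upwards [h1.eventually (by simp)] with y hy using hy.differentiableAt (by simp)
  have htar : ∀ᶠ y in 𝓝 y₀, y ∈ e.target := extChartAt_target_mem_nhds x
  have hsymm : Tendsto e.symm (𝓝 y₀) (𝓝 x) := by
    have := continuousAt_extChartAt_symm (I := I) x
    rw [ContinuousAt, extChartAt_to_inv] at this
    exact this
  have hfd : ∀ᶠ y in 𝓝 y₀, MDifferentiableAt I J f (e.symm y) := by
    have h1 : ContMDiffAt I J 1 f x := hf.of_le (by simp)
    have := hsymm.eventually ((contMDiffAt_iff_contMDiffAt_nhds (by simp)).1 h1)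
    filter_upwards [this] with y hy using hy.mdifferentiableAt (by simp)
  have hfs : ∀ᶠ y in 𝓝 y₀, f (e.symm y) ∈ e'.source :=
    hsymm.eventually (hf.continuousAt.eventually (extChartAt_source_mem_nhds (f x)))
  have hes : ∀ y ∈ e.target, MDifferentiableAt 𝓘(ℝ, F) I e.symm y := by
    intro y hy
    have := mdifferentiableWithinAt_extChartAt_symm (I := I) (x := x) hy
    rwa [I.range_eq_univ, mdifferentiableWithinAt_univ] at this
  have hes' : ∀ y ∈ e'.target, MDifferentiableAt 𝓘(ℝ, G) J e'.symm y := by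
    intro y hy
    have := mdifferentiableWithinAt_extChartAt_symm (I := J) (x := f x) hy
    rwa [J.range_eq_univ, mdifferentiableWithinAt_univ] at this
  -- In coordinates the pulled-back form is `a(g(y)) ∘ Dg(y)`, with `a` the expression of `α` and
  -- `g` that of `f`.
  have key : localExpr (pullbackForm f α : OneForm I M) x =ᶠ[𝓝 y₀]
      fun y => (localExpr α (f x) (g y)).comp (fderiv ℝ g y) := by
    filter_upwards [htar, hgd, hfd, hfs, htar.eventually_nhds, hfs.eventually_nhds] with
      y h1 h2 h3 h4 h5 h6
    have e1 : e'.symm (g y) = f (e.symm y) := by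
      simp only [hg, writtenInExtChartAt, Function.comp]
      exact e'.left_inv h4
    have hgt : g y ∈ e'.target := e'.map_source h4
    have e2 : mfderiv 𝓘(ℝ, F) J (f ∘ e.symm) y = (mfderiv I J f (e.symm y)).comp
        (mfderiv 𝓘(ℝ, F) I e.symm y) := mfderiv_comp y h3 (hes y h1)
    have e3 : mfderiv 𝓘(ℝ, F) J (e'.symm ∘ g) y = (mfderiv 𝓘(ℝ, G) J e'.symm (g y)).comp
        (mfderiv 𝓘(ℝ, F) 𝓘(ℝ, G) g y) :=
      mfderiv_comp y (hes' _ hgt) h2.mdifferentiableAt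
    have e4 : mfderiv 𝓘(ℝ, F) J (f ∘ e.symm) y = mfderiv 𝓘(ℝ, F) J (e'.symm ∘ g) y := by
      refine Filter.EventuallyEq.mfderiv_eq ?_
      filter_upwards [h6] with y' h'
      simp only [hg, writtenInExtChartAt, Function.comp]
      exact (e'.left_inv h').symm
    have e5 : ∀ v : F, mfderiv I J f (e.symm y) (mfderiv 𝓘(ℝ, F) I e.symm y v) =
        mfderiv 𝓘(ℝ, G) J e'.symm (g y) (fderiv ℝ g y v) := by
      intro v
      have := DFunLike.congr_fun (e2.symm.trans (e4.trans e3)) v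
      rw [mfderiv_eq_fderiv] at this
      exact this
    ext v
    change α (f (e.symm y)) (mfderiv I J f (e.symm y) (mfderiv 𝓘(ℝ, F) I e.symm y v)) =
      α (e'.symm (g y)) (mfderiv 𝓘(ℝ, G) J e'.symm (g y) (fderiv ℝ g y v))
    rw [e5]
    -- The covectors on the two sides have base points that agree only through `e1`; generalizing
    -- the vectors makes the rewrite of the base point type-correct.
    generalize fderiv ℝ g y v = w
    generalize mfderiv 𝓘(ℝ, G) J e'.symm (g y) w = w'
    revert w'
    rw [e1]
    exact fun _ => rfl
  have hfx : ∀ v : TangentSpace I x, mfderiv I J f x v = fderiv ℝ g y₀ v := by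
    intro v
    rw [(hf.mdifferentiableAt (by simp)).mfderiv, I.range_eq_univ, fderivWithin_univ]
    rfl
  have hG2 : DifferentiableAt ℝ (fderiv ℝ g) y₀ :=
    (hgs.fderiv_right (m := ∞) (by simp)).differentiableAt (by simp)
  have hsy : IsSymmSndFDerivAt ℝ g y₀ := by
    refine hgs.isSymmSndFDerivAt ?_
    simp only [minSmoothness_of_isRCLikeNormedField]
    exact WithTop.coe_le_coe.2 le_top
  have hα' : DifferentiableAt ℝ (localExpr α (f x)) (g y₀) := by rwa [hgy]
  -- The product rule produces the extra term `a(D²g(u,v))`; being symmetric in `u` and `v`, it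
  -- disappears on antisymmetrization.
  have hD : ∀ a b : F, fderiv ℝ (localExpr (pullbackForm f α : OneForm I M) x) y₀ a b =
      fderiv ℝ (localExpr α (f x)) (g y₀) (fderiv ℝ g y₀ a) (fderiv ℝ g y₀ b) +
        localExpr α (f x) (g y₀) (fderiv ℝ (fderiv ℝ g) y₀ a b) := by
    intro a b
    rw [key.fderiv_eq]
    have h1 := (hα'.hasFDerivAt.comp y₀ (hgs.differentiableAt (by simp)).hasFDerivAt).clm_comp
      hG2.hasFDerivAt
    have h2 := h1.fderiv
    change (fderiv ℝ (fun y => (localExpr α (f x) (g y)).comp (fderiv ℝ g y)) y₀) a b = _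
    simp only [Function.comp_def] at h2
    rw [h2]
    simp [add_comm]
  ext v
  change iExtDeriv (pullbackForm f α : OneForm I M) x u v =
    iExtDeriv α (f x) (mfderiv I J f x u) (mfderiv I J f x v)
  rw [iExtDeriv_apply, iExtDeriv_apply]
  refine (congrArg₂ (· - ·) (hD u v) (hD v u)).trans ?_
  have h1 : ∀ w, fderiv ℝ (localExpr α (f x)) (extChartAt J (f x) (f x)) w =
    fderiv ℝ (localExpr α (f x)) (g y₀) w := fun w => by rw [hgy]
  refine Eq.trans ?_ (congrArg₂ (· - ·) (DFunLike.congr_fun (h1 _) _)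
    (DFunLike.congr_fun (h1 _) _)).symm
  rw [hfx u, hfx v]
  have h2 := congrArg (localExpr α (f x) (g y₀)) (hsy.eq u v)
  linarith

end OneForms

/-! ### Leibniz rule at zero and differentiation in a parameter. -/

section IteratedDeriv
variable {E F : Type*} [NormedAddCommGroup E] [NormedSpace ℝ E] [NormedAddCommGroup F]
  [NormedSpace ℝ F]

/-- In the Leibniz sum only the term with exactly `r` derivatives on `t^r` survives at `0`, with
coefficient `r! * a.choose r`. For `a < r` the coefficient vanishes, so the truncated `a - r` is
harmless. This is where the factors of `verticalMap` come from. -/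
theorem iteratedDeriv_pow_smul_zero {f : ℝ → E} (hf : ContDiffAt ℝ ∞ f 0) (r a : ℕ) :
    iteratedDeriv a (fun t : ℝ => t ^ r • f t) 0 =
      (a.descFactorial r : ℝ) • iteratedDeriv (a - r) f 0 := by
  have h := iteratedDerivWithin_smul (n := a) (mem_univ (0 : ℝ)) uniqueDiffOn_univ
    (f := fun t : ℝ => t ^ r) (g := f) (by fun_prop)
    (hf.of_le (by exact_mod_cast le_top)).contDiffWithinAt
  simp only [iteratedDerivWithin_univ, iteratedDeriv_fun_pow_zero] at h
  change iteratedDeriv a ((fun t : ℝ => t ^ r) • f) 0 = _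
  rw [h, Nat.descFactorial_eq_factorial_mul_choose]
  by_cases hr : r ≤ a
  · rw [Finset.sum_eq_single r]
    · simp [mul_smul, mul_comm, ← Nat.cast_smul_eq_nsmul ℝ]
    · intro i _ hi
      simp [hi]
    · intro hr'
      exact absurd (Finset.mem_range.2 (Nat.lt_succ_of_le hr)) hr'
  · rw [Finset.sum_eq_zero, Nat.choose_eq_zero_of_lt (not_le.1 hr)]
    · simp
    · intro i hi
      have : i ≠ r := by
        have := Finset.mem_range.1 hi
        omega
      simp [this]

/-- Mixed partial derivatives commute. The innermost time derivative is peeled off and the induction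
hypothesis applied to `∂ₜG`; symmetry of the second derivative then moves it past the parameter
derivative. -/
theorem fderiv_iteratedDeriv_snd {G : E × ℝ → F} {S : Set (E × ℝ)} (hS : IsOpen S)
    (hG : ContDiffOn ℝ ∞ G S) (a : ℕ) {x : E} {t : ℝ} (hx : (x, t) ∈ S) (v : E) :
    fderiv ℝ (fun x => iteratedDeriv a (fun s => G (x, s)) t) x v =
      iteratedDeriv a (fun s => fderiv ℝ G (x, s) (v, 0)) t := by
  induction a generalizing G with
  | zero =>
    simp only [iteratedDeriv_zero]
    have hd := ((hG.differentiableOn (by simp)).differentiableAt (hS.mem_nhds hx)).hasFDerivAt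
    have hl : HasFDerivAt (fun x : E => (x, t)) (ContinuousLinearMap.inl ℝ E ℝ) x :=
      hasFDerivAt_prodMk_left x t
    exact DFunLike.congr_fun (HasFDerivAt.comp (f := fun x : E => (x, t)) x hd hl).fderiv v
  | succ a ih =>
    have hder : ∀ y ∈ S, deriv (fun s => G (y.1, s)) y.2 = fderiv ℝ G y (0, 1) := by
      intro y hy
      have hd := ((hG.differentiableOn (by simp)).differentiableAt (hS.mem_nhds hy)).hasFDerivAt
      have hl : HasDerivAt (fun s : ℝ => (y.1, s)) ((0 : E), (1 : ℝ)) y.2 :=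
        (hasDerivAt_const y.2 y.1).prodMk (hasDerivAt_id y.2)
      exact (HasFDerivAt.comp_hasDerivAt (f := fun s : ℝ => (y.1, s)) y.2 hd hl).deriv
    have hG1 := hG.fderiv_of_isOpen hS (m := ∞) (by simp)
    have hG' : ContDiffOn ℝ ∞ (fun y => fderiv ℝ G y (0, 1)) S := hG1.clm_apply contDiffOn_const
    have hSx : ∀ᶠ x' in 𝓝 x, (x', t) ∈ S :=
      (hS.preimage (by fun_prop : Continuous fun x' : E => (x', t))).mem_nhds hx
    have h1 : (fun x => iteratedDeriv (a + 1) (fun s => G (x, s)) t) =ᶠ[𝓝 x]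
        fun x => iteratedDeriv a (fun s => fderiv ℝ G (x, s) (0, 1)) t := by
      filter_upwards [hSx] with x' hx'
      rw [iteratedDeriv_succ']
      refine Filter.EventuallyEq.iteratedDeriv_eq _ ?_
      filter_upwards [(hS.preimage (by fun_prop : Continuous fun s : ℝ => (x', s))).mem_nhds hx']
        with s hs
      exact hder _ hs
    rw [h1.fderiv_eq, ih hG', iteratedDeriv_succ']
    refine Filter.EventuallyEq.iteratedDeriv_eq _ ?_
    filter_upwards [(hS.preimage (by fun_prop : Continuous fun s : ℝ => (x, s))).mem_nhds hx]
      with s hs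
    have hs' : (x, s) ∈ S := hs
    have hd2 := ((hG1.differentiableOn (by simp)).differentiableAt (hS.mem_nhds hs')).hasFDerivAt
    have e1 : fderiv ℝ (fun y => fderiv ℝ G y (0, 1)) (x, s) (v, 0) =
        fderiv ℝ (fderiv ℝ G) (x, s) (v, 0) (0, 1) := by
      rw [(hd2.clm_apply (hasFDerivAt_const _ _)).fderiv]
      simp
    have hl : HasDerivAt (fun s : ℝ => (x, s)) ((0 : E), (1 : ℝ)) s :=
        (hasDerivAt_const s x).prodMk (hasDerivAt_id s)
    have e2 : deriv (fun s => fderiv ℝ G (x, s) (v, 0)) s =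
        fderiv ℝ (fderiv ℝ G) (x, s) (0, 1) (v, 0) := by
      have h3 := HasFDerivAt.comp_hasDerivAt (f := fun s : ℝ => (x, s)) s hd2 hl
      exact ((ContinuousLinearMap.apply ℝ F ((v, 0) : E × ℝ)).hasFDerivAt.comp_hasDerivAt s h3).deriv
    have hsy : IsSymmSndFDerivAt ℝ G (x, s) := by
      refine (hG.contDiffAt (hS.mem_nhds hs')).isSymmSndFDerivAt ?_
      simp only [minSmoothness_of_isRCLikeNormedField]
      exact WithTop.coe_le_coe.2 le_top
    rw [e1, e2, hsy.eq]

end IteratedDeriv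

/-! ### Natural charts of the jet bundles and their tangent maps. -/

section JetCharts
variable {E : Type*} [NormedAddCommGroup E] [NormedSpace ℝ E]
  {Q : Type*} [TopologicalSpace Q] [ChartedSpace E Q] [IsManifold 𝓘(ℝ, E) ∞ Q]

variable (E) in
/-- The model vector space of `T^r Q × ℝ`. -/
abbrev XModel (r : ℕ) : Type _ := JetModel E r × ℝ

/-- The inverse of the natural chart of `T^r Q × ℝ` induced by a chart of `Q`. -/
def param {φ : OpenPartialHomeomorph Q E} (hφ : φ ∈ atlas E Q) (r : ℕ) (y : XModel E r) :
    XJet E Q r := ((jetChart r φ hφ).symm y.1, y.2)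

/-- The natural chart of `T^r Q × ℝ` induced by a chart of `Q`. -/
def coordX (φ : OpenPartialHomeomorph Q E) {r : ℕ} (x : XJet E Q r) : XModel E r :=
  (x.1.coord φ, x.2)

/-- The image of the natural chart of `T^r Q × ℝ` induced by a chart of `Q`. -/
def xTarget (φ : OpenPartialHomeomorph Q E) (r : ℕ) : Set (XModel E r) := {y | y.1 0 ∈ φ.target}

theorem isOpen_xTarget (φ : OpenPartialHomeomorph Q E) (r : ℕ) : IsOpen (xTarget φ r) :=
  φ.open_target.preimage ((continuous_apply 0).comp continuous_fst)

variable {φ : OpenPartialHomeomorph Q E} (hφ : φ ∈ atlas E Q) {r : ℕ}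

theorem extChartAt_xJet (x x' : XJet E Q r) :
    extChartAt (IX E r) x x' = coordX (chartAt E x.1.base) x' := by
  rw [extChartAt_prod]
  rfl

theorem extChartAt_xJet_symm (x : XJet E Q r) (y : XModel E r) :
    (extChartAt (IX E r) x).symm y = param (chart_mem_atlas E x.1.base) r y := by
  rw [extChartAt_prod]
  rfl

theorem coordX_param {y : XModel E r} (hy : y ∈ xTarget φ r) : coordX φ (param hφ r y) = y :=
  Prod.ext ((jetChart r φ hφ).right_inv hy) rfl

theorem param_coordX {x : XJet E Q r} (hx : x.1.base ∈ φ.source) : param hφ r (coordX φ x) = x :=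
  Prod.ext ((jetChart r φ hφ).left_inv hx) rfl

theorem coordX_mem_xTarget (hφ : φ ∈ atlas E Q) {x : XJet E Q r} (hx : x.1.base ∈ φ.source) :
    coordX φ x ∈ xTarget φ r := (jetChart r φ hφ).map_source hx

theorem param_base_mem {y : XModel E r} (hy : y ∈ xTarget φ r) :
    (param hφ r y).1.base ∈ φ.source := (jetChart r φ hφ).map_target hy

theorem param_base {y : XModel E r} (hy : y ∈ xTarget φ r) :
    (param hφ r y).1.base = φ.symm (y.1 0) := curveOfCoord_zero hφ hy

theorem jetChart_mem_atlas : (jetCore E Q r).openPartialHomeomorph (jetChart r φ hφ)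
    ⟨φ, hφ, rfl⟩ ∈ atlas (JetModel E r) (Jet E Q r) := by
  refine mem_iUnion.2 ⟨_, mem_iUnion.2 ⟨⟨φ, hφ, rfl⟩, rfl⟩⟩

theorem contMDiffAt_param {y : XModel E r} (hy : y ∈ xTarget φ r) :
    ContMDiffAt 𝓘(ℝ, XModel E r) (IX E r) ∞ (param hφ r : XModel E r → XJet E Q r) y := by
  have h1 : ContMDiffAt (IJ E r) (IJ E r) ∞ (jetChart r φ hφ).symm y.1 :=
    contMDiffAt_symm_of_mem_maximalAtlas
      (IsManifold.subset_maximalAtlas (jetChart_mem_atlas hφ)) hy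
  have h2 : ContMDiffAt 𝓘(ℝ, XModel E r) (IJ E r) ∞ (fun y : XModel E r => y.1) y :=
    contDiff_fst.contMDiff.contMDiffAt
  have h3 : ContMDiffAt 𝓘(ℝ, XModel E r) 𝓘(ℝ, ℝ) ∞ (fun y : XModel E r => y.2) y :=
    contDiff_snd.contMDiff.contMDiffAt
  exact (h1.comp y h2).prodMk h3

theorem contMDiffAt_coordX (hφ : φ ∈ atlas E Q) {x : XJet E Q r} (hx : x.1.base ∈ φ.source) :
    ContMDiffAt (IX E r) 𝓘(ℝ, XModel E r) ∞ (coordX φ : XJet E Q r → XModel E r) x := by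
  have h1 : ContMDiffAt (IJ E r) (IJ E r) ∞ (jetChart r φ hφ) x.1 :=
    contMDiffAt_of_mem_maximalAtlas
      (IsManifold.subset_maximalAtlas (jetChart_mem_atlas hφ)) hx
  have h2 : ContMDiffAt (IX E r) (IJ E r) ∞ (fun x : XJet E Q r => x.1) x := contMDiffAt_fst
  exact (h1.comp x h2).prodMk_space contMDiffAt_snd

theorem eventually_base_mem (hφ : φ ∈ atlas E Q) {x : XJet E Q r} (hx : x.1.base ∈ φ.source) :
    ∀ᶠ x' : XJet E Q r in 𝓝 x, x'.1.base ∈ φ.source := by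
  have := ((jetCore E Q r).openPartialHomeomorph (jetChart r φ hφ) ⟨φ, hφ, rfl⟩).open_source
  exact (this.preimage continuous_fst).mem_nhds hx

/-- The coordinate change between two charts of `Q` is smooth. -/
theorem contDiffOn_transition {ψ : OpenPartialHomeomorph Q E} (hφ : φ ∈ atlas E Q)
    (hψ : ψ ∈ atlas E Q) : ContDiffOn ℝ ∞ (ψ ∘ φ.symm) (φ.symm.trans ψ).source := by
  rw [← contMDiffOn_iff_contDiffOn]
  refine ContMDiffOn.comp (I' := 𝓘(ℝ, E)) (contMDiffOn_of_mem_maximalAtlas (I := 𝓘(ℝ, E))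
    (n := ∞) (IsManifold.subset_maximalAtlas hψ)) ((contMDiffOn_symm_of_mem_maximalAtlas
      (I := 𝓘(ℝ, E)) (n := ∞) (IsManifold.subset_maximalAtlas hφ)).mono ?_) ?_
  · intro x hx; exact hx.1
  · intro x hx; exact hx.2

theorem coordX_param_apply {ψ : OpenPartialHomeomorph Q E} (hψ : ψ ∈ atlas E Q) {y : XModel E r}
    (hy : y ∈ xTarget φ r) (hy' : φ.symm (y.1 0) ∈ ψ.source) :
    coordX ψ (param hφ r y) =
      (fun a : Fin (r + 1) => iteratedDeriv (a : ℕ) ((ψ ∘ φ.symm) ∘ polyCurve y.1) 0, y.2) := by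
  refine Prod.ext ?_ rfl
  change (Jet.mk r (curveOfCoord φ hφ y.1)).coord ψ = _
  rw [Jet.coord_mk hψ _ (by rwa [curveOfCoord_zero hφ hy]), coord_curveOfCoord hφ hy]
  rfl

theorem contDiff_polyCurve_right (q : JetModel E r) : ContDiff ℝ ∞ (polyCurve q) :=
  (contDiff_polyCurve r).comp (contDiff_prodMk_right q)

/-- The jet coordinate change is `q ↦` jet of `Φ ∘ polyCurve q`. Differentiating in `q` under the
time derivatives turns it into the jet of `DΦ(c)w`, with `c` and `w` the polynomial curves of the
point and the vector. -/
theorem mfderiv_param_apply_polyCurve {y : XModel E r} (hy : y ∈ xTarget φ r) (v : XModel E r) :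
    (mfderiv 𝓘(ℝ, XModel E r) (IX E r) (param hφ r : XModel E r → XJet E Q r) y v : XModel E r) =
      (fun a : Fin (r + 1) => iteratedDeriv (a : ℕ) (fun t =>
        fderiv ℝ (chartAt E (φ.symm (y.1 0)) ∘ φ.symm) (polyCurve y.1 t) (polyCurve v.1 t)) 0,
          v.2) := by
  have hb := param_base hφ hy
  set x := param hφ r y with hx
  set ψ := chartAt E (φ.symm (y.1 0)) with hψ
  have hψa : ψ ∈ atlas E Q := chart_mem_atlas E _
  -- Tangent vectors at `param hφ r y` are read in the preferred chart there, which is induced by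
  -- `ψ`, so this tangent map is the derivative of a coordinate change.
  have e1 : mfderiv 𝓘(ℝ, XModel E r) (IX E r) (param hφ r : XModel E r → XJet E Q r) y =
      fderiv ℝ (coordX ψ ∘ (param hφ r : XModel E r → XJet E Q r)) y := by
    rw [((contMDiffAt_param hφ hy).mdifferentiableAt (by simp)).mfderiv]
    have h1 : writtenInExtChartAt 𝓘(ℝ, XModel E r) (IX E r) y
        (param hφ r : XModel E r → XJet E Q r) = coordX ψ ∘ param hφ r := by
      funext y'
      simp only [writtenInExtChartAt, Function.comp, extChartAt_xJet, extChartAt_model_space_eq_id,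
        PartialEquiv.refl_symm, PartialEquiv.refl_coe, id]
      rw [← hx, hb]
    rw [h1, modelWithCornersSelf_coe, range_id, fderivWithin_univ, extChartAt_model_space_eq_id]
    rfl
  have hΦ := contDiffOn_transition hφ hψa
  have hΦo : IsOpen (φ.symm.trans ψ).source := (φ.symm.trans ψ).open_source
  set Φ := ψ ∘ φ.symm with hΦd
  set S : Set (JetModel E r × ℝ) := {x | polyCurve x.1 x.2 ∈ (φ.symm.trans ψ).source} with hS
  have hSo : IsOpen S := hΦo.preimage (contDiff_polyCurve r).continuous
  have hG : ContDiffOn ℝ ∞ (fun x : JetModel E r × ℝ => Φ (polyCurve x.1 x.2)) S :=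
    hΦ.comp (contDiff_polyCurve r).contDiffOn fun x hx => hx
  have hy0 : y.1 0 ∈ (φ.symm.trans ψ).source := ⟨hy, mem_chart_source E _⟩
  have hyS : (y.1, (0 : ℝ)) ∈ S := by
    change polyCurve y.1 0 ∈ (φ.symm.trans ψ).source
    rwa [polyCurve_zero]
  have e2 : (coordX ψ ∘ (param hφ r : XModel E r → XJet E Q r)) =ᶠ[𝓝 y] fun y =>
      ((fun a : Fin (r + 1) => iteratedDeriv (a : ℕ) (fun s => Φ (polyCurve y.1 s)) 0), y.2) := by
    filter_upwards [(hΦo.preimage ((continuous_apply 0).comp continuous_fst)).mem_nhds hy0]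
      with y' hy'
    exact coordX_param_apply hφ hψa hy'.1 hy'.2
  have hd : ∀ a : Fin (r + 1), DifferentiableAt ℝ
      (fun q : JetModel E r => iteratedDeriv (a : ℕ) (fun s => Φ (polyCurve q s)) 0) y.1 := by
    intro a
    have h1 := ((contDiffOn_iteratedDeriv_snd hSo hG a).contDiffAt
      (hSo.mem_nhds hyS)).differentiableAt (by simp)
    exact DifferentiableAt.comp y.1 (f := fun q : JetModel E r => (q, (0 : ℝ))) h1 (by fun_prop)
  have e3 : HasFDerivAt (fun y : XModel E r => ((fun a : Fin (r + 1) =>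
      iteratedDeriv (a : ℕ) (fun s => Φ (polyCurve y.1 s)) 0), y.2))
      (((ContinuousLinearMap.pi fun a : Fin (r + 1) => fderiv ℝ (fun q : JetModel E r =>
        iteratedDeriv (a : ℕ) (fun s => Φ (polyCurve q s)) 0) y.1).comp
          (ContinuousLinearMap.fst ℝ _ _)).prod (ContinuousLinearMap.snd ℝ _ _)) y := by
    refine HasFDerivAt.prodMk ?_ hasFDerivAt_snd
    exact HasFDerivAt.comp (g := fun q : JetModel E r => fun a : Fin (r + 1) =>
      iteratedDeriv (a : ℕ) (fun s => Φ (polyCurve q s)) 0) y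
      (hasFDerivAt_pi.2 fun a => (hd a).hasFDerivAt) hasFDerivAt_fst
  rw [e1]
  refine (DFunLike.congr_fun (e2.fderiv_eq.trans e3.fderiv) v).trans ?_
  refine Prod.ext ?_ rfl
  funext a
  refine (fderiv_iteratedDeriv_snd hSo hG a hyS v.1).trans ?_
  refine Filter.EventuallyEq.iteratedDeriv_eq _ ?_
  filter_upwards [(hSo.preimage (by fun_prop : Continuous fun s : ℝ => (y.1, s))).mem_nhds hyS]
    with s hs
  have h1 : DifferentiableAt ℝ Φ (polyCurve y.1 s) :=
    (hΦ.contDiffAt (hΦo.mem_nhds hs)).differentiableAt (by simp)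
  have h2 : HasFDerivAt (fun x : JetModel E r × ℝ => polyCurve x.1 x.2)
      (fderiv ℝ (fun x : JetModel E r × ℝ => polyCurve x.1 x.2) (y.1, s)) (y.1, s) :=
    ((contDiff_polyCurve r).differentiable (by simp) _).hasFDerivAt
  have h3 := (HasFDerivAt.comp (g := Φ) (y.1, s) h1.hasFDerivAt h2).fderiv
  -- For fixed time the polynomial curve is linear in its coefficients.
  have h4 : fderiv ℝ (fun x : JetModel E r × ℝ => polyCurve x.1 x.2) (y.1, s) (v.1, 0) =
      polyCurve v.1 s := by
    have hl : HasFDerivAt (fun q : JetModel E r => (q, s)) (ContinuousLinearMap.inl ℝ _ ℝ) y.1 :=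
      hasFDerivAt_prodMk_left y.1 s
    have h5 := (HasFDerivAt.comp (f := fun q : JetModel E r => (q, s)) y.1 h2 hl).fderiv
    let P : JetModel E r →L[ℝ] E := ∑ a : Fin (r + 1), (s ^ (a : ℕ) / ((a : ℕ).factorial : ℝ)) •
      (ContinuousLinearMap.proj a : JetModel E r →L[ℝ] E)
    have h6 : ((fun x : JetModel E r × ℝ => polyCurve x.1 x.2) ∘ fun q : JetModel E r => (q, s)) =
        P := by
      funext q
      simp [P, polyCurve]
    rw [h6, P.fderiv] at h5
    have h7 := DFunLike.congr_fun h5 v.1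
    refine h7.symm.trans ?_
    simp [P, polyCurve]
  change fderiv ℝ (Φ ∘ fun x : JetModel E r × ℝ => polyCurve x.1 x.2) (y.1, s) (v.1, 0) = _
  rw [h3]
  change fderiv ℝ Φ (polyCurve y.1 s) (fderiv ℝ (fun x : JetModel E r × ℝ =>
    polyCurve x.1 x.2) (y.1, s) (v.1, 0)) = _
  rw [h4]

end JetCharts

/-! ### Chart independence of the vertical endomorphisms, the projections and the canonical
injection. -/

section TangentCoordinates

theorem iteratedDeriv_prodMk {E F : Type*} [NormedAddCommGroup E] [NormedSpace ℝ E]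
    [NormedAddCommGroup F] [NormedSpace ℝ F] {c : ℝ → E} {w : ℝ → F} {t : ℝ}
    (hc : ContDiffAt ℝ ∞ c t) (hw : ContDiffAt ℝ ∞ w t) (a : ℕ) :
    iteratedDeriv a (fun s => (c s, w s)) t = (iteratedDeriv a c t, iteratedDeriv a w t) := by
  have h := hc.prodMk hw
  have hle : (a : WithTop ℕ∞) ≤ ∞ := by exact_mod_cast le_top
  have h1 := (ContinuousLinearMap.fst ℝ E F).iteratedFDeriv_comp_left h hle
  have h2 := (ContinuousLinearMap.snd ℝ E F).iteratedFDeriv_comp_left h hle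
  simp only [iteratedDeriv_eq_iteratedFDeriv]
  exact Prod.ext (DFunLike.congr_fun h1 fun _ => (1 : ℝ)).symm
    (DFunLike.congr_fun h2 fun _ => (1 : ℝ)).symm

variable {E : Type*} [NormedAddCommGroup E] [NormedSpace ℝ E]
  {Q : Type*} [TopologicalSpace Q] [ChartedSpace E Q] [IsManifold 𝓘(ℝ, E) ∞ Q]
variable {φ : OpenPartialHomeomorph Q E} (hφ : φ ∈ atlas E Q) {r : ℕ}

/-- The differential of the inverse of a natural chart of `T^r Q × ℝ`, in terms of arbitrary curves
representing the point and the tangent vector. -/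
theorem mfderiv_param_apply {y : XModel E r} (hy : y ∈ xTarget φ r) (v : XModel E r) {c w : ℝ → E}
    (hc : ContDiffAt ℝ ∞ c 0) (hw : ContDiffAt ℝ ∞ w 0)
    (hcy : ∀ a : Fin (r + 1), iteratedDeriv a c 0 = y.1 a)
    (hwv : ∀ a : Fin (r + 1), iteratedDeriv a w 0 = v.1 a) :
    (mfderiv 𝓘(ℝ, XModel E r) (IX E r) (param hφ r : XModel E r → XJet E Q r) y v : XModel E r) =
      (fun a : Fin (r + 1) => iteratedDeriv (a : ℕ) (fun t =>
        fderiv ℝ (chartAt E (φ.symm (y.1 0)) ∘ φ.symm) (c t) (w t)) 0, v.2) := by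
  refine (mfderiv_param_apply_polyCurve hφ hy v).trans (Prod.ext (funext fun a => ?_) rfl)
  have hp := (contDiff_polyCurve_right y.1).contDiffAt (x := (0 : ℝ))
  have hp' := (contDiff_polyCurve_right v.1).contDiffAt (x := (0 : ℝ))
  have hΦ : ContDiffAt ℝ ∞ (chartAt E (φ.symm (y.1 0)) ∘ φ.symm) (y.1 0) :=
    (contDiffOn_transition hφ (chart_mem_atlas E _)).contDiffAt
      ((φ.symm.trans _).open_source.mem_nhds ⟨hy, mem_chart_source E _⟩)
  have hf : ContDiffAt ℝ ∞ (fun p : E × E =>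
      fderiv ℝ (chartAt E (φ.symm (y.1 0)) ∘ φ.symm) p.1 p.2) (y.1 0, v.1 0) :=
    ((hΦ.fderiv_right (m := ∞) (by simp)).comp (y.1 0, v.1 0) contDiffAt_fst).clm_apply
      contDiffAt_snd
  -- The derivatives of `DΦ(c)w` up to order `r` depend only on the `r`-jet of the pair `(c, w)`, so
  -- the polynomial curves may be exchanged for any others with the same jets.
  refine iteratedDeriv_comp_congr (k := r) (hp.prodMk hp') (hc.prodMk hw) (f := fun p : E × E =>
      fderiv ℝ (chartAt E (φ.symm (y.1 0)) ∘ φ.symm) p.1 p.2) ?_ ?_ (Nat.le_of_lt_succ a.2)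
  · rwa [polyCurve_zero, polyCurve_zero]
  · intro b hb
    have h1 := iteratedDeriv_polyCurve y.1 ⟨b, Nat.lt_succ_of_le hb⟩
    have h2 := iteratedDeriv_polyCurve v.1 ⟨b, Nat.lt_succ_of_le hb⟩
    have h3 := hcy ⟨b, Nat.lt_succ_of_le hb⟩
    have h4 := hwv ⟨b, Nat.lt_succ_of_le hb⟩
    simp only at h1 h2 h3 h4
    rw [iteratedDeriv_prodMk hp hp', iteratedDeriv_prodMk hc hw, h1, h2, h3, h4]

theorem mfderiv_param_zero_left {y : XModel E r} (hy : y ∈ xTarget φ r) (s : ℝ) :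
    (mfderiv 𝓘(ℝ, XModel E r) (IX E r) (param hφ r : XModel E r → XJet E Q r) y (0, s) :
      XModel E r) = (0, s) := by
  refine (mfderiv_param_apply hφ hy (0, s) (c := polyCurve y.1) (w := 0)
    (contDiff_polyCurve_right y.1).contDiffAt contDiffAt_const
    (fun a => iteratedDeriv_polyCurve y.1 a) (fun a => ?_)).trans ?_
  · simp
  · refine Prod.ext (funext fun a => ?_) rfl
    simp

/-- The vertical endomorphisms have the same expression in all natural charts. -/
theorem vertEndo_mfderiv_param (β : ℕ) {y : XModel E r} (hy : y ∈ xTarget φ r) (v : XModel E r) :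
    vertEndo β (param hφ r y)
        (mfderiv 𝓘(ℝ, XModel E r) (IX E r) (param hφ r : XModel E r → XJet E Q r) y v) =
      mfderiv 𝓘(ℝ, XModel E r) (IX E r) (param hφ r : XModel E r → XJet E Q r) y
        (verticalMap E r β v.1, 0) := by
  have hp := (contDiff_polyCurve_right y.1).contDiffAt (x := (0 : ℝ))
  have hp' := (contDiff_polyCurve_right v.1).contDiffAt (x := (0 : ℝ))
  have hΦ : ContDiffAt ℝ ∞ (chartAt E (φ.symm (y.1 0)) ∘ φ.symm) (polyCurve y.1 0) := by
    rw [polyCurve_zero]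
    exact (contDiffOn_transition hφ (chart_mem_atlas E _)).contDiffAt
      ((φ.symm.trans _).open_source.mem_nhds ⟨hy, mem_chart_source E _⟩)
  have hf : ContDiffAt ℝ ∞ (fun t =>
      fderiv ℝ (chartAt E (φ.symm (y.1 0)) ∘ φ.symm) (polyCurve y.1 t) (polyCurve v.1 t)) 0 :=
    ((hΦ.fderiv_right (m := ∞) (by simp)).comp 0 hp).clm_apply hp'
  have h1 := mfderiv_param_apply_polyCurve hφ hy v
  -- `𝒥_β` multiplies the curve representing a vector by `t^β`; this commutes with the linear maps
  -- `DΦ(c(t))`.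
  have h2 := mfderiv_param_apply hφ hy (verticalMap E r β v.1, 0) (c := polyCurve y.1)
    (w := fun t => t ^ β • polyCurve v.1 t) hp ((contDiffAt_id.pow β).smul hp')
    (fun a => iteratedDeriv_polyCurve y.1 a) (fun a => by
      rw [iteratedDeriv_pow_smul_zero hp']
      have := iteratedDeriv_polyCurve v.1 ⟨a - β, (Nat.sub_le _ _).trans_lt a.2⟩
      simp only at this
      rw [this]
      rfl)
  refine (congrArg (vertEndo β (param hφ r y)) h1).trans (Eq.trans ?_ h2.symm)
  refine Prod.ext (funext fun a => ?_) rfl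
  simp only [map_smul]
  rw [iteratedDeriv_pow_smul_zero hf]
  rfl

variable (E) in
/-- The truncation `(q₀, …, q_k) ↦ (q₀, …, q_r)`. -/
def truncJet {k r : ℕ} (h : r ≤ k) : JetModel E k →L[ℝ] JetModel E r :=
  ContinuousLinearMap.pi fun a => ContinuousLinearMap.proj (Fin.castLE (Nat.succ_le_succ h) a)

variable (E) in
/-- The coordinate expression of the projection `T^k Q × ℝ → T^r Q × ℝ`. -/
def truncX {k r : ℕ} (h : r ≤ k) : XModel E k →L[ℝ] XModel E r :=
  (truncJet E h).prodMap (ContinuousLinearMap.id ℝ ℝ)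

variable (E) in
/-- The shift `(q₀, …, q_{r+1}) ↦ (q₁, …, q_{r+1})`. -/
def shiftJet (r : ℕ) : JetModel E (r + 1) →L[ℝ] JetModel E r :=
  ContinuousLinearMap.pi fun a => ContinuousLinearMap.proj a.succ

theorem jet_proj_chart_symm {k r : ℕ} (h : r ≤ k) {q : JetModel E k} (hq : q 0 ∈ φ.target) :
    ((jetChart k φ hφ).symm q : Jet E Q k).proj h = (jetChart r φ hφ).symm (truncJet E h q) := by
  have hq' : truncJet E h q 0 ∈ φ.target := hq
  have e0 : (curveOfCoord φ hφ q).toFun 0 = (curveOfCoord φ hφ (truncJet E h q)).toFun 0 := by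
    rw [curveOfCoord_zero hφ hq, curveOfCoord_zero hφ hq']
    rfl
  have hs : (curveOfCoord φ hφ q).toFun 0 ∈ φ.source := by
    rw [curveOfCoord_zero hφ hq]
    exact φ.map_target hq
  refine Quotient.sound (s := jetSetoid E Q r) ⟨e0, fun ψ hψ hψ0 => ?_⟩
  refine Curve.coord_congr hφ hψ e0 hs hψ0 ?_
  rw [coord_curveOfCoord_self hφ hq']
  funext a
  exact congrFun (coord_curveOfCoord_self hφ hq) (Fin.castLE (Nat.succ_le_succ h) a)

theorem proj_param {k r : ℕ} (h : r ≤ k) {y : XModel E k} (hy : y ∈ xTarget φ k) :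
    (param hφ k y).proj h = param hφ r (truncX E h y) :=
  Prod.ext (jet_proj_chart_symm hφ h hy) rfl

theorem truncX_mem_xTarget {k r : ℕ} (h : r ≤ k) {y : XModel E k} :
    truncX E h y ∈ xTarget φ r ↔ y ∈ xTarget φ k := Iff.rfl

theorem coordX_proj (hφ : φ ∈ atlas E Q) {k r : ℕ} (h : r ≤ k) {x : XJet E Q k} (hx : x.1.base ∈ φ.source) :
    coordX φ (x.proj h) = truncX E h (coordX φ x) := by
  have h1 := proj_param hφ h (coordX_mem_xTarget hφ hx)
  rw [param_coordX hφ hx] at h1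
  rw [h1, coordX_param hφ ((truncX_mem_xTarget h).2 (coordX_mem_xTarget hφ hx))]

theorem contMDiff_xProj {k r : ℕ} (h : r ≤ k) :
    ContMDiff (IX E k) (IX E r) ∞ (XJet.proj h : XJet E Q k → XJet E Q r) :=
  ((contMDiff_jetProj h).comp contMDiff_fst).prodMk contMDiff_snd

/-- The tangent map of the projection, in natural coordinates. -/
theorem mfderiv_xProj {k r : ℕ} (h : r ≤ k) (x : XJet E Q k) :
    mfderiv (IX E k) (IX E r) (XJet.proj h : XJet E Q k → XJet E Q r) x = truncX E h := by
  have hφ := chart_mem_atlas E x.1.base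
  have hx := mem_chart_source E x.1.base
  set φ := chartAt E x.1.base with hφd
  rw [((contMDiff_xProj h).contMDiffAt.mdifferentiableAt (by simp)).mfderiv]
  have hy := coordX_mem_xTarget hφ hx
  have h1 : writtenInExtChartAt (IX E k) (IX E r) x
      (XJet.proj h : XJet E Q k → XJet E Q r) =ᶠ[𝓝 (coordX φ x)] truncX E h := by
    filter_upwards [(isOpen_xTarget φ k).mem_nhds hy] with y hy
    simp only [writtenInExtChartAt, Function.comp, extChartAt_xJet, extChartAt_xJet_symm]
    -- The point and its projection have the same base point, hence preferred charts induced by the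
    -- same chart of `Q`; in these the projection is the linear truncation.
    have hb : (x.proj h).1.base = x.1.base := Jet.base_proj h x.1
    rw [hb, proj_param _ h hy, coordX_param _ ((truncX_mem_xTarget h).2 hy)]
  have h2 : (extChartAt (IX E k) x) x = coordX φ x := extChartAt_xJet x x
  rw [h2, ModelWithCorners.range_eq_univ, fderivWithin_univ, h1.fderiv_eq,
    ContinuousLinearMap.fderiv]

/-- The same curve `DΦ(c)w` represents the vector before and after projection; only the number of
its derivatives that are kept changes. -/
theorem mfderiv_xProj_comp_param {k r : ℕ} (h : r ≤ k) {y : XModel E k} (hy : y ∈ xTarget φ k)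
    (v : XModel E k) :
    truncX E h (mfderiv 𝓘(ℝ, XModel E k) (IX E k) (param hφ k : XModel E k → XJet E Q k) y v) =
      (mfderiv 𝓘(ℝ, XModel E r) (IX E r) (param hφ r : XModel E r → XJet E Q r) (truncX E h y)
        (truncX E h v) : XModel E r) := by
  have h1 := mfderiv_param_apply_polyCurve hφ hy v
  have h2 := mfderiv_param_apply hφ ((truncX_mem_xTarget h).2 hy) (truncX E h v)
    (c := polyCurve y.1) (w := polyCurve v.1) (contDiff_polyCurve_right y.1).contDiffAt
    (contDiff_polyCurve_right v.1).contDiffAt (fun a => iteratedDeriv_polyCurve y.1 (Fin.castLE (Nat.succ_le_succ h) a))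
    (fun a => iteratedDeriv_polyCurve v.1 (Fin.castLE (Nat.succ_le_succ h) a))
  exact (congrArg (truncX E h) h1).trans h2.symm

/-- The canonical injection `T^{r+1} Q → T(T^r Q)` has the same expression in all natural charts. -/
theorem mfderiv_param_shift {y : XModel E (r + 1)} (hy : y ∈ xTarget φ (r + 1)) (s : ℝ) :
    (mfderiv 𝓘(ℝ, XModel E r) (IX E r) (param hφ r : XModel E r → XJet E Q r)
        (truncX E (Nat.le_succ r) y) (shiftJet E r y.1, s) : XModel E r) =
      (jetInj (param hφ (r + 1) y).1, s) := by
  have hp := (contDiff_polyCurve_right y.1).contDiffAt (x := (0 : ℝ))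
  have hd : ContDiff ℝ ∞ (deriv (polyCurve y.1)) :=
    ((contDiff_infty_iff_deriv).1 (contDiff_polyCurve_right y.1)).2
  -- The shifted coordinates are the jet of `w = c'`, and `DΦ(c)c' = (Φ ∘ c)'`.
  have h2 := mfderiv_param_apply hφ ((truncX_mem_xTarget (Nat.le_succ r)).2 hy)
    (shiftJet E r y.1, s) (c := polyCurve y.1) (w := deriv (polyCurve y.1)) hp hd.contDiffAt
    (fun a => iteratedDeriv_polyCurve y.1 (Fin.castLE (Nat.succ_le_succ (Nat.le_succ r)) a))
    (fun a => by
      rw [← iteratedDeriv_succ']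
      exact iteratedDeriv_polyCurve y.1 a.succ)
  refine h2.trans (Prod.ext (funext fun a => ?_) rfl)
  have hψ := chart_mem_atlas E (φ.symm (y.1 0))
  have h3 := coordX_param_apply hφ hψ hy (mem_chart_source E _)
  have h4 : (jetInj (param hφ (r + 1) y).1 : JetModel E r) a =
      (coordX (chartAt E (φ.symm (y.1 0))) (param hφ (r + 1) y)).1 a.succ := by
    rw [← param_base hφ hy]
    rfl
  refine Eq.trans ?_ h4.symm
  rw [h3]
  change _ = iteratedDeriv ((a : ℕ) + 1) _ 0
  rw [iteratedDeriv_succ']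
  refine Filter.EventuallyEq.iteratedDeriv_eq _ ?_
  have hΦ := contDiffOn_transition hφ hψ
  have hΦo : IsOpen (φ.symm.trans (chartAt E (φ.symm (y.1 0)))).source :=
    (φ.symm.trans (chartAt E (φ.symm (y.1 0)))).open_source
  have hy0 : polyCurve y.1 0 ∈ (φ.symm.trans (chartAt E (φ.symm (y.1 0)))).source := by
    rw [polyCurve_zero]
    exact ⟨hy, mem_chart_source E _⟩
  filter_upwards [hp.continuousAt.eventually (hΦo.mem_nhds hy0)] with t ht
  have h5 := ((hΦ.contDiffAt (hΦo.mem_nhds ht)).differentiableAt (by simp)).hasFDerivAt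
  exact (h5.comp_hasDerivAt t
    ((contDiff_polyCurve_right y.1).differentiable (by simp) t).hasDerivAt).deriv.symm

theorem mfderiv_param_coordX (x : XJet E Q r) :
    mfderiv 𝓘(ℝ, XModel E r) (IX E r)
      (param (chart_mem_atlas E x.1.base) r : XModel E r → XJet E Q r)
        (coordX (chartAt E x.1.base) x) = ContinuousLinearMap.id ℝ (XModel E r) := by
  have h := mfderivWithin_range_extChartAt_symm (I := IX E r) (x := x)
  rw [ModelWithCorners.range_eq_univ, mfderivWithin_univ, extChartAt_xJet] at h
  have h1 : ((extChartAt (IX E r) x).symm : XModel E r → XJet E Q r) =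
    param (chart_mem_atlas E x.1.base) r := funext fun y => extChartAt_xJet_symm x y
  rw [h1] at h
  exact h

end TangentCoordinates

/-! ### The Lagrangian total derivative in coordinates: smoothness and semibasic order. -/

section JetForms

set_option synthInstance.maxHeartbeats 200000 in
theorem contDiff_clm_flip {F : Type*} [NormedAddCommGroup F] [NormedSpace ℝ F] :
    ContDiff ℝ ∞ (ContinuousLinearMap.flip : (F →L[ℝ] F →L[ℝ] ℝ) → F →L[ℝ] F →L[ℝ] ℝ) := by
  have : IsBoundedLinearMap ℝ
      (ContinuousLinearMap.flip : (F →L[ℝ] F →L[ℝ] ℝ) → F →L[ℝ] F →L[ℝ] ℝ) :=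
    { map_add := fun _ _ => rfl
      map_smul := fun _ _ => rfl
      bound := ⟨1, one_pos, fun f => by rw [ContinuousLinearMap.opNorm_flip, one_mul]⟩ }
  exact this.contDiff

variable {E : Type*} [NormedAddCommGroup E] [NormedSpace ℝ E]
  {Q : Type*} [TopologicalSpace Q] [ChartedSpace E Q] [IsManifold 𝓘(ℝ, E) ∞ Q]
variable {φ : OpenPartialHomeomorph Q E} (hφ : φ ∈ atlas E Q) {k r : ℕ}

/-- The expression of a one-form on `T^r Q × ℝ` in a natural chart. -/
def rep (ξ : OneForm (IX E r) (XJet E Q r)) : XModel E r → XModel E r →L[ℝ] ℝ :=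
  pullbackForm (I := 𝓘(ℝ, XModel E r)) (J := IX E r) (param hφ r) ξ

theorem localExpr_xJet (ξ : OneForm (IX E r) (XJet E Q r)) (x : XJet E Q r) :
    localExpr ξ x = rep (chart_mem_atlas E x.1.base) ξ := by
  have h1 : ((extChartAt (IX E r) x).symm : XModel E r → XJet E Q r) =
    param (chart_mem_atlas E x.1.base) r := funext fun y => extChartAt_xJet_symm x y
  unfold localExpr rep pullbackForm
  rw [h1]
  rfl

/-- Smooth one-forms on `T^r Q × ℝ`. -/
def IsSmoothForm (ξ : OneForm (IX E r) (XJet E Q r)) : Prop :=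
  ∀ ⦃φ : OpenPartialHomeomorph Q E⦄ (hφ : φ ∈ atlas E Q), ContDiffOn ℝ ∞ (rep hφ ξ) (xTarget φ r)

/-- One-forms on `T^r Q × ℝ` which are semibasic over `T^s Q`. -/
def IsSemibasic (s : ℕ) (ξ : OneForm (IX E r) (XJet E Q r)) : Prop :=
  ∀ ⦃φ : OpenPartialHomeomorph Q E⦄ (hφ : φ ∈ atlas E Q), ∀ y ∈ xTarget φ r, ∀ v : XModel E r,
    (∀ a : Fin (r + 1), (a : ℕ) ≤ s → v.1 a = 0) → rep hφ ξ y v = 0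

/-- Every tangent space is the model space, so vectors at propositionally equal points can be
compared there; this removes transport along equalities of base points. -/
theorem oneForm_congr (ξ : OneForm (IX E r) (XJet E Q r)) {x x' : XJet E Q r} (h : x = x')
    {u u' : XModel E r} (hu : u = u') :
    ξ x (u : TangentSpace (IX E r) x) = ξ x' (u' : TangentSpace (IX E r) x') := by
  subst h hu
  rfl

theorem iExtDeriv_congr (ξ : OneForm (IX E r) (XJet E Q r)) {x x' : XJet E Q r} (h : x = x')
    {u u' v v' : XModel E r} (hu : u = u') (hv : v = v') :
    iExtDeriv ξ x (u : TangentSpace (IX E r) x) (v : TangentSpace (IX E r) x) =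
      iExtDeriv ξ x' (u' : TangentSpace (IX E r) x') (v' : TangentSpace (IX E r) x') := by
  subst h hu hv
  rfl

theorem mdifferentiableAt_of_param {g : XJet E Q r → ℝ} {y : XModel E r} (hy : y ∈ xTarget φ r)
    (hg : DifferentiableAt ℝ (g ∘ param hφ r) y) :
    MDifferentiableAt (IX E r) 𝓘(ℝ, ℝ) g (param hφ r y) := by
  have hb := param_base_mem hφ hy
  have h1 : (g ∘ param hφ r) ∘ coordX φ =ᶠ[𝓝 (param hφ r y)] g := by
    filter_upwards [eventually_base_mem hφ hb] with x hx
    simp only [Function.comp, param_coordX hφ hx]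
  refine MDifferentiableAt.congr_of_eventuallyEq ?_ h1.symm
  have h2 := (contMDiffAt_coordX hφ hb).mdifferentiableAt (n := ∞) (by simp)
  refine MDifferentiableAt.comp (I' := 𝓘(ℝ, XModel E r)) _ ?_ h2
  rw [coordX_param hφ hy]
  exact hg.mdifferentiableAt

theorem mvfderiv_param_apply {g : XJet E Q r → ℝ} {y : XModel E r} (hy : y ∈ xTarget φ r)
    (hg : DifferentiableAt ℝ (g ∘ param hφ r) y) (v : XModel E r) :
    mvfderiv (IX E r) g (param hφ r y)
      (mfderiv 𝓘(ℝ, XModel E r) (IX E r) (param hφ r : XModel E r → XJet E Q r) y v) =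
        fderiv ℝ (g ∘ param hφ r) y v := by
  have h := mvfderiv_comp_apply (I := IX E r) (I' := 𝓘(ℝ, XModel E r)) y (mdifferentiableAt_of_param hφ hy hg)
    ((contMDiffAt_param hφ hy).mdifferentiableAt (by simp)) v
  refine h.symm.trans ?_
  have : mfderiv 𝓘(ℝ, XModel E r) 𝓘(ℝ, ℝ) (g ∘ param hφ r) y = fderiv ℝ (g ∘ param hφ r) y :=
    mfderiv_eq_fderiv
  exact DFunLike.congr_fun this v

theorem contDiffOn_comp_param {L : XJet E Q k → ℝ} (hL : ContMDiff (IX E k) 𝓘(ℝ, ℝ) ∞ L) :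
    ContDiffOn ℝ ∞ (L ∘ param hφ k) (xTarget φ k) := fun y hy => by
  have h := hL.contMDiffAt.comp y (contMDiffAt_param hφ hy)
  rw [contMDiffAt_iff_contDiffAt] at h
  exact h.contDiffWithinAt

theorem dLdz_param {L : XJet E Q k → ℝ} (hL : ContMDiff (IX E k) 𝓘(ℝ, ℝ) ∞ L) {y : XModel E k}
    (hy : y ∈ xTarget φ k) : dLdz L (param hφ k y) = fderiv ℝ (L ∘ param hφ k) y (0, 1) := by
  have hd := ((contDiffOn_comp_param hφ hL).contDiffAt
    ((isOpen_xTarget φ k).mem_nhds hy)).differentiableAt (by simp)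
  rw [← mvfderiv_param_apply hφ hy hd]
  exact congrArg (mvfderiv (IX E k) L (param hφ k y)) (mfderiv_param_zero_left hφ hy 1).symm

/-- The coordinate expression of `totalVec`. -/
def repTotal (L : XJet E Q k → ℝ) (h : k ≤ r + 1) (y : XModel E (r + 1)) : XModel E r :=
  (shiftJet E r y.1, L (param hφ k (truncX E h y)))

theorem contDiffOn_repTotal {L : XJet E Q k → ℝ} (hL : ContMDiff (IX E k) 𝓘(ℝ, ℝ) ∞ L)
    (h : k ≤ r + 1) : ContDiffOn ℝ ∞ (repTotal hφ L h) (xTarget φ (r + 1)) := by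
  refine ContDiffOn.prodMk ?_ ?_
  · exact ((shiftJet E r).contDiff.comp contDiff_fst).contDiffOn
  · exact (contDiffOn_comp_param hφ hL).comp (truncX E h).contDiff.contDiffOn
      fun y hy => (truncX_mem_xTarget h).2 hy

theorem totalVec_param (L : XJet E Q k → ℝ) (h : k ≤ r + 1) {y : XModel E (r + 1)}
    (hy : y ∈ xTarget φ (r + 1)) :
    (totalVec L h (param hφ (r + 1) y) : XModel E r) =
      mfderiv 𝓘(ℝ, XModel E r) (IX E r) (param hφ r : XModel E r → XJet E Q r)
        (truncX E (Nat.le_succ r) y) (repTotal hφ L h y) := by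
  refine Eq.trans ?_ (mfderiv_param_shift hφ hy _).symm
  change ((jetInj (param hφ (r + 1) y).1 : JetModel E r), L ((param hφ (r + 1) y).proj h)) = _
  rw [proj_param hφ h hy]

theorem contraction_totalVec_param (ξ : OneForm (IX E r) (XJet E Q r)) (L : XJet E Q k → ℝ)
    (h : k ≤ r + 1) {y : XModel E (r + 1)} (hy : y ∈ xTarget φ (r + 1)) :
    ξ ((param hφ (r + 1) y).proj (Nat.le_succ r)) (totalVec L h (param hφ (r + 1) y)) =
      rep hφ ξ (truncX E (Nat.le_succ r) y) (repTotal hφ L h y) :=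
  oneForm_congr ξ (proj_param hφ (Nat.le_succ r) hy) (totalVec_param hφ L h hy)

theorem differentiableAt_localExpr {ξ : OneForm (IX E r) (XJet E Q r)} (hξ : IsSmoothForm ξ)
    (x : XJet E Q r) : DifferentiableAt ℝ (localExpr ξ x) (extChartAt (IX E r) x x) := by
  rw [localExpr_xJet, extChartAt_xJet]
  exact ((hξ (chart_mem_atlas E x.1.base)).contDiffAt ((isOpen_xTarget _ r).mem_nhds
    (coordX_mem_xTarget (chart_mem_atlas E x.1.base) (mem_chart_source E _)))).differentiableAt
      (by simp)

theorem contDiffOn_rep_repTotal {L : XJet E Q k → ℝ} (hL : ContMDiff (IX E k) 𝓘(ℝ, ℝ) ∞ L)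
    (h : k ≤ r + 1) {ξ : OneForm (IX E r) (XJet E Q r)} (hξ : IsSmoothForm ξ) :
    ContDiffOn ℝ ∞ (fun y => rep hφ ξ (truncX E (Nat.le_succ r) y) (repTotal hφ L h y))
      (xTarget φ (r + 1)) :=
  ((hξ hφ).comp (truncX E (Nat.le_succ r)).contDiff.contDiffOn
    fun _ hy => (truncX_mem_xTarget _).2 hy).clm_apply (contDiffOn_repTotal hφ hL h)

/-- The coordinate expression of the Lagrangian total derivative of a one-form. -/
theorem rep_totalDForm {L : XJet E Q k → ℝ} (hL : ContMDiff (IX E k) 𝓘(ℝ, ℝ) ∞ L)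
    (h : k ≤ r + 1) {ξ : OneForm (IX E r) (XJet E Q r)} (hξ : IsSmoothForm ξ)
    {y : XModel E (r + 1)} (hy : y ∈ xTarget φ (r + 1)) (v : XModel E (r + 1)) :
    rep hφ (totalDForm L h ξ) y v =
      (fderiv ℝ (rep hφ ξ) (truncX E (Nat.le_succ r) y) (repTotal hφ L h y)
          (truncX E (Nat.le_succ r) v) -
        fderiv ℝ (rep hφ ξ) (truncX E (Nat.le_succ r) y) (truncX E (Nat.le_succ r) v)
          (repTotal hφ L h y)) +
      fderiv ℝ (fun y => rep hφ ξ (truncX E (Nat.le_succ r) y) (repTotal hφ L h y)) y v -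
      fderiv ℝ (L ∘ param hφ k) (truncX E h y) (0, 1) *
        rep hφ ξ (truncX E (Nat.le_succ r) y) (truncX E (Nat.le_succ r) v) := by
  set x := param hφ (r + 1) y with hx
  set w := mfderiv 𝓘(ℝ, XModel E (r + 1)) (IX E (r + 1))
    (param hφ (r + 1) : XModel E (r + 1) → XJet E Q (r + 1)) y v with hw
  have hyt : truncX E (Nat.le_succ r) y ∈ xTarget φ r := (truncX_mem_xTarget _).2 hy
  have hτx : x.proj (Nat.le_succ r) = param hφ r (truncX E (Nat.le_succ r) y) :=
    proj_param hφ (Nat.le_succ r) hy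
  have hτw : (mfderiv (IX E (r + 1)) (IX E r)
      (XJet.proj (Nat.le_succ r) : XJet E Q (r + 1) → XJet E Q r) x w : XModel E r) =
      mfderiv 𝓘(ℝ, XModel E r) (IX E r) (param hφ r : XModel E r → XJet E Q r)
        (truncX E (Nat.le_succ r) y) (truncX E (Nat.le_succ r) v) := by
    rw [mfderiv_xProj]
    exact mfderiv_xProj_comp_param hφ (Nat.le_succ r) hy v
  have t1 : iExtDeriv ξ (x.proj (Nat.le_succ r)) (totalVec L h x) (mfderiv (IX E (r + 1)) (IX E r)
      (XJet.proj (Nat.le_succ r) : XJet E Q (r + 1) → XJet E Q r) x w) =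
      fderiv ℝ (rep hφ ξ) (truncX E (Nat.le_succ r) y) (repTotal hφ L h y)
          (truncX E (Nat.le_succ r) v) -
        fderiv ℝ (rep hφ ξ) (truncX E (Nat.le_succ r) y) (truncX E (Nat.le_succ r) v)
          (repTotal hφ L h y) := by
    refine (iExtDeriv_congr ξ hτx (totalVec_param hφ L h hy) hτw).trans ?_
    -- `iExtDeriv` is computed in the preferred chart of each point; naturality replaces that moving
    -- chart by the fixed chart `φ`.
    have h1 := iExtDeriv_pullbackForm (contMDiffAt_param hφ hyt) (differentiableAt_localExpr hξ _)
      (repTotal hφ L h y)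
    have h2 := DFunLike.congr_fun h1 (truncX E (Nat.le_succ r) v)
    exact h2.symm.trans (iExtDeriv_modelSpace _ _ _ _)
  have t2 : mvfderiv (IX E (r + 1)) (fun x : XJet E Q (r + 1) =>
      ξ (x.proj (Nat.le_succ r)) (totalVec L h x)) x w =
      fderiv ℝ (fun y => rep hφ ξ (truncX E (Nat.le_succ r) y) (repTotal hφ L h y)) y v := by
    have h1 : ((fun x : XJet E Q (r + 1) => ξ (x.proj (Nat.le_succ r)) (totalVec L h x)) ∘
        param hφ (r + 1)) =ᶠ[𝓝 y] fun y =>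
          rep hφ ξ (truncX E (Nat.le_succ r) y) (repTotal hφ L h y) := by
      filter_upwards [(isOpen_xTarget φ (r + 1)).mem_nhds hy] with y' hy'
      exact contraction_totalVec_param hφ ξ L h hy'
    have h2 := ((contDiffOn_rep_repTotal hφ hL h hξ).contDiffAt
      ((isOpen_xTarget φ (r + 1)).mem_nhds hy)).differentiableAt (by simp)
    rw [← h1.fderiv_eq]
    exact mvfderiv_param_apply hφ hy (h1.symm.differentiableAt_iff.1 h2) v
  have t3 : dLdz L (x.proj h) = fderiv ℝ (L ∘ param hφ k) (truncX E h y) (0, 1) := by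
    rw [hx, proj_param hφ h hy]
    exact dLdz_param hφ hL ((truncX_mem_xTarget _).2 hy)
  have t4 : ξ (x.proj (Nat.le_succ r)) (mfderiv (IX E (r + 1)) (IX E r)
      (XJet.proj (Nat.le_succ r) : XJet E Q (r + 1) → XJet E Q r) x w) =
      rep hφ ξ (truncX E (Nat.le_succ r) y) (truncX E (Nat.le_succ r) v) :=
    oneForm_congr ξ hτx hτw
  rw [← t1, ← t2, ← t3, ← t4]
  rfl

theorem IsSmoothForm.totalDForm {L : XJet E Q k → ℝ} (hL : ContMDiff (IX E k) 𝓘(ℝ, ℝ) ∞ L)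
    (h : k ≤ r + 1) {ξ : OneForm (IX E r) (XJet E Q r)} (hξ : IsSmoothForm ξ) :
    IsSmoothForm (totalDForm L h ξ) := by
  intro φ hφ
  have hτ : ∀ y ∈ xTarget φ (r + 1), truncX E (Nat.le_succ r) y ∈ xTarget φ r :=
    fun y hy => (truncX_mem_xTarget _).2 hy
  have hτ' : ∀ y ∈ xTarget φ (r + 1), truncX E h y ∈ xTarget φ k :=
    fun y hy => (truncX_mem_xTarget _).2 hy
  have ht := (truncX E (Nat.le_succ r)).contDiff (n := ∞)
  have hS := contDiffOn_repTotal hφ hL h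
  have hA := (((hξ hφ).fderiv_of_isOpen (isOpen_xTarget φ r) (m := ∞) (by simp)).comp
    ht.contDiffOn hτ)
  have hB := (contDiffOn_rep_repTotal hφ hL h hξ).fderiv_of_isOpen (isOpen_xTarget φ (r + 1))
    (m := ∞) (by simp)
  have hC := (((contDiffOn_comp_param hφ hL).fderiv_of_isOpen (isOpen_xTarget φ k)
    (m := ∞) (by simp)).comp (truncX E h).contDiff.contDiffOn hτ').clm_apply
      (contDiffOn_const (c := ((0 : JetModel E k), (1 : ℝ))))
  have hD := (hξ hφ).comp ht.contDiffOn hτ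
  have hAf := ((contDiff_clm_flip (F := XModel E r)).comp_contDiffOn hA).clm_apply hS
  have hall := ((((hA.clm_apply hS).sub hAf).clm_comp
    (contDiffOn_const (c := truncX E (Nat.le_succ r)))).add hB).sub
      (hC.smul (hD.clm_comp (contDiffOn_const (c := truncX E (Nat.le_succ r)))))
  refine hall.congr fun y hy => ?_
  exact ContinuousLinearMap.ext fun v => rep_totalDForm hφ hL h hξ hy v

/-- Write `a` for the coordinate expression of `ξ` and `S` for that of `Γ`. In `D_Lξ(v)` the term
`Da(v)(S)` from `-dξ(v,Γ)` cancels against the derivative of `ξ(Γ)`. What remains involves `a` and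
its derivatives applied to the truncation of `v`, and `a(DS·v)`. The jet part of `DS·v` is the shift
of `v`, which costs exactly one order; its `z` part is killed by `a`. -/
theorem IsSemibasic.totalDForm {s : ℕ} {L : XJet E Q k → ℝ}
    (hL : ContMDiff (IX E k) 𝓘(ℝ, ℝ) ∞ L) (h : k ≤ r + 1) {ξ : OneForm (IX E r) (XJet E Q r)}
    (hξ : IsSmoothForm ξ) (hs : IsSemibasic s ξ) : IsSemibasic (s + 1) (totalDForm L h ξ) := by
  intro φ hφ y hy v hv
  have hyt : truncX E (Nat.le_succ r) y ∈ xTarget φ r := (truncX_mem_xTarget _).2 hy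
  have hv1 : ∀ a : Fin (r + 1), (a : ℕ) ≤ s → (truncX E (Nat.le_succ r) v).1 a = 0 :=
    fun a ha => hv _ (ha.trans (Nat.le_succ s))
  have ha := ((hξ hφ).contDiffAt ((isOpen_xTarget φ r).mem_nhds hyt)).differentiableAt
    (by simp) |>.hasFDerivAt
  have hS := ((contDiffOn_repTotal hφ hL h).contDiffAt
    ((isOpen_xTarget φ (r + 1)).mem_nhds hy)).differentiableAt (by simp) |>.hasFDerivAt
  -- For a fixed vector `u` of this kind, `y ↦ a(y)(u)` vanishes identically near the point, and so
  -- do its derivatives.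
  have hDv : ∀ w u : XModel E r, (∀ a : Fin (r + 1), (a : ℕ) ≤ s → u.1 a = 0) →
      fderiv ℝ (rep hφ ξ) (truncX E (Nat.le_succ r) y) w u = 0 := by
    intro w u hu
    have h1 : (fun y => rep hφ ξ y u) =ᶠ[𝓝 (truncX E (Nat.le_succ r) y)] fun _ => 0 := by
      filter_upwards [(isOpen_xTarget φ r).mem_nhds hyt] with y' hy' using hs hφ y' hy' u hu
    have h2 := (ha.clm_apply (hasFDerivAt_const u _)).fderiv
    rw [h1.fderiv_eq] at h2
    have h3 := DFunLike.congr_fun h2 w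
    simpa using h3.symm
  have hB : HasFDerivAt (fun y => rep hφ ξ (truncX E (Nat.le_succ r) y) (repTotal hφ L h y)) _ y :=
    (ha.comp y (truncX E (Nat.le_succ r)).hasFDerivAt).clm_apply hS
  have hSv : ∀ a : Fin (r + 1), (a : ℕ) ≤ s → (fderiv ℝ (repTotal hφ L h) y v).1 a = 0 := by
    intro a ha'
    have h1 : HasFDerivAt (fun y => (repTotal hφ L h y).1 a) _ y :=
      ((ContinuousLinearMap.proj a).comp (ContinuousLinearMap.fst ℝ (JetModel E r) ℝ)).hasFDerivAt.comp
        y hS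
    have h2 : HasFDerivAt (fun y : XModel E (r + 1) => (repTotal hφ L h y).1 a)
        (((ContinuousLinearMap.proj a.succ : JetModel E (r + 1) →L[ℝ] E)).comp
          (ContinuousLinearMap.fst ℝ (JetModel E (r + 1)) ℝ)) y :=
      ((ContinuousLinearMap.proj a.succ : JetModel E (r + 1) →L[ℝ] E).comp
        (ContinuousLinearMap.fst ℝ (JetModel E (r + 1)) ℝ)).hasFDerivAt
    have h3 := DFunLike.congr_fun (h1.unique h2) v
    refine h3.trans (hv a.succ ?_)
    simpa using ha'
  rw [rep_totalDForm hφ hL h hξ hy, hDv _ _ hv1, hB.fderiv, hs hφ _ hyt _ hv1]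
  have h5 := hs hφ _ hyt _ hSv
  simp [h5]

/-- The coordinate expression of `i(𝒥_β)dL`. -/
theorem rep_vertEndo {L : XJet E Q k → ℝ} (hL : ContMDiff (IX E k) 𝓘(ℝ, ℝ) ∞ L) (β : ℕ)
    {y : XModel E k} (hy : y ∈ xTarget φ k) (v : XModel E k) :
    rep hφ (fun y => (mvfderiv (IX E k) L y).comp (vertEndo β y)) y v =
      fderiv ℝ (L ∘ param hφ k) y (verticalMap E k β v.1, 0) := by
  have hd := ((contDiffOn_comp_param hφ hL).contDiffAt
    ((isOpen_xTarget φ k).mem_nhds hy)).differentiableAt (by simp)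
  rw [← mvfderiv_param_apply hφ hy hd]
  exact congrArg (mvfderiv (IX E k) L (param hφ k y)) (vertEndo_mfderiv_param hφ β hy v)

theorem isSmoothForm_vertEndo {L : XJet E Q k → ℝ} (hL : ContMDiff (IX E k) 𝓘(ℝ, ℝ) ∞ L) (β : ℕ) :
    IsSmoothForm (fun y => (mvfderiv (IX E k) L y).comp (vertEndo β y)) := by
  intro φ hφ
  let J : XModel E k →L[ℝ] XModel E k := ((verticalMap E k β).comp
    (ContinuousLinearMap.fst ℝ (JetModel E k) ℝ)).prod 0
  refine ContDiffOn.congr (((contDiffOn_comp_param hφ hL).fderiv_of_isOpen (isOpen_xTarget φ k)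
    (m := ∞) (by simp)).clm_comp (contDiffOn_const (c := J))) fun y hy => ?_
  exact ContinuousLinearMap.ext fun v => rep_vertEndo hφ hL β hy v

/-- The component of `𝒥_β v` of index `a ≤ k` involves only `v_{a-β}`, so no component of `v` beyond
`k - β` enters. -/
theorem isSemibasic_vertEndo {L : XJet E Q k → ℝ} (hL : ContMDiff (IX E k) 𝓘(ℝ, ℝ) ∞ L) (β : ℕ) :
    IsSemibasic (k - β) (fun y => (mvfderiv (IX E k) L y).comp (vertEndo β y)) := by
  intro φ hφ y hy v hv
  have h0 : verticalMap E k β v.1 = 0 := by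
    funext a
    change ((a : ℕ).descFactorial β : ℝ) • v.1 ⟨a - β, _⟩ = 0
    rw [hv ⟨a - β, _⟩ (Nat.sub_le_sub_right (Nat.le_of_lt_succ a.2) β), smul_zero]
  rw [rep_vertEndo hφ hL β hy, h0]
  exact map_zero _

theorem isSmoothForm_iterTotalDForm {L : XJet E Q k → ℝ} (hL : ContMDiff (IX E k) 𝓘(ℝ, ℝ) ∞ L)
    {ξ : OneForm (IX E k) (XJet E Q k)} (hξ : IsSmoothForm ξ) (j : ℕ) :
    IsSmoothForm (iterTotalDForm L ξ j) := by
  induction j with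
  | zero => exact hξ
  | succ j ih => exact IsSmoothForm.totalDForm hL _ ih

theorem isSemibasic_iterTotalDForm {L : XJet E Q k → ℝ} (hL : ContMDiff (IX E k) 𝓘(ℝ, ℝ) ∞ L)
    {ξ : OneForm (IX E k) (XJet E Q k)} (hξ : IsSmoothForm ξ) {s : ℕ} (hs : IsSemibasic s ξ)
    (j : ℕ) : IsSemibasic (s + j) (iterTotalDForm L ξ j) := by
  induction j with
  | zero => exact hs
  | succ j ih => exact IsSemibasic.totalDForm hL _ (isSmoothForm_iterTotalDForm hL hξ j) ih

theorem IsSemibasic.apply_eq_zero {s : ℕ} {ξ : OneForm (IX E r) (XJet E Q r)}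
    (hs : IsSemibasic s ξ) (x : XJet E Q r) {v : XModel E r}
    (hv : ∀ a : Fin (r + 1), (a : ℕ) ≤ s → v.1 a = 0) : ξ x v = 0 := by
  have hφ := chart_mem_atlas E x.1.base
  have hx := mem_chart_source E x.1.base
  have h1 := hs hφ _ (coordX_mem_xTarget hφ hx) v hv
  refine Eq.trans ?_ h1
  refine oneForm_congr ξ (param_coordX hφ hx).symm ?_
  rw [mfderiv_param_coordX]
  rfl

end JetForms

/-! ### Contraction of the Cartan form with a holonomic field gives `E_L + L`. -/

section EnergyIdentity
variable {E : Type*} [NormedAddCommGroup E] [NormedSpace ℝ E]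
  {Q : Type*} [TopologicalSpace Q] [ChartedSpace E Q] [IsManifold 𝓘(ℝ, E) ∞ Q]
variable {φ : OpenPartialHomeomorph Q E} (hφ : φ ∈ atlas E Q) {k r : ℕ}

variable (E) in
/-- Extension of `(q₀, …, q_r)` by zeros to `(q₀, …, q_k)`. -/
def extJet (r k : ℕ) : JetModel E r →L[ℝ] JetModel E k :=
  ContinuousLinearMap.pi fun a : Fin (k + 1) =>
    if h : (a : ℕ) < r + 1 then ContinuousLinearMap.proj (⟨a, h⟩ : Fin (r + 1)) else 0

theorem extJet_apply_of_lt (q : JetModel E r) (a : Fin (k + 1)) (h : (a : ℕ) < r + 1) :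
    extJet E r k q a = q ⟨a, h⟩ := by
  simp only [extJet, ContinuousLinearMap.pi_apply, h, dite_true, ContinuousLinearMap.proj_apply]

theorem truncJet_extJet (h : r ≤ k) (q : JetModel E r) : truncJet E h (extJet E r k q) = q := by
  funext a
  exact extJet_apply_of_lt q _ a.2

variable (E) in
/-- Extension by zeros of the coordinates on `T^r Q × ℝ`. -/
def extX (r k : ℕ) : XModel E r →L[ℝ] XModel E k :=
  (extJet E r k).prodMap (ContinuousLinearMap.id ℝ ℝ)

theorem truncX_extX (h : r ≤ k) (y : XModel E r) : truncX E h (extX E r k y) = y :=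
  Prod.ext (truncJet_extJet h y.1) rfl

/-- The projection `T^k Q × ℝ → T^r Q × ℝ` is surjective. -/
theorem xProj_surjective (h : r ≤ k) :
    Function.Surjective (XJet.proj h : XJet E Q k → XJet E Q r) := by
  intro x
  have hφ := chart_mem_atlas E x.1.base
  have hx := mem_chart_source E x.1.base
  have hy : extX E r k (coordX (chartAt E x.1.base) x) ∈ xTarget (chartAt E x.1.base) k := by
    rw [← truncX_mem_xTarget h, truncX_extX]
    exact coordX_mem_xTarget hφ hx
  refine ⟨param hφ k (extX E r k (coordX (chartAt E x.1.base) x)), ?_⟩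
  rw [proj_param hφ h hy, truncX_extX, param_coordX hφ hx]

theorem xProj_xProj {s : ℕ} (h : r ≤ k) (h' : s ≤ r) (x : XJet E Q k) :
    (x.proj h).proj h' = x.proj (h'.trans h) := Prod.ext (Jet.proj_proj h h' x.1) rfl

theorem chartAt_jetProj (h : r ≤ k) (p : Jet E Q k) (a : Fin (r + 1)) :
    (chartAt (JetModel E r) (p.proj h) (p.proj h) : JetModel E r) a =
      (chartAt (JetModel E k) p p : JetModel E k) (Fin.castLE (Nat.succ_le_succ h) a) := by
  have h1 := coordX_proj (x := (p, (0 : ℝ))) (chart_mem_atlas E p.base) h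
    (mem_chart_source E p.base)
  have h2 : (chartAt (JetModel E r) (p.proj h) (p.proj h) : JetModel E r) =
      (coordX (chartAt E p.base) (XJet.proj h (p, (0 : ℝ)))).1 := by
    rw [chartAt_jet, Jet.base_proj]
    rfl
  rw [h2, h1]
  rfl

/-- The projections are compatible with the total vector fields. -/
theorem truncX_totalVec {s : ℕ} (L : XJet E Q k → ℝ) (h : k ≤ r + 1) (h' : k ≤ s + 1) (hs : s ≤ r)
    (x : XJet E Q (r + 1)) :
    truncX E hs (totalVec L h x) =
      (totalVec L h' (x.proj (Nat.succ_le_succ hs)) : XModel E s) := by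
  refine Prod.ext (funext fun a => ?_) ?_
  · exact (chartAt_jetProj (Nat.succ_le_succ hs) x.1 a.succ).symm
  · change L _ = L _
    rw [xProj_xProj]

/-- `i(Γ) i(𝒥_β) dL = Δ_β(L)`. -/
theorem vertEndo_totalVec (L : XJet E Q k → ℝ) (h : k ≤ r + 1) (b : ℕ) (x : XJet E Q (r + 1)) :
    vertEndo (b + 1) (x.proj (Nat.le_succ r)) (totalVec L h x) =
      canonicalVField (b + 1) (x.proj (Nat.le_succ r)) := by
  refine Prod.ext (funext fun a => ?_) rfl
  change ((a : ℕ).descFactorial (b + 1) : ℝ) • (chartAt (JetModel E (r + 1)) x.1 x.1 :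
      JetModel E (r + 1)) (Fin.succ ⟨a - (b + 1), _⟩) = ((a : ℕ).descFactorial (b + 1) : ℝ) •
    (chartAt (JetModel E r) (x.1.proj (Nat.le_succ r)) (x.1.proj (Nat.le_succ r)) : JetModel E r)
      ⟨a - b, _⟩
  rw [chartAt_jetProj]
  -- The indices `(a - (b + 1)) + 1` and `a - b` differ only when `a ≤ b`, and there the coefficient
  -- is zero.
  rcases lt_or_ge (a : ℕ) (b + 1) with hab | hab
  · rw [Nat.descFactorial_eq_zero_iff_lt.2 hab, Nat.cast_zero, zero_smul, zero_smul]
  · refine congrArg (fun i => ((a : ℕ).descFactorial (b + 1) : ℝ) •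
      (chartAt (JetModel E (r + 1)) x.1 x.1 : JetModel E (r + 1)) i) (Fin.ext ?_)
    simp only [Fin.succ_mk, Fin.castLE_mk]
    omega

/-- Only the pull-back of `F` to `T^{r+1}Q × ℝ` is visibly smooth. In a chart, extension of the
coordinates by zero is a smooth section of the projection, and restricting to it recovers `F`. -/
theorem mdifferentiable_of_contraction {L : XJet E Q k → ℝ}
    (hL : ContMDiff (IX E k) 𝓘(ℝ, ℝ) ∞ L) (h : k ≤ r + 1) {ξ : OneForm (IX E r) (XJet E Q r)}
    (hξ : IsSmoothForm ξ) {F : XJet E Q r → ℝ}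
    (hF : ∀ x : XJet E Q (r + 1), ξ (x.proj (Nat.le_succ r)) (totalVec L h x) =
      F (x.proj (Nat.le_succ r))) : MDifferentiable (IX E r) 𝓘(ℝ, ℝ) F := by
  intro x
  have hφ := chart_mem_atlas E x.1.base
  have hx := mem_chart_source E x.1.base
  set φ := chartAt E x.1.base
  have hy := coordX_mem_xTarget hφ hx
  have hext : ∀ y ∈ xTarget φ r, extX E r (r + 1) y ∈ xTarget φ (r + 1) := fun y hy => by
    rwa [← truncX_mem_xTarget (Nat.le_succ r), truncX_extX]
  have h1 : ContDiffOn ℝ ∞ (F ∘ param hφ r) (xTarget φ r) := by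
    refine ((contDiffOn_rep_repTotal hφ hL h hξ).comp (extX E r (r + 1)).contDiff.contDiffOn
      hext).congr fun y hy => ?_
    have h2 := contraction_totalVec_param hφ ξ L h (hext y hy)
    rw [hF, proj_param hφ _ (hext y hy), truncX_extX] at h2
    rw [Function.comp, h2, Function.comp, truncX_extX]
  have h2 := mdifferentiableAt_of_param hφ hy ((h1.contDiffAt
    ((isOpen_xTarget φ r).mem_nhds hy)).differentiableAt (by simp))
  rwa [param_coordX hφ hx] at h2

/-- The total derivative commutes with contraction by the total vector field. -/
theorem totalDForm_totalVec {L : XJet E Q k → ℝ} (hL : ContMDiff (IX E k) 𝓘(ℝ, ℝ) ∞ L)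
    (h : k ≤ r + 1) (h' : k ≤ r + 1 + 1) {ξ : OneForm (IX E r) (XJet E Q r)}
    (hξ : IsSmoothForm ξ) {F : XJet E Q r → ℝ}
    (hF : ∀ x : XJet E Q (r + 1), ξ (x.proj (Nat.le_succ r)) (totalVec L h x) =
      F (x.proj (Nat.le_succ r))) (x : XJet E Q (r + 1 + 1)) :
    totalDForm L h ξ (x.proj (Nat.le_succ (r + 1))) (totalVec L h' x) =
      totalD L h F (x.proj (Nat.le_succ (r + 1))) := by
  set x₁ := x.proj (Nat.le_succ (r + 1)) with hx₁
  set u := totalVec L h' x with hu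
  have hτ : mfderiv (IX E (r + 1)) (IX E r)
      (XJet.proj (Nat.le_succ r) : XJet E Q (r + 1) → XJet E Q r) x₁ u = totalVec L h x₁ := by
    rw [mfderiv_xProj]
    exact truncX_totalVec L h' h (Nat.le_succ r) x
  have hF' : (fun y : XJet E Q (r + 1) => ξ (y.proj (Nat.le_succ r)) (totalVec L h y)) =
      F ∘ XJet.proj (Nat.le_succ r) := funext hF
  have t2 : mvfderiv (IX E (r + 1)) (fun y : XJet E Q (r + 1) =>
      ξ (y.proj (Nat.le_succ r)) (totalVec L h y)) x₁ u =
      mvfderiv (IX E r) F (x₁.proj (Nat.le_succ r)) (totalVec L h x₁) := by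
    rw [hF']
    refine (mvfderiv_comp_apply (I := IX E r) (I' := IX E (r + 1)) x₁
      (mdifferentiable_of_contraction hL h hξ hF _)
      ((contMDiff_xProj (Nat.le_succ r)).contMDiffAt.mdifferentiableAt (by simp)) u).trans ?_
    rw [hτ]
  change iExtDeriv ξ (x₁.proj (Nat.le_succ r)) (totalVec L h x₁) (mfderiv (IX E (r + 1)) (IX E r)
      (XJet.proj (Nat.le_succ r) : XJet E Q (r + 1) → XJet E Q r) x₁ u) +
    mvfderiv (IX E (r + 1)) (fun y : XJet E Q (r + 1) =>
      ξ (y.proj (Nat.le_succ r)) (totalVec L h y)) x₁ u -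
    dLdz L (x₁.proj h) * ξ (x₁.proj (Nat.le_succ r)) (mfderiv (IX E (r + 1)) (IX E r)
      (XJet.proj (Nat.le_succ r) : XJet E Q (r + 1) → XJet E Q r) x₁ u) = _
  -- In Cartan's formula `dξ(Γ,Γ) = 0`; what is left is `Γ(F) - (∂L/∂z)F`.
  rw [t2, hτ, hF, iExtDeriv_apply_self, zero_add]
  rfl

theorem iterTotalDForm_totalVec {L F : XJet E Q k → ℝ} (hL : ContMDiff (IX E k) 𝓘(ℝ, ℝ) ∞ L)
    {ξ : OneForm (IX E k) (XJet E Q k)} (hξ : IsSmoothForm ξ)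
    (hF : ∀ x : XJet E Q (k + 1), ξ (x.proj (Nat.le_succ k)) (totalVec L (Nat.le_succ k) x) =
      F (x.proj (Nat.le_succ k))) (j : ℕ) (x : XJet E Q (k + j + 1)) :
    iterTotalDForm L ξ j (x.proj (Nat.le_succ (k + j)))
      (totalVec L (Nat.le_add_right k (j + 1)) x) =
        iterTotalD L F j (x.proj (Nat.le_succ (k + j))) := by
  induction j with
  | zero => exact hF x
  | succ j ih => exact totalDForm_totalVec hL _ _ (isSmoothForm_iterTotalDForm hL hξ j) ih x

variable {m : ℕ} {L : XJet E Q (m + 1) → ℝ}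

theorem cartanForm_apply (x : XJet E Q (2 * m + 1)) (u : XModel E (2 * m + 1)) :
    cartanForm L x u = ∑ b : Fin (m + 1),
      ((-1 : ℝ) ^ (b : ℕ) / (((b : ℕ) + 1).factorial : ℝ)) *
        iterTotalDForm L (fun y => (mvfderiv (IX E (m + 1)) L y).comp (vertEndo ((b : ℕ) + 1) y)) b
          (x.proj (level_le b)) (truncX E (level_le b) u) := by
  have h : ∀ b : Fin (m + 1), mfderiv (IX E (2 * m + 1)) (IX E (m + 1 + b))
      (XJet.proj (level_le b) : XJet E Q (2 * m + 1) → XJet E Q (m + 1 + b)) x =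
        truncX E (level_le b) := fun b => mfderiv_xProj _ x
  unfold cartanForm
  simp only [h]
  exact sum_apply _ _ _

/-- `i(Γ)θ_L = E_L + L`. -/
theorem cartanForm_totalVec (hL : ContMDiff (IX E (m + 1)) 𝓘(ℝ, ℝ) ∞ L)
    (h : m + 1 ≤ 2 * m + 1 + 1) (x : XJet E Q (2 * m + 1 + 1)) :
    cartanForm L (x.proj (Nat.le_succ _)) (totalVec L h x) =
      energy L (x.proj (Nat.le_succ _)) + L ((x.proj (Nat.le_succ _)).proj (order_le m)) := by
  refine (cartanForm_apply _ _).trans ?_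
  rw [energy, sub_add_cancel]
  refine Finset.sum_congr rfl fun b _ => ?_
  congr 1
  have h1 := iterTotalDForm_totalVec (F := fun y => mvfderiv (IX E (m + 1)) L y
    (canonicalVField ((b : ℕ) + 1) y)) hL (isSmoothForm_vertEndo hL ((b : ℕ) + 1))
    (fun x => congrArg (mvfderiv (IX E (m + 1)) L (x.proj (Nat.le_succ (m + 1))))
      (vertEndo_totalVec L (Nat.le_succ (m + 1)) b x)) b
        (x.proj (Nat.succ_le_succ (level_le b)))
  have e : (x.proj (Nat.succ_le_succ (level_le b))).proj (Nat.le_succ (m + 1 + b)) =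
      (x.proj (Nat.le_succ _)).proj (level_le b) := by
    rw [xProj_xProj, xProj_xProj]
  rw [← e]
  refine Eq.trans ?_ h1
  exact oneForm_congr _ rfl (truncX_totalVec L h _ (level_le b) x)

end EnergyIdentity

/-! ### The Cartan form is semibasic and defines the Legendre covector. -/

section LegendreMap
variable {E : Type*} [NormedAddCommGroup E] [NormedSpace ℝ E]
  {Q : Type*} [TopologicalSpace Q] [ChartedSpace E Q] [IsManifold 𝓘(ℝ, E) ∞ Q]
  {m : ℕ} {L : XJet E Q (m + 1) → ℝ}

/-- The summand of index `β` is semibasic of order `(k - β) + (β - 1) = k - 1`, for every `β`.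
Nothing is required of `u.2`, so `∂/∂z` is annihilated too. -/
theorem cartanForm_apply_eq_zero (hL : ContMDiff (IX E (m + 1)) 𝓘(ℝ, ℝ) ∞ L)
    (x : XJet E Q (2 * m + 1)) {u : XModel E (2 * m + 1)} (hu : truncJet E (base_le m) u.1 = 0) :
    cartanForm L x u = 0 := by
  rw [cartanForm_apply]
  refine Finset.sum_eq_zero fun b _ => ?_
  have h1 := isSemibasic_iterTotalDForm hL (isSmoothForm_vertEndo hL ((b : ℕ) + 1))
    (isSemibasic_vertEndo hL ((b : ℕ) + 1)) b
  have h2 := h1.apply_eq_zero (x.proj (level_le b)) (v := truncX E (level_le b) u) (fun a ha => by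
    have ha' : (a : ℕ) < m + 1 := by omega
    exact congrFun hu ⟨a, ha'⟩)
  rw [h2, mul_zero]

/-- The choice in `extendedLegendre` needs a witness: `θ_L` composed with extension by zero. It
works because a vector and the zero extension of its truncation differ by a vertical vector, which
`θ_L` kills. -/
theorem extendedLegendre_spec (hL : ContMDiff (IX E (m + 1)) 𝓘(ℝ, ℝ) ∞ L)
    (x : XJet E Q (2 * m + 1)) (u : XModel E (2 * m + 1)) :
    cartanForm L x u = extendedLegendre L x (truncX E (base_le m) u) := by
  have h := Classical.epsilon_spec (p := fun ζ : TangentSpace (IX E m) (x.proj (base_le m)) →L[ℝ] ℝ =>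
    ∀ u : TangentSpace (IX E (2 * m + 1)) x,
      cartanForm L x u = ζ (mfderiv (IX E (2 * m + 1)) (IX E m) (XJet.proj (base_le m)) x u)) (by
    refine ⟨(cartanForm L x : XModel E (2 * m + 1) →L[ℝ] ℝ).comp (extX E m (2 * m + 1)), ?_⟩
    intro (u : XModel E (2 * m + 1))
    rw [mfderiv_xProj]
    have h1 := cartanForm_apply_eq_zero hL x (u := u -
      extX E m (2 * m + 1) (truncX E (base_le m) u)) (by
        change truncJet E (base_le m) (u.1 -
          extJet E m (2 * m + 1) (truncJet E (base_le m) u.1)) = 0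
        rw [map_sub, truncJet_extJet, sub_self])
    have h2 := (map_sub (cartanForm L x : XModel E (2 * m + 1) →L[ℝ] ℝ) u
      (extX E m (2 * m + 1) (truncX E (base_le m) u))).symm.trans h1
    exact sub_eq_zero.1 h2)
  exact (h u).trans (congrArg (extendedLegendre L x)
    (DFunLike.congr_fun (mfderiv_xProj (base_le m) x) u))

theorem cartanForm_eq_legendreCovector (hL : ContMDiff (IX E (m + 1)) 𝓘(ℝ, ℝ) ∞ L)
    (x : XJet E Q (2 * m + 1)) (u : XModel E (2 * m + 1)) :
    cartanForm L x u = legendreCovector L x (truncJet E (base_le m) u.1) := by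
  have h0 : cartanForm L x u = cartanForm L x ((u.1, 0) : XModel E (2 * m + 1)) := by
    have h1 := cartanForm_apply_eq_zero hL x (u := (0, u.2)) (map_zero _)
    have h2 := map_add (cartanForm L x : XModel E (2 * m + 1) →L[ℝ] ℝ) (u.1, 0) (0, u.2)
    have h3 : ((u.1, 0) : XModel E (2 * m + 1)) + (0, u.2) = u := by simp
    rw [h3] at h2
    exact h2.trans (add_eq_left.2 h1)
  rw [h0, extendedLegendre_spec hL]
  have h4 : mfderiv (IJ E m) (IX E m) (fun q : Jet E Q m => (q, x.2)) (x.1.proj (base_le m)) =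
      ContinuousLinearMap.inl ℝ (JetModel E m) ℝ := mfderiv_prod_left
  unfold legendreCovector
  rw [h4]
  rfl

end LegendreMap

/-! ### The canonical contact form in coordinates and its nondegeneracy. -/

section CanonicalForm
variable {F : Type*} [NormedAddCommGroup F] [NormedSpace ℝ F] {H : Type*} [TopologicalSpace H]
  {I : ModelWithCorners ℝ F H} {M : Type*} [TopologicalSpace M] [ChartedSpace H M]
  [IsManifold I ∞ M]

variable (I) in
/-- The model of `T*M × ℝ`. -/
abbrev cotModel : ModelWithCorners ℝ ((F × (F →L[ℝ] ℝ)) × ℝ)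
    (ModelProd (ModelProd H (F →L[ℝ] ℝ)) ℝ) :=
  (I.prod 𝓘(ℝ, F →L[ℝ] ℝ)).prod 𝓘(ℝ, ℝ)

theorem extChartAt_cot_fst (y y' : CotBundle I M × ℝ) :
    (extChartAt (cotModel I) y y').1.1 = extChartAt I y.1.proj y'.1.proj := by
  rw [extChartAt_prod, FiberBundle.extChartAt]
  rfl

theorem extChartAt_cot_snd (y y' : CotBundle I M × ℝ) :
    (extChartAt (cotModel I) y y').2 = y'.2 := by
  rw [extChartAt_prod]
  rfl

theorem extChartAt_cot_covector (y y' : CotBundle I M × ℝ) (v : F) :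
    (extChartAt (cotModel I) y y').1.2 v =
      (y'.1.snd : TangentSpace I y'.1.proj →L[ℝ] ℝ)
        ((trivializationAt F (TangentSpace I) y.1.proj).symmL ℝ y'.1.proj v) := by
  rw [extChartAt_prod, FiberBundle.extChartAt]
  change (ContinuousLinearMap.inCoordinates F (TangentSpace I) ℝ (Trivial M ℝ) y.1.proj y'.1.proj
    y.1.proj y'.1.proj y'.1.snd) v = _
  rw [ContinuousLinearMap.inCoordinates]
  change ((trivializationAt ℝ (Trivial M ℝ) y.1.proj).continuousLinearMapAt ℝ y'.1.proj) _ = _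
  have h : (trivializationAt ℝ (Trivial M ℝ) y.1.proj).continuousLinearMapAt ℝ y'.1.proj =
      ContinuousLinearMap.id ℝ ℝ := Bundle.Trivial.continuousLinearMapAt_trivialization ℝ M ℝ _
  rw [h]
  rfl

theorem mem_chart_source_of_mem_cot_target (y : CotBundle I M × ℝ)
    {Y : (F × (F →L[ℝ] ℝ)) × ℝ} (hY : Y ∈ (extChartAt (cotModel I) y).target) :
    ((extChartAt (cotModel I) y).symm Y).1.proj ∈ (chartAt H y.1.proj).source := by
  have h := (extChartAt (cotModel I) y).map_target hY
  rw [extChartAt_prod, PartialEquiv.prod_source, FiberBundle.extChartAt,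
    PartialEquiv.trans_source] at h
  have h1 := h.1.2.1
  rw [extChartAt_source] at h1
  exact h1

/-- In the natural chart `(q, p, z)` the canonical contact form is `dz - p dq`. -/
theorem localExpr_canonicalContactForm [I.Boundaryless] (y : CotBundle I M × ℝ) {Y : (F × (F →L[ℝ] ℝ)) × ℝ}
    (hY : Y ∈ (extChartAt (cotModel I) y).target) (u : (F × (F →L[ℝ] ℝ)) × ℝ) :
    localExpr (canonicalContactForm : OneForm (cotModel I) (CotBundle I M × ℝ)) y Y u =
      u.2 - Y.1.2 u.1.1 := by
  set e := extChartAt (cotModel I) y with he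
  set x := e.symm Y with hx
  set T := mfderiv 𝓘(ℝ, (F × (F →L[ℝ] ℝ)) × ℝ) (cotModel I) e.symm Y with hT
  have hes : MDifferentiableAt 𝓘(ℝ, (F × (F →L[ℝ] ℝ)) × ℝ) (cotModel I) e.symm Y := by
    have := mdifferentiableWithinAt_extChartAt_symm (I := cotModel I) (x := y) hY
    rwa [ModelWithCorners.range_eq_univ, mdifferentiableWithinAt_univ] at this
  have hxs := mem_chart_source_of_mem_cot_target y hY
  have heY : ∀ Y' ∈ e.target, e (e.symm Y') = Y' := fun Y' hY' => e.right_inv hY'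
  have htn : e.target ∈ 𝓝 Y := (isOpen_extChartAt_target y).mem_nhds hY
  have t1 : mfderiv (cotModel I) 𝓘(ℝ, ℝ) (fun y : CotBundle I M × ℝ => y.2) x (T u) = u.2 := by
    have h1 := mfderiv_comp_apply (I' := cotModel I) (I'' := 𝓘(ℝ, ℝ))
      (g := fun y : CotBundle I M × ℝ => y.2) Y (mdifferentiableAt_snd) hes u
    refine h1.symm.trans ?_
    have h2 : (fun y : CotBundle I M × ℝ => y.2) ∘ e.symm =ᶠ[𝓝 Y] Prod.snd := by
      filter_upwards [htn] with Y' hY'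
      have := extChartAt_cot_snd y (e.symm Y')
      rw [← he, heY Y' hY'] at this
      exact this.symm
    rw [h2.mfderiv_eq, mfderiv_eq_fderiv]
    exact DFunLike.congr_fun fderiv_snd u
  have t2 : mfderiv (cotModel I) I (fun y : CotBundle I M × ℝ => y.1.proj) x (T u) =
      mfderiv 𝓘(ℝ, F) I (extChartAt I y.1.proj).symm Y.1.1 u.1.1 := by
    have hp : MDifferentiableAt (cotModel I) I (fun y : CotBundle I M × ℝ => y.1.proj) x :=
      MDifferentiableAt.comp (I' := I.prod 𝓘(ℝ, F →L[ℝ] ℝ)) x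
        ((contMDiff_proj (n := ∞) (IB := I) (fun x : M => TangentSpace I x →L[ℝ] Trivial M ℝ x)
          ).contMDiffAt.mdifferentiableAt (by simp)) mdifferentiableAt_fst
    have h1 := mfderiv_comp_apply (I' := cotModel I) (I'' := I)
      (g := fun y : CotBundle I M × ℝ => y.1.proj) Y hp hes u
    refine h1.symm.trans ?_
    have h2 : (fun y : CotBundle I M × ℝ => y.1.proj) ∘ e.symm =ᶠ[𝓝 Y]
        (extChartAt I y.1.proj).symm ∘ fun Y' => Y'.1.1 := by
      filter_upwards [htn] with Y' hY'
      have := extChartAt_cot_fst y (e.symm Y')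
      rw [← he, heY Y' hY'] at this
      simp only [Function.comp]
      rw [this, PartialEquiv.left_inv]
      rw [extChartAt_source]
      exact mem_chart_source_of_mem_cot_target y hY'
    have h3 : Y.1.1 ∈ (extChartAt I y.1.proj).target := by
      have := extChartAt_cot_fst y (e.symm Y)
      rw [← he, heY Y hY] at this
      rw [this]
      refine PartialEquiv.map_source _ ?_
      rwa [extChartAt_source]
    have h4 : MDifferentiableAt 𝓘(ℝ, F) I (extChartAt I y.1.proj).symm Y.1.1 := by
      have := mdifferentiableWithinAt_extChartAt_symm (I := I) (x := y.1.proj) h3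
      rwa [ModelWithCorners.range_eq_univ, mdifferentiableWithinAt_univ] at this
    have h5 : HasFDerivAt (fun Y' : (F × (F →L[ℝ] ℝ)) × ℝ => Y'.1.1)
        ((ContinuousLinearMap.fst ℝ F (F →L[ℝ] ℝ)).comp (ContinuousLinearMap.fst ℝ _ ℝ)) Y :=
      ((ContinuousLinearMap.fst ℝ F (F →L[ℝ] ℝ)).comp
        (ContinuousLinearMap.fst ℝ (F × (F →L[ℝ] ℝ)) ℝ)).hasFDerivAt
    rw [h2.mfderiv_eq]
    have h6 := mfderiv_comp_apply (I := 𝓘(ℝ, (F × (F →L[ℝ] ℝ)) × ℝ)) (I' := 𝓘(ℝ, F)) (I'' := I)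
      (g := (extChartAt I y.1.proj).symm) (f := fun Y' : (F × (F →L[ℝ] ℝ)) × ℝ => Y'.1.1) Y h4
        h5.differentiableAt.mdifferentiableAt u
    refine h6.trans ?_
    congr 1
    rw [mfderiv_eq_fderiv, h5.fderiv]
    rfl
  -- The fibre coordinate `p` is the covector composed with the inverse tangent trivialization,
  -- which is the derivative of the inverse base chart; hence `p dq` is the canonical one-form.
  have t3 : Y.1.2 u.1.1 = (x.1.snd : TangentSpace I x.1.proj →L[ℝ] ℝ)
      (mfderiv (cotModel I) I (fun y : CotBundle I M × ℝ => y.1.proj) x (T u)) := by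
    have h1 := extChartAt_cot_covector y x u.1.1
    have h2 := extChartAt_cot_fst y x
    rw [← he, heY Y hY] at h1 h2
    rw [h1, t2, TangentBundle.symmL_trivializationAt hxs, ModelWithCorners.range_eq_univ,
      mfderivWithin_univ, h2]
    rfl
  rw [t3, ← t1]
  rfl

variable [I.Boundaryless]

theorem localExpr_canonicalContactForm_eventuallyEq (y : CotBundle I M × ℝ) :
    localExpr (canonicalContactForm : OneForm (cotModel I) (CotBundle I M × ℝ)) y
      =ᶠ[𝓝 (extChartAt (cotModel I) y y)] fun Y =>
        ContinuousLinearMap.snd ℝ (F × (F →L[ℝ] ℝ)) ℝ - Y.1.2.comp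
          ((ContinuousLinearMap.fst ℝ F (F →L[ℝ] ℝ)).comp
            (ContinuousLinearMap.fst ℝ (F × (F →L[ℝ] ℝ)) ℝ)) := by
  filter_upwards [extChartAt_target_mem_nhds (I := cotModel I) y] with Y hY
  exact ContinuousLinearMap.ext fun u => localExpr_canonicalContactForm y hY u

variable (F) in
set_option synthInstance.maxHeartbeats 200000 in
/-- The derivative of the coordinate expression `dz - p dq` of the canonical contact form. -/
def canonicalDeriv : ((F × (F →L[ℝ] ℝ)) × ℝ) →L[ℝ] ((F × (F →L[ℝ] ℝ)) × ℝ) →L[ℝ] ℝ :=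
  -((ContinuousLinearMap.compL ℝ ((F × (F →L[ℝ] ℝ)) × ℝ) F ℝ).flip
    ((ContinuousLinearMap.fst ℝ F (F →L[ℝ] ℝ)).comp
      (ContinuousLinearMap.fst ℝ (F × (F →L[ℝ] ℝ)) ℝ))).comp
    ((ContinuousLinearMap.snd ℝ F (F →L[ℝ] ℝ)).comp
      (ContinuousLinearMap.fst ℝ (F × (F →L[ℝ] ℝ)) ℝ))

-- The expression `dz - p dq` is affine in `(q, p, z)`, so its derivative is the constant bilinear
-- map `(u, v) ↦ -u_p(v_q)`.
set_option synthInstance.maxHeartbeats 200000 in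
theorem hasFDerivAt_localExpr_canonicalContactForm (y : CotBundle I M × ℝ) :
    HasFDerivAt (localExpr (canonicalContactForm : OneForm (cotModel I) (CotBundle I M × ℝ)) y)
      (canonicalDeriv F) (extChartAt (cotModel I) y y) := by
  refine HasFDerivAt.congr_of_eventuallyEq ?_ (localExpr_canonicalContactForm_eventuallyEq y)
  have h : HasFDerivAt (𝕜 := ℝ) (E := (F × (F →L[ℝ] ℝ)) × ℝ)
      (F := (F × (F →L[ℝ] ℝ)) × ℝ →L[ℝ] ℝ) (canonicalDeriv F) (canonicalDeriv F)
      (extChartAt (cotModel I) y y) := ContinuousLinearMap.hasFDerivAt (𝕜 := ℝ)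
        (E := (F × (F →L[ℝ] ℝ)) × ℝ) (F := (F × (F →L[ℝ] ℝ)) × ℝ →L[ℝ] ℝ) (canonicalDeriv F)
  refine (h.const_add
    (ContinuousLinearMap.snd ℝ (F × (F →L[ℝ] ℝ)) ℝ)).congr_of_eventuallyEq ?_
  refine Eventually.of_forall fun Y => ?_
  exact sub_eq_add_neg (ContinuousLinearMap.snd ℝ (F × (F →L[ℝ] ℝ)) ℝ) _

theorem iExtDeriv_canonicalContactForm (y : CotBundle I M × ℝ) (u v : (F × (F →L[ℝ] ℝ)) × ℝ) :
    iExtDeriv (canonicalContactForm : OneForm (cotModel I) (CotBundle I M × ℝ)) y u v =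
      v.1.2 u.1.1 - u.1.2 v.1.1 := by
  refine (iExtDeriv_apply _ y u v).trans ?_
  rw [(hasFDerivAt_localExpr_canonicalContactForm y).fderiv]
  change -(u.1.2 v.1.1) - -(v.1.2 u.1.1) = _
  ring

theorem canonicalContactForm_apply (y : CotBundle I M × ℝ) (u : (F × (F →L[ℝ] ℝ)) × ℝ) :
    canonicalContactForm (I := I) y u = u.2 - (extChartAt (cotModel I) y y).1.2 u.1.1 := by
  rw [← localExpr_canonicalContactForm y (mem_extChartAt_target y) u]
  have h := mfderivWithin_range_extChartAt_symm (I := cotModel I) (x := y)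
  rw [ModelWithCorners.range_eq_univ, mfderivWithin_univ] at h
  change _ = canonicalContactForm _ (mfderiv _ _ (extChartAt (cotModel I) y).symm _ u)
  rw [h, extChartAt_to_inv]
  rfl

theorem canonicalContactForm_ddz (y : CotBundle I M × ℝ) :
    canonicalContactForm (I := I) y (ddz y) = 1 := by
  refine (canonicalContactForm_apply y ((0, 0), 1)).trans ?_
  simp

theorem iExtDeriv_canonicalContactForm_ddz (y : CotBundle I M × ℝ) :
    iExtDeriv (canonicalContactForm : OneForm (cotModel I) (CotBundle I M × ℝ)) y (ddz y) = 0 := by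
  refine ContinuousLinearMap.ext fun v => ?_
  refine (iExtDeriv_canonicalContactForm y ((0, 0), 1) v).trans ?_
  simp

/-- The canonical contact form is a contact form: `dη` is nondegenerate on `ker η`. -/
theorem canonicalContactForm_nondegenerate (y : CotBundle I M × ℝ) (u : (F × (F →L[ℝ] ℝ)) × ℝ)
    (h0 : canonicalContactForm (I := I) y u = 0)
    (h1 : iExtDeriv (canonicalContactForm : OneForm (cotModel I) (CotBundle I M × ℝ)) y u = 0) :
    u = 0 := by
  have hv : ∀ v : (F × (F →L[ℝ] ℝ)) × ℝ, v.1.2 u.1.1 - u.1.2 v.1.1 = 0 := fun v => by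
    rw [← iExtDeriv_canonicalContactForm y u v, h1]
    rfl
  have hp : u.1.2 = 0 := ContinuousLinearMap.ext fun w => by
    have := hv ((w, 0), 0)
    simpa using this
  have hq : u.1.1 = 0 := by
    by_contra hne
    -- Hahn–Banach supplies a covector `g` that detects the `q` component; testing against `(0, g)`
    -- forces this component to vanish.
    obtain ⟨g, -, hg⟩ := exists_dual_vector ℝ u.1.1 (norm_ne_zero_iff.2 hne)
    have h2 := hv ((0, g), 0)
    simp only [map_zero, sub_zero] at h2
    rw [h2] at hg
    exact hne (norm_eq_zero.1 (by exact_mod_cast hg.symm))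
  have hz := canonicalContactForm_apply y u
  rw [h0, hq, map_zero, sub_zero] at hz
  exact Prod.ext (Prod.ext hq hp) hz.symm

end CanonicalForm

/-! ### Uniqueness and transport of the contact equations. -/

section ContactPullback
variable {F : Type*} [NormedAddCommGroup F] [NormedSpace ℝ F] {H : Type*} [TopologicalSpace H]
  {I : ModelWithCorners ℝ F H} {M : Type*} [TopologicalSpace M] [ChartedSpace H M]
  {G : Type*} [NormedAddCommGroup G] [NormedSpace ℝ G] {H' : Type*} [TopologicalSpace H']
  {J : ModelWithCorners ℝ G H'} {N : Type*} [TopologicalSpace N] [ChartedSpace H' N]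
  {P : Type*} [NormedAddCommGroup P] [NormedSpace ℝ P] {H'' : Type*} [TopologicalSpace H'']
  {K : ModelWithCorners ℝ P H''} {W : Type*} [TopologicalSpace W] [ChartedSpace H'' W]
  [IsManifold I ∞ M] [IsManifold J ∞ N] [IsManifold K ∞ W]

theorem iExtDeriv_sub (α : OneForm I M) (x : M) (u v : TangentSpace I x) :
    iExtDeriv α x (u - v) = iExtDeriv α x u - iExtDeriv α x v := by
  refine ContinuousLinearMap.ext fun w => ?_
  refine Eq.trans ?_ (sub_apply _ _ _).symm
  rw [iExtDeriv_antisymm α x (u - v), iExtDeriv_antisymm α x u, iExtDeriv_antisymm α x v, map_sub]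
  ring

/-- A one-form is nondegenerate at a point if no nonzero vector is annihilated by the form and by
its exterior derivative. -/
def IsNondegenerateAt (α : OneForm I M) (x : M) : Prop :=
  ∀ u : TangentSpace I x, α x u = 0 → iExtDeriv α x u = 0 → u = 0

/-- Nondegeneracy is injectivity of the linear map `u ↦ (α(u), i(u)dα)`. Both the Reeb conditions
and the contact equations prescribe this pair, which yields their uniqueness. -/
theorem IsNondegenerateAt.eq_of_eq {α : OneForm I M} {x : M} (h : IsNondegenerateAt α x)
    {u v : TangentSpace I x} (h0 : α x u = α x v) (h1 : iExtDeriv α x u = iExtDeriv α x v) :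
    u = v := by
  refine sub_eq_zero.1 (h (u - v) ?_ ?_)
  · rw [map_sub, h0, sub_self]
  · rw [iExtDeriv_sub, h1, sub_self]

theorem IsReeb.unique {α : OneForm I M} (h : ∀ x, IsNondegenerateAt α x) {R R' : VField I M}
    (hR : IsReeb α R) (hR' : IsReeb α R') : R = R' :=
  funext fun x => (h x).eq_of_eq ((hR x).2.trans (hR' x).2.symm) ((hR x).1.trans (hR' x).1.symm)

theorem ContactEqAt.unique {α : OneForm I M} {x : M} (h : IsNondegenerateAt α x)
    {R X Y : VField I M} {E : M → ℝ} (hX : ContactEqAt α R E X x) (hY : ContactEqAt α R E Y x) :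
    X x = Y x :=
  h.eq_of_eq (hX.2.trans hY.2.symm) (hX.1.trans hY.1.symm)

/-- The multiplier in the contact equations is determined by the Reeb vector field. -/
theorem contactEqAt_of_multiplier {α : OneForm I M} {R X : VField I M} (hR : IsReeb α R)
    {E : M → ℝ} {x : M} {c : ℝ} (h1 : iExtDeriv α x (X x) = mvfderiv I E x - c • α x)
    (h2 : α x (X x) = -E x) : ContactEqAt α R E X x := by
  -- Evaluate on `R`: the left side is `dα(X, R) = -dα(R, X) = 0`, and `α(R) = 1`, so `c = R(E)`.
  have h3 : mvfderiv I E x (R x) - c * α x (R x) = 0 := by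
    have h4 : iExtDeriv α x (X x) (R x) = 0 := by
      rw [iExtDeriv_antisymm, (hR x).1]
      exact neg_zero
    rw [h1] at h4
    exact h4
  rw [(hR x).2, mul_one, sub_eq_zero] at h3
  exact ⟨h3 ▸ h1, h2⟩

variable [I.Boundaryless] [J.Boundaryless] [K.Boundaryless] {η : OneForm J N}
  (hη : ∀ y, DifferentiableAt ℝ (localExpr η y) (extChartAt J y y))

theorem mfderiv_comp_clm {p : W → N} {g : M → W} {x : M} (hg : MDifferentiableAt I K g x)
    (hp : MDifferentiableAt K J p (g x)) (u : TangentSpace I x) :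
    mfderiv I J (p ∘ g) x u = mfderiv K J p (g x) (mfderiv I K g x u) :=
  mfderiv_comp_apply x hp hg u

include hη in
theorem iExtDeriv_pullbackForm_comp {p : W → N} {g : M → W} {x : M}
    (hg : ContMDiffAt I K ∞ g x) (hp : ContMDiffAt K J ∞ p (g x)) (u v : TangentSpace I x) :
    iExtDeriv (pullbackForm (p ∘ g) η : OneForm I M) x u v =
      iExtDeriv (pullbackForm p η : OneForm K W) (g x) (mfderiv I K g x u)
        (mfderiv I K g x v) := by
  have hg' := hg.mdifferentiableAt (by simp)
  have hp' := hp.mdifferentiableAt (by simp)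
  rw [iExtDeriv_pullbackForm (hp.comp x hg) (hη _), iExtDeriv_pullbackForm hp (hη _)]
  change iExtDeriv η (p (g x)) (mfderiv I J (p ∘ g) x u) (mfderiv I J (p ∘ g) x v) =
    iExtDeriv η (p (g x)) (mfderiv K J p (g x) (mfderiv I K g x u))
      (mfderiv K J p (g x) (mfderiv I K g x v))
  exact congrArg₂ (fun a b => iExtDeriv η (p (g x)) a b) (mfderiv_comp_clm hg' hp' u)
    (mfderiv_comp_clm hg' hp' v)

include hη in
/-- Contact equations at the points of the image of a map, for a vector field tangent to the image,
restrict to the source of the map. -/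
theorem ContactEqAt.restrict {p : W → N} {g : M → W} {x : M}
    (hg : ContMDiffAt I K ∞ g x) (hp : ContMDiffAt K J ∞ p (g x)) {S X : VField K W} {h : W → ℝ}
    (hh : MDifferentiableAt K 𝓘(ℝ, ℝ) h (g x))
    (hX : ContactEqAt (pullbackForm p η) S h X (g x)) {R Y : VField I M}
    (hR : IsReeb (pullbackForm (p ∘ g) η) R) (hY : X (g x) = mfderiv I K g x (Y x)) :
    ContactEqAt (pullbackForm (p ∘ g) η) R (h ∘ g) Y x := by
  have hg' := hg.mdifferentiableAt (by simp)
  have hp' := hp.mdifferentiableAt (by simp)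
  have hα : ∀ u : TangentSpace I x, (pullbackForm (p ∘ g) η : OneForm I M) x u =
      (pullbackForm p η : OneForm K W) (g x) (mfderiv I K g x u) := fun u =>
    congrArg (η (p (g x))) (mfderiv_comp_clm hg' hp' u)
  obtain ⟨h1, h2⟩ := hX
  rw [hY] at h1 h2
  -- `S` need not be tangent to the image of `g`, so its multiplier is merely carried along as a
  -- number and identified with `R(h ∘ g)` afterwards.
  refine contactEqAt_of_multiplier hR (c := mvfderiv K h (g x) (S (g x))) ?_ ((hα _).trans h2)
  refine ContinuousLinearMap.ext fun v => ?_
  refine (iExtDeriv_pullbackForm_comp hη hg hp _ v).trans ?_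
  rw [h1]
  change mvfderiv K h (g x) (mfderiv I K g x v) - mvfderiv K h (g x) (S (g x)) *
    (pullbackForm p η : OneForm K W) (g x) (mfderiv I K g x v) = mvfderiv I (h ∘ g) x v -
      mvfderiv K h (g x) (S (g x)) * (pullbackForm (p ∘ g) η : OneForm I M) x v
  rw [hα v, mvfderiv_comp_apply (I := K) (I' := I) x hh hg' v]

variable {f : M → N} (hf : IsLocalDiffeomorph I J ∞ f)

include hf in
theorem mfderiv_bijective (x : M) : Function.Bijective (mfderiv I J f x) := by
  have h := (hf.mfderivToContinuousLinearEquiv (by simp) x).bijective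
  exact h

include hf hη in
theorem isNondegenerateAt_pullbackForm {x : M} (h : IsNondegenerateAt η (f x)) :
    IsNondegenerateAt (pullbackForm f η : OneForm I M) x := by
  intro u h0 h1
  obtain ⟨hinj, hsurj⟩ := mfderiv_bijective hf x
  refine hinj ((h _ h0 (ContinuousLinearMap.ext fun w => ?_)).trans (map_zero _).symm)
  obtain ⟨v, rfl⟩ := hsurj w
  rw [iExtDeriv_pullbackForm (hf x).contMDiffAt (hη _)] at h1
  exact DFunLike.congr_fun h1 v

include hf hη in
theorem isReeb_pullbackForm {R : VField J N} (hR : IsReeb η R) {S : VField I M}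
    (hS : ∀ x, mfderiv I J f x (S x) = R (f x)) :
    IsReeb (pullbackForm f η : OneForm I M) S := by
  intro x
  constructor
  · rw [iExtDeriv_pullbackForm (hf x).contMDiffAt (hη _), hS, (hR (f x)).1]
    rfl
  · exact (congrArg (η (f x)) (hS x)).trans (hR (f x)).2

include hf hη in
/-- Contact equations are transported by local diffeomorphisms. -/
theorem ContactEqAt.pushforward {x : M} {R Y : VField J N} {S X : VField I M} {h : N → ℝ}
    {E : M → ℝ} (hh : MDifferentiableAt J 𝓘(ℝ, ℝ) h (f x)) (hE : E =ᶠ[𝓝 x] h ∘ f)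
    (hS : mfderiv I J f x (S x) = R (f x)) (hY : mfderiv I J f x (X x) = Y (f x))
    (hX : ContactEqAt (pullbackForm f η) S E X x) : ContactEqAt η R h Y (f x) := by
  obtain ⟨h1, h2⟩ := hX
  have hd : ∀ v, mvfderiv I E x v = mvfderiv J h (f x) (mfderiv I J f x v) := fun v => by
    refine Eq.trans ?_ (mvfderiv_comp_apply (I := J) (I' := I) x hh
      ((hf x).contMDiffAt.mdifferentiableAt (by simp)) v)
    exact DFunLike.congr_fun (hE.mfderiv_eq (I := I) (I' := 𝓘(ℝ, ℝ))) v
  constructor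
  · refine ContinuousLinearMap.ext fun w => ?_
    obtain ⟨v, rfl⟩ := (mfderiv_bijective hf x).2 w
    rw [iExtDeriv_pullbackForm (hf x).contMDiffAt (hη _), hY] at h1
    refine (DFunLike.congr_fun h1 v).trans ?_
    change mvfderiv I E x v - mvfderiv I E x (S x) * η (f x) (mfderiv I J f x v) =
      mvfderiv J h (f x) (mfderiv I J f x v) - mvfderiv J h (f x) (R (f x)) *
        η (f x) (mfderiv I J f x v)
    rw [hd, hd, hS]
  · rw [← hY]
    exact h2.trans (congrArg Neg.neg hE.self_of_nhds)

end ContactPullback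

/-! ### Local inverses and lifts of vector fields along local diffeomorphisms. -/

section LocalDiffeomorphisms
variable {F : Type*} [NormedAddCommGroup F] [NormedSpace ℝ F] {H : Type*} [TopologicalSpace H]
  {I : ModelWithCorners ℝ F H} {M : Type*} [TopologicalSpace M] [ChartedSpace H M]
  {G : Type*} [NormedAddCommGroup G] [NormedSpace ℝ G] {H' : Type*} [TopologicalSpace H']
  {J : ModelWithCorners ℝ G H'} {N : Type*} [TopologicalSpace N] [ChartedSpace H' N]
  [IsManifold I ∞ M] [IsManifold J ∞ N] {f : M → N} (hf : IsLocalDiffeomorph I J ∞ f)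

include hf in
theorem exists_isOpen_injOn (x : M) : ∃ U : Set M, IsOpen U ∧ x ∈ U ∧ InjOn f U := by
  obtain ⟨Φ, hx, he⟩ := hf x
  exact ⟨Φ.source, Φ.open_source, hx, (Φ.toOpenPartialHomeomorph.injOn).congr he.symm⟩

include hf in
/-- The inverse of an injective restriction of a local diffeomorphism is smooth. -/
theorem contMDiffOn_leftInverse {U : Set M} (hU : IsOpen U) {σ : N → M}
    (hσ : ∀ x ∈ U, σ (f x) = x) : ContMDiffOn J I ∞ σ (f '' U) := by
  rintro _ ⟨x, hx, rfl⟩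
  obtain ⟨Φ, hxΦ, he⟩ := hf x
  have hfx : f x = Φ x := he hxΦ
  have hx' : f x ∈ Φ.target := hfx ▸ Φ.map_source hxΦ
  have hs : ContMDiffAt J I ∞ Φ.symm (f x) := Φ.symm.contMDiffOn.contMDiffAt
    (Φ.open_target.mem_nhds hx')
  have hsx : Φ.symm (f x) = x := by rw [hfx]; exact Φ.left_inv hxΦ
  refine (hs.congr_of_eventuallyEq ?_).contMDiffWithinAt
  -- Near `f x` the smooth local inverse lands in `U`, where the left-inverse property forces `σ` to
  -- agree with it.
  have hUn : ∀ᶠ y in 𝓝 (f x), Φ.symm y ∈ U :=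
    hs.continuousAt.eventually (hU.mem_nhds (hsx.symm ▸ hx))
  filter_upwards [hUn, Φ.open_target.mem_nhds hx'] with y hy hyt
  have h2 : f (Φ.symm y) = y := (he (Φ.map_target hyt)).trans (Φ.right_inv hyt)
  have h1 := hσ _ hy
  rwa [h2] at h1

include hf in
/-- The pull-back of a smooth vector field by a local diffeomorphism. -/
theorem exists_smooth_lift [CompleteSpace F] [CompleteSpace G] {R : VField J N}
    (hR : SmoothVFieldOn R univ) :
    ∃ S : VField I M, SmoothVFieldOn S univ ∧ ∀ x, mfderiv I J f x (S x) = R (f x) := by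
  have hinv : ∀ x, (mfderiv I J f x).IsInvertible := fun x =>
    ⟨hf.mfderivToContinuousLinearEquiv (by simp) x, rfl⟩
  refine ⟨VectorField.mpullback I J f R, ?_, fun x => ?_⟩
  · exact (ContMDiff.mpullback_vectorField (contMDiffOn_univ.1 hR) hf.contMDiff hinv
      (by simp)).contMDiffOn
  · rw [VectorField.mpullback_apply]
    exact (hinv x).self_apply_inverse _

/-- Supplies the smoothness of both `X_L` and `X_H`: each is `X` restricted along a map into `W` and
then projected by `pr₁` or `pr₂`. -/
theorem smoothVFieldOn_mfderiv {G' : Type*} [NormedAddCommGroup G'] [NormedSpace ℝ G']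
    {K' : Type*} [TopologicalSpace K'] {K : ModelWithCorners ℝ G' K'} {S : Type*}
    [TopologicalSpace S] [ChartedSpace K' S] {p : M → N} (hp : ContMDiff I J ∞ p)
    {X : VField I M} (hX : SmoothVFieldOn X univ) {s : Set S} {g : S → M}
    (hg : ContMDiffOn K I ∞ g s) :
    ContMDiffOn K J.tangent ∞
      (fun y => (⟨p (g y), mfderiv I J p (g y) (X (g y))⟩ : TangentBundle J N)) s := by
  have h1 : ContMDiff I.tangent J.tangent ∞ (tangentMap I J p) :=
    hp.contMDiff_tangentMap (by simp)
  exact h1.comp_contMDiffOn ((contMDiffOn_univ.1 hX).comp_contMDiffOn hg)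

end LocalDiffeomorphisms

/-! ### Smooth structure of the unified bundle and restriction to the graph of `Leg`. -/

section UnifiedBundle
variable {E : Type*} [NormedAddCommGroup E] [NormedSpace ℝ E]
  {Q : Type*} [TopologicalSpace Q] [ChartedSpace E Q] [IsManifold 𝓘(ℝ, E) ∞ Q]

theorem tangentBundle_mk_congr {F : Type*} [NormedAddCommGroup F] [NormedSpace ℝ F] {H : Type*}
    [TopologicalSpace H] {I : ModelWithCorners ℝ F H} {M : Type*} [TopologicalSpace M]
    [ChartedSpace H M] {a b : M} (h : a = b) {v w : F} (hv : v = w) :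
    (⟨a, (v : TangentSpace I a)⟩ : TangentBundle I M) = ⟨b, (w : TangentSpace I b)⟩ := by
  subst h
  subst hv
  rfl

/-- The canonical injection `T^{r+1} Q → T(T^r Q)` is smooth. -/
theorem contMDiff_jetInj (r : ℕ) : ContMDiff (IJ E (r + 1)) (IJ E r).tangent ∞
    (fun p : Jet E Q (r + 1) =>
      (⟨p.proj (Nat.le_succ r), jetInj p⟩ : TangentBundle (IJ E r) (Jet E Q r))) := by
  intro p₀
  have hφ := chart_mem_atlas E p₀.base
  have hp₀ := mem_chart_source E p₀.base
  set φ := chartAt E p₀.base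
  have hmem : ∀ y ∈ xTarget φ (r + 1), truncX E (Nat.le_succ r) y ∈ xTarget φ r := fun y hy =>
    (truncX_mem_xTarget (Nat.le_succ r)).2 hy
  set G : XModel E (r + 1) → Jet E Q r := fun y => (param hφ r (truncX E (Nat.le_succ r) y)).1
  have hG : ∀ y ∈ xTarget φ (r + 1), ContMDiffAt 𝓘(ℝ, XModel E (r + 1)) (IJ E r) ∞ G y :=
    fun y hy => contMDiffAt_fst.comp y ((contMDiffAt_param hφ (hmem y hy)).comp y
      (truncX E (Nat.le_succ r)).contMDiff.contMDiffAt)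
  -- In a chart the injection is `TG ∘ V`: `G` forgets the top coordinate, and `V` is the shift
  -- padded by an arbitrary top component, taken to be zero, which `TG` discards.
  set V : XModel E (r + 1) → XModel E (r + 1) := fun y =>
    (extJet E r (r + 1) (shiftJet E r y.1), 0)
  have hV : ContMDiff 𝓘(ℝ, XModel E (r + 1)) 𝓘(ℝ, XModel E (r + 1)).tangent ∞
      (fun y => (⟨y, V y⟩ : TangentBundle 𝓘(ℝ, XModel E (r + 1)) (XModel E (r + 1)))) := by
    refine (contMDiff_vectorSpace_iff_contDiff (𝕜 := ℝ) (V := V)).2 ?_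
    exact ((extJet E r (r + 1)).contDiff.comp ((shiftJet E r).contDiff.comp
      contDiff_fst)).prodMk contDiff_const
  have hS := isOpen_xTarget φ (r + 1)
  have hT : ContMDiffOn 𝓘(ℝ, XModel E (r + 1)).tangent (IJ E r).tangent ∞
      (tangentMapWithin 𝓘(ℝ, XModel E (r + 1)) (IJ E r) G (xTarget φ (r + 1)))
      (TotalSpace.proj ⁻¹' xTarget φ (r + 1)) :=
    ContMDiffOn.contMDiffOn_tangentMapWithin (n := ∞)
      (fun y hy => (hG y hy).contMDiffWithinAt) (by simp) hS.uniqueMDiffOn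
  set c : Jet E Q (r + 1) → XModel E (r + 1) := fun p => coordX φ (p, (0 : ℝ))
  have hc : ContMDiffAt (IJ E (r + 1)) 𝓘(ℝ, XModel E (r + 1)) ∞ c p₀ :=
    ContMDiffAt.comp (I' := IX E (r + 1)) p₀ (contMDiffAt_coordX hφ (x := (p₀, (0 : ℝ))) hp₀)
      (contMDiffAt_id.prodMk contMDiffAt_const)
  have hc₀ : c p₀ ∈ xTarget φ (r + 1) := coordX_mem_xTarget hφ (x := (p₀, (0 : ℝ))) hp₀
  have hcomp : ContMDiffAt (IJ E (r + 1)) (IJ E r).tangent ∞ (fun p =>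
      tangentMapWithin 𝓘(ℝ, XModel E (r + 1)) (IJ E r) G (xTarget φ (r + 1))
        (⟨c p, V (c p)⟩ : TangentBundle 𝓘(ℝ, XModel E (r + 1)) (XModel E (r + 1)))) p₀ := by
    have h1 := hT.contMDiffAt (x := ⟨c p₀, V (c p₀)⟩)
      ((hS.preimage (FiberBundle.continuous_proj _ _)).mem_nhds hc₀)
    exact h1.comp p₀ (hV.contMDiffAt.comp p₀ hc)
  refine hcomp.congr_of_eventuallyEq ?_
  filter_upwards [hc.continuousAt.eventually (hS.mem_nhds hc₀),
    (continuous_id.prodMk continuous_const).continuousAt.eventually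
      (eventually_base_mem hφ (x := (p₀, (0 : ℝ))) hp₀)] with p hp hps
  have hpar : param hφ (r + 1) (c p) = (p, (0 : ℝ)) := param_coordX hφ hps
  have hpt := proj_param hφ (Nat.le_succ r) hp
  rw [hpar] at hpt
  refine tangentBundle_mk_congr (congrArg Prod.fst hpt) ?_
  have h1 : mfderivWithin 𝓘(ℝ, XModel E (r + 1)) (IJ E r) G (xTarget φ (r + 1)) (c p) =
      mfderiv 𝓘(ℝ, XModel E (r + 1)) (IJ E r) G (c p) :=
    mfderivWithin_of_isOpen hS hp
  have hpm := (contMDiffAt_param hφ (hmem _ hp)).mdifferentiableAt (by simp)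
  have h2 : mfderiv 𝓘(ℝ, XModel E (r + 1)) (IJ E r) G (c p) (V (c p)) =
      (mfderiv 𝓘(ℝ, XModel E r) (IX E r) (param hφ r) (truncX E (Nat.le_succ r) (c p))
        (truncX E (Nat.le_succ r) (V (c p))) : XModel E r).1 := by
    have h5 : MDifferentiableAt 𝓘(ℝ, XModel E (r + 1)) 𝓘(ℝ, XModel E r)
        (truncX E (Nat.le_succ r)) (c p) :=
      (truncX E (Nat.le_succ r)).differentiableAt.mdifferentiableAt
    refine (mfderiv_comp_apply (I' := IX E r) (I'' := IJ E r)
      (f := param hφ r ∘ truncX E (Nat.le_succ r)) (g := Prod.fst) (c p)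
      mdifferentiableAt_fst (hpm.comp (c p) h5) (V (c p))).trans ?_
    have h6 := mfderiv_comp_apply (I' := 𝓘(ℝ, XModel E r)) (I'' := IX E r)
      (f := truncX E (Nat.le_succ r)) (g := param hφ r) (c p) hpm h5 (V (c p))
    have h7 : mfderiv 𝓘(ℝ, XModel E (r + 1)) 𝓘(ℝ, XModel E r) (truncX E (Nat.le_succ r)) (c p) =
        truncX E (Nat.le_succ r) :=
      (truncX E (Nat.le_succ r)).hasFDerivAt.hasMFDerivAt.mfderiv
    rw [mfderiv_fst]
    refine congrArg Prod.fst (h6.trans ?_)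
    exact congrArg _ (DFunLike.congr_fun h7 (V (c p)))
  have h3 : truncX E (Nat.le_succ r) (V (c p)) = (shiftJet E r (c p).1, 0) :=
    Prod.ext (truncJet_extJet (Nat.le_succ r) _) rfl
  have h4 := mfderiv_param_shift hφ hp 0
  rw [hpar] at h4
  refine Eq.symm ((DFunLike.congr_fun h1 (V (c p))).trans (h2.trans ?_))
  rw [h3]
  exact congrArg Prod.fst h4

variable {m : ℕ}

theorem contMDiff_pr₁ : ContMDiff (IW E m) (IX E (2 * m + 1)) ∞
    (pr₁ : Unified E Q m → XJet E Q (2 * m + 1)) :=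
  ((contMDiff_proj _).comp contMDiff_fst).prodMk contMDiff_snd

/-- The pull-back bundle has the fibre coordinates of the cotangent bundle, so smoothness of the
fibre part of `pr₂` is that of the identity of `W`. -/
theorem contMDiff_pr₂ : ContMDiff (IW E m) (IP E m) ∞
    (pr₂ : Unified E Q m → PhaseSpace E Q m) := by
  refine ContMDiff.prodMk (ContMDiff.comp (I' := (IJ E (2 * m + 1)).prod
    𝓘(ℝ, JetModel E m →L[ℝ] ℝ)) (g := Pullback.lift (rho E Q m)) (fun w => ?_) contMDiff_fst)
      contMDiff_snd
  rw [contMDiffAt_totalSpace]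
  refine ⟨(rho E Q m).contMDiff.contMDiffAt.comp w (contMDiff_proj _ w), ?_⟩
  exact (contMDiffAt_totalSpace.1 (contMDiffAt_id
    (I := (IJ E (2 * m + 1)).prod 𝓘(ℝ, JetModel E m →L[ℝ] ℝ)) (x := w))).2

theorem contMDiff_legendreGraph {L : XJet E Q (m + 1) → ℝ}
    (h : ContMDiff (IX E (2 * m + 1)) (IP E m) ∞ (legendre L)) :
    ContMDiff (IX E (2 * m + 1)) (IW E m) ∞ (legendreGraph L) := by
  refine ContMDiff.prodMk (fun x => ?_) contMDiff_snd
  rw [contMDiffAt_totalSpace]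
  exact ⟨contMDiffAt_fst, (contMDiffAt_totalSpace.1 (h x).fst).2⟩

/-- The coupling function is smooth. -/
theorem contMDiff_coupling : ContMDiff (IW E m) 𝓘(ℝ, ℝ) ∞ (coupling : Unified E Q m → ℝ) := by
  intro w
  have h1 : ContMDiffAt (IW E m) ((IJ E m).prod 𝓘(ℝ, JetModel E m →L[ℝ] ℝ)) ∞
      (fun w : Unified E Q m => (pr₂ w).1) w := (contMDiff_pr₂ w).fst
  have h2 : ContMDiffAt (IW E m) (IJ E m).tangent ∞ (fun w : Unified E Q m =>
      (⟨(w.1.proj.proj (order_le m)).proj (Nat.le_succ m), jetInj (w.1.proj.proj (order_le m))⟩ :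
        TangentBundle (IJ E m) (Jet E Q m))) w :=
    (contMDiff_jetInj m _).comp w ((contMDiff_jetProj (order_le m) _).comp w
      ((contMDiff_proj _ _).comp w contMDiffAt_fst))
  -- To be paired with the covector, the vector is moved to the direct projection, equal to the
  -- iterated one by `Jet.proj_proj`.
  have h3 : ContMDiffAt (IW E m) (IJ E m).tangent ∞ (fun w : Unified E Q m =>
      (⟨w.1.proj.proj (base_le m), (jetInj (w.1.proj.proj (order_le m)) : JetModel E m)⟩ :
        TangentBundle (IJ E m) (Jet E Q m))) w :=
    h2.congr_of_eventuallyEq (Eventually.of_forall fun w => tangentBundle_mk_congr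
      (Jet.proj_proj (order_le m) (Nat.le_succ m) w.1.proj).symm rfl)
  have h4 := ContMDiffAt.clm_bundle_apply (𝕜 := ℝ) (IB := IJ E m) (IM := IW E m)
    (F₁ := JetModel E m) (F₂ := ℝ)
    (E₁ := fun q : Jet E Q m => TangentSpace (IJ E m) q) (E₂ := Trivial (Jet E Q m) ℝ)
    (b := fun w : Unified E Q m => w.1.proj.proj (base_le m)) (ϕ := fun w => w.1.snd)
    (v := fun w => (jetInj (w.1.proj.proj (order_le m)) : JetModel E m)) h1 h3
  exact (contMDiffAt_totalSpace.1 h4).2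

theorem contMDiff_unifiedHamiltonian {L : XJet E Q (m + 1) → ℝ}
    (hL : ContMDiff (IX E (m + 1)) 𝓘(ℝ, ℝ) ∞ L) :
    ContMDiff (IW E m) 𝓘(ℝ, ℝ) ∞ (unifiedHamiltonian L) :=
  contMDiff_coupling.sub (hL.comp ((contMDiff_xProj (order_le m)).comp contMDiff_pr₁))

/-- The Hamiltonian function restricts to the Lagrangian energy on the graph of the Legendre map. -/
theorem unifiedHamiltonian_legendreGraph {L : XJet E Q (m + 1) → ℝ}
    (hL : ContMDiff (IX E (m + 1)) 𝓘(ℝ, ℝ) ∞ L) (x : XJet E Q (2 * m + 1)) :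
    unifiedHamiltonian L (legendreGraph L x) = energy L x := by
  -- The vector `Γ` at a point of `T^{2k-1}Q × ℝ` needs one more derivative, so the point is lifted
  -- to `T^{2k}Q × ℝ`. The lift does not affect the projection of `Γ` to `T^{k-1}Q`, which is `j_k`.
  obtain ⟨x, rfl⟩ := xProj_surjective (Nat.le_succ (2 * m + 1)) x
  have h := cartanForm_totalVec hL (by omega) x
  have h1 := cartanForm_eq_legendreCovector hL (x.proj (Nat.le_succ (2 * m + 1)))
    (totalVec L (by omega) x)
  rw [h] at h1
  refine Eq.trans ?_ (eq_sub_of_add_eq h1).symm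
  refine congrArg (fun t => t - L _) ?_
  refine congrArg (legendreCovector L (x.proj (Nat.le_succ (2 * m + 1)))) ?_
  funext a
  have e : (x.1.proj (Nat.le_succ (2 * m + 1))).proj (order_le m) = x.1.proj (by omega) :=
    Jet.proj_proj _ _ _
  change (chartAt (JetModel E (m + 1)) ((x.1.proj (Nat.le_succ (2 * m + 1))).proj (order_le m))
    ((x.1.proj (Nat.le_succ (2 * m + 1))).proj (order_le m)) : JetModel E (m + 1)) a.succ = _
  rw [e, chartAt_jetProj]
  rfl

/-- The contact Lagrangian form is the pull-back of the canonical contact form by the Legendre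
map. -/
theorem lagrangianContactForm_eq_pullbackForm {L : XJet E Q (m + 1) → ℝ}
    (hL : ContMDiff (IX E (m + 1)) 𝓘(ℝ, ℝ) ∞ L)
    (h : ContMDiff (IX E (2 * m + 1)) (IP E m) ∞ (legendre L)) :
    lagrangianContactForm L = pullbackForm (legendre L) canonicalContactForm := by
  funext x
  refine ContinuousLinearMap.ext fun (u : XModel E (2 * m + 1)) => ?_
  have hd := (h x).mdifferentiableAt (by simp)
  have h1 : mvfderiv (IX E (2 * m + 1)) (fun y : XJet E Q (2 * m + 1) => y.2) x u =
      mvfderiv (IP E m) (fun y : PhaseSpace E Q m => y.2) (legendre L x)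
        (mfderiv (IX E (2 * m + 1)) (IP E m) (legendre L) x u) :=
    mvfderiv_comp_apply (I := IP E m) (I' := IX E (2 * m + 1)) (g := fun y : PhaseSpace E Q m => y.2)
      x mdifferentiableAt_snd hd u
  have hp : MDifferentiableAt (IP E m) (IJ E m) (fun y : PhaseSpace E Q m => y.1.proj)
      (legendre L x) :=
    ((contMDiff_proj _ _).comp _ contMDiffAt_fst).mdifferentiableAt (n := ∞) (by simp)
  -- `Leg` covers the projection to `T^{k-1}Q`, so the canonical one-form evaluates the Legendre
  -- covector on the truncated vector.
  have h2 : mfderiv (IX E (2 * m + 1)) (IJ E m)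
      (fun y : XJet E Q (2 * m + 1) => y.1.proj (base_le m)) x u =
      mfderiv (IP E m) (IJ E m) (fun y : PhaseSpace E Q m => y.1.proj) (legendre L x)
        (mfderiv (IX E (2 * m + 1)) (IP E m) (legendre L) x u) :=
    mfderiv_comp_apply (g := fun y : PhaseSpace E Q m => y.1.proj) x hp hd u
  have h3 : mfderiv (IX E (2 * m + 1)) (IJ E m)
      (fun y : XJet E Q (2 * m + 1) => y.1.proj (base_le m)) x u =
      truncJet E (base_le m) u.1 := by
    refine (mfderiv_comp_apply (I' := IX E m) (I'' := IJ E m)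
      (f := (XJet.proj (base_le m) : XJet E Q (2 * m + 1) → XJet E Q m)) (g := Prod.fst) x
      mdifferentiableAt_fst ((contMDiff_xProj (base_le m) x).mdifferentiableAt (by simp)) u).trans ?_
    rw [mfderiv_fst]
    exact congrArg Prod.fst (DFunLike.congr_fun (mfderiv_xProj (base_le m) x) u)
  change mvfderiv (IX E (2 * m + 1)) (fun y : XJet E Q (2 * m + 1) => y.2) x u -
    cartanForm L x u = mvfderiv (IP E m) (fun y : PhaseSpace E Q m => y.2) (legendre L x)
        (mfderiv (IX E (2 * m + 1)) (IP E m) (legendre L) x u) -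
      legendreCovector L x (mfderiv (IP E m) (IJ E m) (fun y : PhaseSpace E Q m => y.1.proj)
        (legendre L x) (mfderiv (IX E (2 * m + 1)) (IP E m) (legendre L) x u))
  rw [h1, cartanForm_eq_legendreCovector hL]
  refine congrArg (fun t => _ - legendreCovector L x t) ?_
  exact h3.symm.trans h2

end UnifiedBundle

/-! ### The Reeb field of the canonical contact form. -/

section ReebField
variable {F : Type*} [NormedAddCommGroup F] [NormedSpace ℝ F] {H : Type*} [TopologicalSpace H]
  {I : ModelWithCorners ℝ F H} {M : Type*} [TopologicalSpace M] [ChartedSpace H M]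
  [IsManifold I ∞ M]

theorem smoothVFieldOn_ddz :
    SmoothVFieldOn (ddz : VField (I.prod 𝓘(ℝ, ℝ)) (M × ℝ)) univ := by
  have h1 : ContMDiff (I.prod 𝓘(ℝ, ℝ)) I.tangent ∞
      (fun y : M × ℝ => (⟨y.1, 0⟩ : TangentBundle I M)) :=
    (Bundle.contMDiff_zeroSection ℝ (TangentSpace I : M → Type _)).comp contMDiff_fst
  have h2 : ContMDiff (I.prod 𝓘(ℝ, ℝ)) 𝓘(ℝ, ℝ).tangent ∞
      (fun y : M × ℝ => (⟨y.2, (1 : ℝ)⟩ : TangentBundle 𝓘(ℝ, ℝ) ℝ)) := by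
    have h3 : ContMDiff 𝓘(ℝ, ℝ) 𝓘(ℝ, ℝ).tangent ∞
        (fun t : ℝ => (⟨t, (1 : ℝ)⟩ : TangentBundle 𝓘(ℝ, ℝ) ℝ)) :=
      (contMDiff_vectorSpace_iff_contDiff (𝕜 := ℝ) (V := fun _ : ℝ => (1 : ℝ))).2 contDiff_const
    exact h3.comp contMDiff_snd
  exact (contMDiff_equivTangentBundleProd_symm.comp (h1.prodMk h2)).contMDiffOn

theorem isReeb_canonicalContactForm [I.Boundaryless] :
    IsReeb (canonicalContactForm : OneForm (cotModel I) (CotBundle I M × ℝ)) ddz := fun y =>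
  ⟨iExtDeriv_canonicalContactForm_ddz y, canonicalContactForm_ddz y⟩

end ReebField

end HOContact

end

/-! ### The equivalence of the unified, Lagrangian and Hamiltonian dynamics. -/

set_option maxHeartbeats 1000000 in
theorem mainTheorem6 {E : Type*} [NormedAddCommGroup E] [NormedSpace ℝ E] [FiniteDimensional ℝ E]
    {Q : Type*} [TopologicalSpace Q] [T2Space Q] [SecondCountableTopology Q] [ChartedSpace E Q]
    [IsManifold 𝓘(ℝ, E) ∞ Q] (m : ℕ) (L : XJet E Q (m + 1) → ℝ)
    (hL : ContMDiff (IX E (m + 1)) 𝓘(ℝ, ℝ) ∞ L) (hreg : IsRegularLagrangian L)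
    (X : VField (IW E m) (Unified E Q m)) (hX : SmoothVFieldOn X univ)
    (hsol : ∀ w ∈ W₁ L, ContactEqAt unifiedForm ddz (unifiedHamiltonian L) X w)
    (htan : IsTangentToW₁ L X) :
    ∃ R_L X_L : VField (IX E (2 * m + 1)) (XJet E Q (2 * m + 1)),
      -- the contact Lagrangian vector field `X_L`, its uniqueness, and its relation with `X`
      SmoothVFieldOn R_L univ ∧ IsReeb (lagrangianContactForm L) R_L ∧
      SmoothVFieldOn X_L univ ∧
      (∀ x, ContactEqAt (lagrangianContactForm L) R_L (energy L) X_L x) ∧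
      (∀ R, IsReeb (lagrangianContactForm L) R → R = R_L) ∧
      (∀ Y, (∀ x, ContactEqAt (lagrangianContactForm L) R_L (energy L) Y x) → Y = X_L) ∧
      (∀ w ∈ W₁ L, X_L (pr₁ w) = mfderiv (IW E m) (IX E (2 * m + 1)) pr₁ w (X w)) ∧
      -- the open sets on which the Legendre map is a diffeomorphism onto its image
      (∀ x, ∃ U : Set (XJet E Q (2 * m + 1)), IsOpen U ∧ x ∈ U ∧ InjOn (legendre L) U) ∧
      ∀ U : Set (XJet E Q (2 * m + 1)), IsOpen U → InjOn (legendre L) U →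
        IsOpen (legendre L '' U) ∧
        ∃ (H : PhaseSpace E Q m → ℝ) (X_H : VField (IP E m) (PhaseSpace E Q m)),
          ContMDiffOn (IP E m) 𝓘(ℝ, ℝ) ∞ H (legendre L '' U) ∧
          (∀ x ∈ U, H (legendre L x) = energy L x) ∧
          (∀ w ∈ W₁ L, pr₁ w ∈ U → unifiedHamiltonian L w = H (pr₂ w)) ∧
          SmoothVFieldOn X_H (legendre L '' U) ∧
          (∀ w ∈ W₁ L, pr₁ w ∈ U → X_H (pr₂ w) = mfderiv (IW E m) (IP E m) pr₂ w (X w)) ∧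
          (∀ y ∈ legendre L '' U, ContactEqAt canonicalContactForm ddz H X_H y) ∧
          (∀ x ∈ U, mfderiv (IX E (2 * m + 1)) (IP E m) (legendre L) x (X_L x) =
            X_H (legendre L x)) := by
  have hf := hreg.contMDiff
  have hg := contMDiff_legendreGraph hf
  have hη : ∀ y : PhaseSpace E Q m, DifferentiableAt ℝ
      (localExpr (canonicalContactForm : OneForm (IP E m) (PhaseSpace E Q m)) y)
      (extChartAt (IP E m) y y) := fun y =>
    (hasFDerivAt_localExpr_canonicalContactForm y).differentiableAt
  have hform := lagrangianContactForm_eq_pullbackForm hL hf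
  have henergy : unifiedHamiltonian L ∘ legendreGraph L = energy L :=
    funext (unifiedHamiltonian_legendreGraph hL)
  -- Smoothness of `E_L` comes from that of `ℋ` and `Leg`, not from the iterated total derivatives.
  have hEs : ContMDiff (IX E (2 * m + 1)) 𝓘(ℝ, ℝ) ∞ (energy L) :=
    henergy ▸ (contMDiff_unifiedHamiltonian hL).comp hg
  have : CompleteSpace E := FiniteDimensional.complete ℝ E
  obtain ⟨R_L, hRs, hR⟩ := exists_smooth_lift hreg
    (smoothVFieldOn_ddz (I := (IJ E m).prod 𝓘(ℝ, JetModel E m →L[ℝ] ℝ))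
      (M := CotBundle (IJ E m) (Jet E Q m)))
  have hReeb : IsReeb (lagrangianContactForm L) R_L :=
    hform ▸ isReeb_pullbackForm hη hreg isReeb_canonicalContactForm hR
  have hnd : ∀ x, IsNondegenerateAt (lagrangianContactForm L) x := fun x =>
    hform ▸ isNondegenerateAt_pullbackForm hη hreg (fun u h0 h1 =>
      canonicalContactForm_nondegenerate (legendre L x) u h0 h1)
  -- The required relation with `X` along `W₁` leaves no other choice.
  let X_L : VField (IX E (2 * m + 1)) (XJet E Q (2 * m + 1)) := fun x =>
    mfderiv (IW E m) (IX E (2 * m + 1)) pr₁ (legendreGraph L x) (X (legendreGraph L x))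
  have hgd : ∀ x, MDifferentiableAt (IX E (2 * m + 1)) (IW E m) (legendreGraph L) x := fun x =>
    (hg x).mdifferentiableAt (by simp)
  -- Tangency gives some preimage `u` of the value of `X`; since `pr₁ ∘ legendreGraph L` is the
  -- identity, applying `T pr₁` shows `u = X_L x`.
  have hXL : ∀ x, X (legendreGraph L x) =
      mfderiv (IX E (2 * m + 1)) (IW E m) (legendreGraph L) x (X_L x) := fun x => by
    obtain ⟨u, hu⟩ := htan x
    have h1 : X_L x = u := by
      have h2 := mfderiv_comp_clm (hgd x)
        ((contMDiff_pr₁ (legendreGraph L x)).mdifferentiableAt (by simp)) u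
      have h3 : mfderiv (IX E (2 * m + 1)) (IX E (2 * m + 1)) (pr₁ ∘ legendreGraph L) x =
          ContinuousLinearMap.id ℝ (TangentSpace (IX E (2 * m + 1)) x) := mfderiv_id
      refine (congrArg _ hu).trans (h2.symm.trans ?_)
      exact DFunLike.congr_fun h3 u
    rw [h1, hu]
  have hTLeg : ∀ x, mfderiv (IX E (2 * m + 1)) (IP E m) (legendre L) x (X_L x) =
      mfderiv (IW E m) (IP E m) pr₂ (legendreGraph L x) (X (legendreGraph L x)) := fun x =>
    (mfderiv_comp_clm (hgd x) ((contMDiff_pr₂ (legendreGraph L x)).mdifferentiableAt (by simp))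
      (X_L x)).trans (congrArg _ (hXL x).symm)
  have hcontact : ∀ x, ContactEqAt (lagrangianContactForm L) R_L (energy L) X_L x := fun x => by
    have h1 := ContactEqAt.restrict (R := R_L) (Y := X_L) hη (hg x)
      (contMDiff_pr₂ (legendreGraph L x))
      ((contMDiff_unifiedHamiltonian hL _).mdifferentiableAt (by simp))
      (hsol _ (mem_range_self x)) (by
        -- `pr₂ ∘ legendreGraph L` is `legendre L` by definition, so the restricted form is `Leg^* η
        -- = η_L`.
        change IsReeb (pullbackForm (legendre L) canonicalContactForm) R_L
        rw [← hform]
        exact hReeb) (hXL x)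
    rw [henergy] at h1
    change ContactEqAt (pullbackForm (legendre L) canonicalContactForm) R_L (energy L) X_L x at h1
    rwa [← hform] at h1
  refine ⟨R_L, X_L, hRs, hReeb, smoothVFieldOn_mfderiv contMDiff_pr₁ hX hg.contMDiffOn, hcontact,
    fun R h => h.unique hnd hReeb, fun Y h => funext fun x => (h x).unique (hnd x) (hcontact x), ?_,
    exists_isOpen_injOn hreg, ?_⟩
  · rintro _ ⟨x, rfl⟩
    rfl
  intro U hU hinj
  obtain ⟨σ, hσ⟩ : ∃ σ : PhaseSpace E Q m → XJet E Q (2 * m + 1),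
      ∀ x ∈ U, σ (legendre L x) = x := by
    have h : ∀ y : PhaseSpace E Q m, ∃ x, ∀ x' ∈ U, legendre L x' = y → x = x' := by
      intro y
      by_cases hy : ∃ x ∈ U, legendre L x = y
      · obtain ⟨x, hx, rfl⟩ := hy
        exact ⟨x, fun x' hx' he => hinj hx hx' he.symm⟩
      -- Off the image of `U` the value of `σ` is irrelevant, but some point must exist; one is
      -- found over the base point of `y`.
      · obtain ⟨x, -⟩ := xProj_surjective (base_le m) ((y.1.proj, y.2) : XJet E Q m)
        exact ⟨x, fun x' hx' he => absurd ⟨x', hx', he⟩ hy⟩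
    choose σ hσ using h
    exact ⟨σ, fun x hx => hσ _ x hx rfl⟩
  have hσs := contMDiffOn_leftInverse hreg hU hσ
  -- The ascription to the model space is needed since `Leg (σ y) = y` is known only on `Leg(U)`;
  -- elsewhere the value has no meaning.
  let X_H : VField (IP E m) (PhaseSpace E Q m) := fun y =>
    (mfderiv (IW E m) (IP E m) pr₂ (legendreGraph L (σ y)) (X (legendreGraph L (σ y))) :
      (JetModel E m × (JetModel E m →L[ℝ] ℝ)) × ℝ)
  have hXH : ∀ x ∈ U, X_H (legendre L x) =
      mfderiv (IW E m) (IP E m) pr₂ (legendreGraph L x) (X (legendreGraph L x)) := fun x hx =>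
    congrArg (fun x' => (mfderiv (IW E m) (IP E m) pr₂ (legendreGraph L x')
      (X (legendreGraph L x')) : (JetModel E m × (JetModel E m →L[ℝ] ℝ)) × ℝ)) (hσ x hx)
  have hHs : ContMDiffOn (IP E m) 𝓘(ℝ, ℝ) ∞ (energy L ∘ σ) (legendre L '' U) :=
    hEs.comp_contMDiffOn hσs
  have hopen : IsOpen (legendre L '' U) := hreg.isOpenMap U hU
  refine ⟨hopen, energy L ∘ σ, X_H, hHs, fun x hx => congrArg (energy L) (hσ x hx), ?_, ?_, ?_, ?_,
    fun x hx => (hTLeg x).trans (hXH x hx).symm⟩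
  · rintro _ ⟨x, rfl⟩ hx
    exact (unifiedHamiltonian_legendreGraph hL x).trans (congrArg (energy L) (hσ x hx)).symm
  · refine (smoothVFieldOn_mfderiv contMDiff_pr₂ hX (hg.comp_contMDiffOn hσs)).congr ?_
    rintro _ ⟨x, hx, rfl⟩
    exact tangentBundle_mk_congr (congrArg (legendre L) (hσ x hx)).symm rfl
  · rintro _ ⟨x, rfl⟩ hx
    exact hXH x hx
  · rintro _ ⟨x, hx, rfl⟩
    have h1 := hcontact x
    rw [hform] at h1
    refine ContactEqAt.pushforward hη hreg
      ((hHs.contMDiffAt (hopen.mem_nhds (mem_image_of_mem _ hx))).mdifferentiableAt (by simp)) ?_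
      (hR x) ((hTLeg x).trans (hXH x hx).symm) h1
    filter_upwards [hU.mem_nhds hx] with x' hx'
    exact (congrArg (energy L) (hσ x' hx')).symm
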